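/- **Setting.** Let $n\ge 2$ and let $\Omega\subset\mathbb R^n$ be a bounded connected $\mathcal C^{1,1}$ domain with connected complement, $\Gamma=\partial\Omega$, with outward unit normal $\nu$ and surface measure $\sigma$. For $j=1,2$ let $A_j\in\mathcal C^1(\overline\Omega,\mathbb R^n)$, $V_j\in L^\infty(\Omega,\mathbb R)$, and let $H_j=(-{\rm i}\nabla+A_j)^2+V_j$ act on $L^2(\Omega)$ with domain $D(H_j)=\{v\in H^1_0(\Omega):(-{\rm i}\nabla+A_j)^2v\in L^2(\Omega)\}$. Write $x\cdot y=\sum_k x_ky_k$ for $x,y\in\mathbb C^n$. Let $\lambda\in\mathbb C\setminus\mathbb R$, let $\sqrt\lambda$ be either of the two square roots of $\lambda$, let $\eta_1,\eta_2\in\mathbb S^{n-1}$, let $A_{j,\sharp}\in\mathcal C_0^\infty(\mathbb R^n,\mathbb R^n)$, $j=1,2$, and let $b_2\in W^{2,\infty}(\mathbb R^n)$ be complex valued with $\eta_2\cdot\nabla b_2=0$. Put $$\psi_j(x)=-\int_{-\infty}^0\eta_j\cdot A_{j,\sharp}(x+s\eta_j)\,ds,\qquad \Phi_1(x)=e^{{\rm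 i}\sqrt\lambda\,\eta_1\cdot x}e^{{\rm i}\psi_1(x)},\qquad \Phi_2(x)=e^{-{\rm i}\sqrt\lambda\,\eta_2\cdot x}b_2(x)e^{-{\rm i}\psi_2(x)}.$$ For $f\in H^{1/2}(\Gamma)$ let $\Lambda_{j,\lambda}f=(\partial_\nu+{\rm i}A_j\cdot\nu)u|_\Gamma=\big((\nabla+{\rm i}A_j)u\big)\cdot\nu\in H^{-1/2}(\Gamma)$, where $u\in H^1(\Omega)$ solves $(-{\rm i}\nabla+A_j)^2u+V_ju-\lambda u=0$ in $\Omega$, $u=f$ on $\Gamma$. The normal trace of a field $X\in L^2(\Omega;\mathbb C^n)$ with $\operatorname{div}X\in L^2(\Omega)$ is the element $X\cdot\nu$ of $H^{-1/2}(\Gamma)$ given by $\langle X\cdot\nu,w|_\Gamma\rangle=\int_\Omega X\cdot\overline{\nabla w}\,dx+\int_\Omega(\operatorname{div}X)\,\overline w\,dx$ for $w\in H^1(\Omega)$. Set $S_j=\langle\Lambda_{j,\lambda}\Phi_1,\overline{\Phi_2}\rangle$. **Proposition.** For $j=1,2$, $H_j-\lambda:D(H_j)\to L^2(\Omega)$ is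 bijective, the Dirichlet problem defining $\Lambda_{j,\lambda}\Phi_1$ has a unique solution in $H^1(\Omega)$, and $$\begin{aligned}S_1={}&2\sqrt\lambda\int_\Omega\eta_2\cdot(A_1-A_{2,\sharp})\,e^{{\rm i}\sqrt\lambda(\eta_1-\eta_2)\cdot x}\,b_2\,e^{{\rm i}(\psi_1-\psi_2)}dx+\int_\Omega(V_1b_2-q_{12})\,e^{{\rm i}\sqrt\lambda(\eta_1-\eta_2)\cdot x}e^{{\rm i}(\psi_1-\psi_2)}dx\\ &-{\rm i}\int_\Gamma e^{{\rm i}\sqrt\lambda(\eta_1-\eta_2)\cdot x}e^{{\rm i}(\psi_1-\psi_2)}\big(b_2\sqrt\lambda\,\eta_2+b_2\nabla\psi_2+{\rm i}\nabla b_2+b_2A_1\big)\cdot\nu\,d\sigma(x)\\ &-\int_\Omega\Big[(H_1-\lambda)^{-1}\big(2\sqrt\lambda\,\eta_1\cdot(A_1-A_{1,\sharp})+q_{11}\big)\Phi_1\Big]\big(2\sqrt\lambda\,\eta_2\cdot(A_1-A_{2,\sharp})b_2+V_1b_2-q_{12}\big)e^{-{\rm i}\sqrt\lambda\,\eta_2\cdot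 x}e^{-{\rm i}\psi_2}dx,\end{aligned}$$ $$\begin{aligned}S_2={}&\int_\Omega\big[2\sqrt\lambda\,\eta_2\cdot(A_2-A_{2,\sharp})b_2+V_2b_2-q_{22}\big]e^{{\rm i}\sqrt\lambda(\eta_1-\eta_2)\cdot x}e^{{\rm i}(\psi_1-\psi_2)}dx\\ &-{\rm i}\int_\Gamma e^{{\rm i}\sqrt\lambda(\eta_1-\eta_2)\cdot x}e^{{\rm i}(\psi_1-\psi_2)}\big(b_2\sqrt\lambda\,\eta_2+b_2\nabla\psi_2+{\rm i}\nabla b_2+b_2A_2\big)\cdot\nu\,d\sigma(x)\\ &-\int_\Omega\Big[(H_2-\lambda)^{-1}\big(2\sqrt\lambda\,\eta_1\cdot(A_2-A_{1,\sharp})+q_{21}\big)\Phi_1\Big]\big(2\sqrt\lambda\,\eta_2\cdot(A_2-A_{2,\sharp})b_2+V_2b_2-q_{22}\big)e^{-{\rm i}\sqrt\lambda\,\eta_2\cdot x}e^{-{\rm i}\psi_2}dx,\end{aligned}$$ where, for $j=1,2$, $$q_{j1}=-{\rm i}\operatorname{div}A_j+|A_j|^2+V_j+2A_j\cdot\nabla\psi_1-{\rm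 i}\Delta\psi_1+|\nabla\psi_1|^2,$$ $$q_{j2}=\Delta b_2-2{\rm i}\nabla\psi_2\cdot\nabla b_2-2{\rm i}\nabla b_2\cdot A_j+\big(-{\rm i}\Delta\psi_2-|\nabla\psi_2|^2-2\nabla\psi_2\cdot A_j-{\rm i}\operatorname{div}A_j-|A_j|^2\big)b_2.$$ -/

import Mathlib

open MeasureTheory Set Filter Topology TopologicalSpace Matrix
open scoped ContDiff NNReal ENNReal Distributions ComplexConjugate

noncomputable section

namespace MagneticSchrodinger

/-- The Euclidean space `ℝⁿ`. -/
abbrev Euc (n : ℕ) : Type := EuclideanSpace ℝ (Fin n)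

/-! ### Domains, outward normal, surface measure -/

/-- The boundary of `Ω` is of class `C^{1,1}`: near each boundary point, in suitable orthonormal
coordinates, `Ω` is the region below the graph of a `C¹` function with Lipschitz derivative. -/
def HasC11Boundary {n : ℕ} (Ω : Set (Euc n)) : Prop :=
  ∀ x₀ ∈ frontier Ω,
    ∃ (T : Euc n ≃ₗᵢ[ℝ] WithLp 2 (Euc (n - 1) × ℝ)) (γ : Euc (n - 1) → ℝ) (K : ℝ≥0)
      (U : Set (Euc n)),
      ContDiff ℝ 1 γ ∧ LipschitzWith K (fderiv ℝ γ) ∧ IsOpen U ∧ x₀ ∈ U ∧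
        ∀ x ∈ U, x ∈ Ω ↔ (T x).snd < γ (T x).fst

/-- Bounded connected `C^{1,1}` domains with connected complement. -/
structure IsAdmissibleDomain {n : ℕ} (Ω : Opens (Euc n)) : Prop where
  bounded : Bornology.IsBounded (Ω : Set (Euc n))
  connected : IsConnected (Ω : Set (Euc n))
  connected_compl : IsConnected ((Ω : Set (Euc n))ᶜ)
  c11 : HasC11Boundary (Ω : Set (Euc n))

/-- `v` is the outward unit normal vector to `∂Ω` at `x`: to first order at `x`, the set `Ω` is the
half space `{y | ⟨v, y - x⟩ < 0}`. -/
def IsOutwardUnitNormal {n : ℕ} (Ω : Set (Euc n)) (x v : Euc n) : Prop :=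
  ‖v‖ = 1 ∧ ∀ ε > 0, ∀ᶠ y in 𝓝 x,
    (y ∈ Ω → inner ℝ v (y - x) ≤ ε * ‖y - x‖) ∧
    (y ∉ Ω → -(ε * ‖y - x‖) ≤ inner ℝ v (y - x))

open Classical in
/-- The outward unit normal vector field `ν` (zero where there is none). -/
def outwardNormal {n : ℕ} (Ω : Set (Euc n)) (x : Euc n) : Euc n :=
  if h : ∃ v, IsOutwardUnitNormal Ω x v then h.choose else 0

/-- The surface measure `σ` on `∂Ω`: the `(n-1)`-dimensional Hausdorff measure, normalized so as to
agree with Lebesgue measure on `(n-1)`-dimensional subspaces. -/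
def surfaceMeasure {n : ℕ} (Ω : Set (Euc n)) : Measure (Euc n) :=
  (Measure.euclideanHausdorffMeasure (n - 1)).restrict (frontier Ω)

/-! ### Vector calculus; the product `x · y = ∑ xₖ yₖ` on `ℂⁿ` is `x ⬝ᵥ y` -/

/-- A real vector seen in `ℂⁿ`. -/
def toC {n : ℕ} (v : Euc n) : Fin n → ℂ := fun k => ((v k : ℝ) : ℂ)

/-- `η · x` for real vectors, as a complex number. -/
def rdot {n : ℕ} (η x : Euc n) : ℂ := ((inner ℝ η x : ℝ) : ℂ)

/-- The (classical) gradient of a complex-valued function on `ℝⁿ`. -/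
def grad {n : ℕ} (f : Euc n → ℂ) (x : Euc n) : Fin n → ℂ :=
  fun k => fderiv ℝ f x (EuclideanSpace.single k 1)

/-- The divergence of a real vector field. -/
def divergence {n : ℕ} (A : Euc n → Euc n) (x : Euc n) : ℝ :=
  ∑ k, (fderiv ℝ A x (EuclideanSpace.single k 1)) k

/-- `W^{2,∞}(ℝⁿ)`, each class being represented by its `C¹` element: bounded `C¹` functions with
bounded and Lipschitz first derivatives. -/
structure IsW2Infty {n : ℕ} (b : Euc n → ℂ) : Prop where
  contDiff : ContDiff ℝ 1 b
  bounded : ∃ C : ℝ, ∀ x, ‖b x‖ ≤ C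
  bounded_fderiv : ∃ C : ℝ, ∀ x, ‖fderiv ℝ b x‖ ≤ C
  lipschitz_fderiv : ∃ K : ℝ≥0, LipschitzWith K (fderiv ℝ b)

/-! ### Sobolev spaces -/

/-- `L²(Ω)` with complex values. -/
abbrev L2 {n : ℕ} (Ω : Opens (Euc n)) : Type := Lp ℂ 2 (volume.restrict (Ω : Set (Euc n)))

open Classical in
/-- The class in `L²(Ω)` of a square integrable function (zero for other functions). -/
def toL2 {n : ℕ} (Ω : Opens (Euc n)) (f : Euc n → ℂ) : L2 Ω :=
  if h : MemLp f 2 (volume.restrict (Ω : Set (Euc n))) then h.toLp f else 0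

/-- `∂ₖ u = g` in the sense of distributions on `Ω`. -/
def HasWeakPartial {n : ℕ} {Ω : Opens (Euc n)} (k : Fin n) (u g : L2 Ω) : Prop :=
  ∀ φ : 𝓓(Ω, ℂ), ∫ x in (Ω : Set (Euc n)), u x * grad φ x k
    = -∫ x in (Ω : Set (Euc n)), g x * φ x

/-- `u ∈ H¹(Ω)`. -/
def MemH1 {n : ℕ} {Ω : Opens (Euc n)} (u : L2 Ω) : Prop :=
  ∀ k, ∃ g : L2 Ω, HasWeakPartial k u g

open Classical in
/-- The weak partial derivative `∂ₖ u ∈ L²(Ω)` (zero if there is none). -/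
def weakPartial {n : ℕ} {Ω : Opens (Euc n)} (k : Fin n) (u : L2 Ω) : L2 Ω :=
  if h : ∃ g : L2 Ω, HasWeakPartial k u g then h.choose else 0

/-- `u ∈ H¹₀(Ω)`, the closure of `C_c^∞(Ω)` in `H¹(Ω)`. -/
def MemH10 {n : ℕ} {Ω : Opens (Euc n)} (u : L2 Ω) : Prop :=
  MemH1 u ∧ ∀ ε > 0, ∃ φ : 𝓓(Ω, ℂ), ‖u - toL2 Ω φ‖ ≤ ε ∧
    ∀ k, ‖weakPartial k u - toL2 Ω (fun x => grad φ x k)‖ ≤ ε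

/-- `div X = d` in the sense of distributions on `Ω`. -/
def HasWeakDiv {n : ℕ} {Ω : Opens (Euc n)} (X : Fin n → L2 Ω) (d : L2 Ω) : Prop :=
  ∀ φ : 𝓓(Ω, ℂ), ∑ k, ∫ x in (Ω : Set (Euc n)), X k x * grad φ x k
    = -∫ x in (Ω : Set (Euc n)), d x * φ x

open Classical in
/-- The divergence in `L²(Ω)` of a field `X ∈ H_div(Ω)` (zero for other fields). -/
def weakDiv {n : ℕ} {Ω : Opens (Euc n)} (X : Fin n → L2 Ω) : L2 Ω :=
  if h : ∃ d : L2 Ω, HasWeakDiv X d then h.choose else 0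

/-- The pairing `⟨X · ν, w⟩` between the normal trace `X · ν ∈ H^{-1/2}(∂Ω)` of a field
`X ∈ H_div(Ω)` and the boundary value in `H^{1/2}(∂Ω)` of `w ∈ H¹(Ω)`, antilinear in `w`. -/
def normalTracePairing {n : ℕ} {Ω : Opens (Euc n)} (X : Fin n → L2 Ω) (w : L2 Ω) : ℂ :=
  (∑ k, ∫ x in (Ω : Set (Euc n)), X k x * conj (weakPartial k w x))
    + ∫ x in (Ω : Set (Euc n)), weakDiv X x * conj (w x)

/-! ### The magnetic Schrödinger operator, its resolvent and its Dirichlet-to-Neumann map -/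

/-- `(-i∇ + A)² u + V u = f` in the sense of distributions on `Ω`, for `u ∈ H¹(Ω)`. -/
def SolvesMagnetic {n : ℕ} {Ω : Opens (Euc n)} (A : Euc n → Euc n) (V : Euc n → ℝ)
    (u f : L2 Ω) : Prop :=
  MemH1 u ∧ ∀ φ : 𝓓(Ω, ℂ),
    (∑ k, ∫ x in (Ω : Set (Euc n)),
        (-Complex.I * weakPartial k u x + toC (A x) k * u x) *
          (Complex.I * grad φ x k + toC (A x) k * φ x))
      + ∫ x in (Ω : Set (Euc n)), (V x : ℂ) * u x * φ x
    = ∫ x in (Ω : Set (Euc n)), f x * φ x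

/-- The graph of the operator `H = (-i∇ + A)² + V` acting on `L²(Ω)` with domain
`D(H) = {v ∈ H¹₀(Ω) : (-i∇ + A)² v ∈ L²(Ω)}`: the pairs `(v, H v)` with `v ∈ D(H)`. -/
def schrodingerGraph {n : ℕ} (Ω : Opens (Euc n)) (A : Euc n → Euc n) (V : Euc n → ℝ) :
    Set (L2 Ω × L2 Ω) :=
  {p | MemH10 p.1 ∧ SolvesMagnetic A V p.1 p.2}

/-- `H - lam` is a bijection from `D(H)` onto `L²(Ω)`. -/
def ResolventExists {n : ℕ} (Ω : Opens (Euc n)) (A : Euc n → Euc n) (V : Euc n → ℝ)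
    (lam : ℂ) : Prop :=
  ∀ f : L2 Ω, ∃! v : L2 Ω, (v, f + lam • v) ∈ schrodingerGraph Ω A V

open Classical in
/-- The resolvent `(H - lam)⁻¹`: it sends `f` to the `v ∈ D(H)` with `H v - lam v = f`. -/
def schrodingerResolvent {n : ℕ} (Ω : Opens (Euc n)) (A : Euc n → Euc n) (V : Euc n → ℝ)
    (lam : ℂ) (f : L2 Ω) : L2 Ω :=
  if h : ∃ v : L2 Ω, (v, f + lam • v) ∈ schrodingerGraph Ω A V then h.choose else 0

/-- `u ∈ H¹(Ω)` solves `(-i∇ + A)² u + V u - lam u = 0` in `Ω` with `u = F` on `∂Ω`, the boundary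
datum in `H^{1/2}(∂Ω)` being given as the boundary value of `F ∈ H¹(Ω)`. -/
def IsDirichletSolution {n : ℕ} {Ω : Opens (Euc n)} (A : Euc n → Euc n) (V : Euc n → ℝ)
    (lam : ℂ) (F u : L2 Ω) : Prop :=
  SolvesMagnetic A V u (lam • u) ∧ MemH10 (u - F)

open Classical in
/-- The solution of the Dirichlet problem with boundary datum `F`. -/
def dirichletSolution {n : ℕ} {Ω : Opens (Euc n)} (A : Euc n → Euc n) (V : Euc n → ℝ)
    (lam : ℂ) (F : L2 Ω) : L2 Ω :=
  if h : ∃ u : L2 Ω, IsDirichletSolution A V lam F u then h.choose else 0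

/-- The field `(∇ + iA) u`. -/
def covariantGrad {n : ℕ} {Ω : Opens (Euc n)} (A : Euc n → Euc n) (u : L2 Ω) : Fin n → L2 Ω :=
  fun k => toL2 Ω (fun x => weakPartial k u x + Complex.I * toC (A x) k * u x)

/-- The pairing `⟨Λ F, w⟩` of the Dirichlet-to-Neumann map
`Λ F = (∂_ν + i A·ν) u = ((∇ + iA) u) · ν ∈ H^{-1/2}(∂Ω)` with the boundary value of `w ∈ H¹(Ω)`,
where `u` solves the Dirichlet problem with boundary datum `F`. -/
def dnPairing {n : ℕ} {Ω : Opens (Euc n)} (A : Euc n → Euc n) (V : Euc n → ℝ)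
    (lam : ℂ) (F w : L2 Ω) : ℂ :=
  normalTracePairing (covariantGrad A (dirichletSolution A V lam F)) w

/-! ### The ansatz functions; `r` stands for `√lam` -/

/-- The (real) phase `ψ(x) = -∫_{-∞}^0 η · A♯(x + sη) ds`, as a complex-valued function. -/
def phase {n : ℕ} (η : Euc n) (As : Euc n → Euc n) (x : Euc n) : ℂ :=
  ((-∫ s in Iic (0 : ℝ), inner ℝ η (As (x + s • η)) : ℝ) : ℂ)

/-- `Φ₁(x) = e^{i r η₁·x} e^{iψ₁(x)}`. -/
def ansatz₁ {n : ℕ} (r : ℂ) (η₁ : Euc n) (ψ₁ : Euc n → ℂ) (x : Euc n) : ℂ :=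
  Complex.exp (Complex.I * r * rdot η₁ x) * Complex.exp (Complex.I * ψ₁ x)

/-- `e^{-i r η₂·x} e^{-iψ₂(x)}`. -/
def expFactor₂ {n : ℕ} (r : ℂ) (η₂ : Euc n) (ψ₂ : Euc n → ℂ) (x : Euc n) : ℂ :=
  Complex.exp (-Complex.I * r * rdot η₂ x) * Complex.exp (-Complex.I * ψ₂ x)

/-- `Φ₂(x) = e^{-i r η₂·x} b₂(x) e^{-iψ₂(x)}`. -/
def ansatz₂ {n : ℕ} (r : ℂ) (η₂ : Euc n) (b₂ ψ₂ : Euc n → ℂ) (x : Euc n) : ℂ :=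
  Complex.exp (-Complex.I * r * rdot η₂ x) * b₂ x * Complex.exp (-Complex.I * ψ₂ x)

/-- `e^{i r (η₁ - η₂)·x} e^{i(ψ₁(x) - ψ₂(x))}`. -/
def expFactor₁₂ {n : ℕ} (r : ℂ) (η₁ η₂ : Euc n) (ψ₁ ψ₂ : Euc n → ℂ) (x : Euc n) : ℂ :=
  Complex.exp (Complex.I * r * rdot (η₁ - η₂) x) * Complex.exp (Complex.I * (ψ₁ x - ψ₂ x))

/-- `S = ⟨Λ Φ₁, conj Φ₂⟩`. -/
def pairingS {n : ℕ} (Ω : Opens (Euc n)) (A : Euc n → Euc n) (V : Euc n → ℝ)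
    (lam r : ℂ) (η₁ η₂ : Euc n) (b₂ ψ₁ ψ₂ : Euc n → ℂ) : ℂ :=
  dnPairing A V lam (toL2 Ω (ansatz₁ r η₁ ψ₁)) (toL2 Ω (fun x => conj (ansatz₂ r η₂ b₂ ψ₂ x)))

/-- `-i div A + |A|² + V + 2 A·∇ψ₁ - i Δψ₁ + |∇ψ₁|²`. -/
def q₁ {n : ℕ} (A : Euc n → Euc n) (V : Euc n → ℝ) (ψ₁ : Euc n → ℂ) (x : Euc n) : ℂ :=
  -Complex.I * divergence A x + (‖A x‖ : ℂ) ^ 2 + V x + 2 * (toC (A x) ⬝ᵥ grad ψ₁ x)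
    - Complex.I * Laplacian.laplacian ψ₁ x + grad ψ₁ x ⬝ᵥ grad ψ₁ x

/-- `Δb₂ - 2i ∇ψ₂·∇b₂ - 2i ∇b₂·A + (-iΔψ₂ - |∇ψ₂|² - 2∇ψ₂·A - i div A - |A|²) b₂`. -/
def q₂ {n : ℕ} (A : Euc n → Euc n) (b₂ ψ₂ : Euc n → ℂ) (x : Euc n) : ℂ :=
  Laplacian.laplacian b₂ x - 2 * Complex.I * (grad ψ₂ x ⬝ᵥ grad b₂ x)
    - 2 * Complex.I * (grad b₂ x ⬝ᵥ toC (A x))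
    + (-Complex.I * Laplacian.laplacian ψ₂ x - grad ψ₂ x ⬝ᵥ grad ψ₂ x
        - 2 * (grad ψ₂ x ⬝ᵥ toC (A x)) - Complex.I * divergence A x - (‖A x‖ : ℂ) ^ 2) * b₂ x

end MagneticSchrodinger

end

open MagneticSchrodinger

namespace MagneticSchrodinger

/-! ### Calculus of locally Lipschitz functions -/

section Lipschitz

/-! Both formulas are one Green identity, proved for a general pair (A, V) and applied twice. The
phases ψ_j are integrals of −η_j·A_{j,♯} along half lines, so they solve the transport equation
η_j·∇ψ_j = −η_j·A_{j,♯} (`fderiv_phase`). Squaring the momentum on a modulated plane wave produces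
the square of the vector √λ η + ∇ψ + A. Its leading part λ cancels the spectral parameter, and by
the transport equation its part of order √λ is 2√λ η·(A − A_♯). Thus (H − λ)Φ₁ = g, where g is the
source fed to the resolvent in the statement. With −i replaced by i, also ((i∇ + A)² + V − λ)Φ₂ = G,
where η₂·∇b₂ = 0 removes the other term of order √λ (`momentum_ansatz₁`, `momentum_ansatz₂`).

As λ is not real, the form of H − λ is bounded below on H¹₀: its imaginary part controls the L²
norm, and its modulus then controls the gradient. Lax–Milgram gives the resolvent
(`resolventExists`), and the Dirichlet solution is u = Φ₁ − v with v = (H − λ)⁻¹g in H¹₀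
(`isDirichletSolution_iff`). The equation determines the divergence of (∇ + iA)u. An integration by
parts, in which v has no boundary contribution, turns the pairing into ∫ u G − i ∫_Γ Φ₁ ((i∇ +
A)Φ₂)·ν (`normalTracePairing_covariantGrad`). Inserting u = Φ₁ − v gives the integrals of the
statement; the formula for S₁ only splits the first one in two.

The boundary term needs the divergence theorem with ν defined by first-order approximation and σ
defined as Hausdorff measure (`divergenceFormula`). It is localized to charts, where it becomes a
statement about a subgraph combined with the area formula for graphs.

The field (i∇ + A)Φ₂ is only locally Lipschitz, because ∇b₂ is only Lipschitz. All calculus is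
therefore done for locally Lipschitz functions, with pointwise identities almost everywhere by
Rademacher. The potential A, which is controlled only on the closure of Ω, is replaced by a
Lipschitz extension; no quantity in the statement sees the change. -/

theorem locallyLipschitz_mul {X : Type*} [PseudoEMetricSpace X] {f g : X → ℂ}
    (hf : LocallyLipschitz f) (hg : LocallyLipschitz g) :
    LocallyLipschitz (fun x => f x * g x) := by
  have h : LocallyLipschitz (fun p : ℂ × ℂ => p.1 * p.2) :=
    ((contDiff_fst.mul contDiff_snd : ContDiff ℝ 1 (fun p : ℂ × ℂ => p.1 * p.2))).locallyLipschitz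
  exact h.comp (hf.prodMk hg)

/-- Compactness gives a Lipschitz constant on the closed 1-neighbourhood of the support. A point of
the support and a point outside that neighbourhood are at distance at least 1, so there the sup
bound is itself a Lipschitz bound. -/
theorem locallyLipschitz_lipschitzWith_of_hasCompactSupport {X F : Type*} [MetricSpace X]
    [ProperSpace X] [NormedAddCommGroup F] {f : X → F} (hf : LocallyLipschitz f)
    (hc : HasCompactSupport f) : ∃ K, LipschitzWith K f := by
  have hT : IsCompact (Metric.cthickening 1 (tsupport f)) := hc.isCompact.cthickening
  obtain ⟨K, hK⟩ := LocallyLipschitzOn.exists_lipschitzOnWith_of_compact hT hf.locallyLipschitzOn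
  obtain ⟨M, hM⟩ := hf.continuous.bounded_above_of_compact_support hc
  have hM0 : ∀ x y : X, x ∈ tsupport f → y ∉ tsupport f →
      dist (f x) (f y) ≤ max K (Real.toNNReal M) * dist x y := by
    intro x y hx hy
    by_cases hy' : y ∈ Metric.cthickening 1 (tsupport f)
    · refine (hK.dist_le_mul x (Metric.self_subset_cthickening _ hx) y hy').trans ?_
      gcongr
      exact le_max_left _ _
    · have h1 : 1 ≤ dist x y := by
        by_contra! h
        exact hy' (Metric.mem_cthickening_of_dist_le y x 1 _ hx (by rw [dist_comm]; exact h.le))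
      rw [image_eq_zero_of_notMem_tsupport hy, dist_zero_right]
      calc ‖f x‖ ≤ M := hM x
        _ ≤ (Real.toNNReal M : ℝ) * 1 := by simp
        _ ≤ _ := by
            gcongr
            exact le_max_right _ _
  refine ⟨max K (Real.toNNReal M), LipschitzWith.of_dist_le_mul fun x y => ?_⟩
  by_cases hx : x ∈ tsupport f <;> by_cases hy : y ∈ tsupport f
  · refine (hK.dist_le_mul x (Metric.self_subset_cthickening _ hx) y
      (Metric.self_subset_cthickening _ hy)).trans ?_
    gcongr
    exact le_max_left _ _
  · exact hM0 x y hx hy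
  · rw [dist_comm, dist_comm x]; exact hM0 y x hy hx
  · rw [image_eq_zero_of_notMem_tsupport hx, image_eq_zero_of_notMem_tsupport hy, dist_self]
    positivity

variable {E : Type*} [NormedAddCommGroup E] [NormedSpace ℝ E] [FiniteDimensional ℝ E]
  {F : Type*} [NormedAddCommGroup F] [NormedSpace ℝ F]

theorem locallyLipschitz_norm_fderiv_le {f : E → F} (hf : LocallyLipschitz f) {s : Set E}
    (hs : Bornology.IsBounded s) : ∃ C : ℝ, ∀ x ∈ s, ‖fderiv ℝ f x‖ ≤ C := by
  obtain ⟨R, hR⟩ := hs.subset_closedBall 0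
  have : ProperSpace E := FiniteDimensional.proper ℝ E
  obtain ⟨K, hK⟩ := LocallyLipschitzOn.exists_lipschitzOnWith_of_compact
    (isCompact_closedBall (0 : E) (R + 1)) hf.locallyLipschitzOn
  refine ⟨K, fun x hx => norm_fderiv_le_of_lipschitzOn ℝ (s := Metric.closedBall 0 (R + 1)) ?_ hK⟩
  have h1 : dist x 0 ≤ R := hR hx
  exact Metric.closedBall_mem_nhds_of_mem (by simpa using lt_of_le_of_lt h1 (by simp))

variable [MeasurableSpace E] [BorelSpace E] (μ : Measure E) [μ.IsAddHaarMeasure]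

/-- Rademacher's theorem on each ball of integer radius; countably many null sets are discarded. -/
theorem locallyLipschitz_ae_differentiableAt [FiniteDimensional ℝ F] {f : E → F}
    (hf : LocallyLipschitz f) : ∀ᵐ x ∂μ, DifferentiableAt ℝ f x := by
  have : ProperSpace E := FiniteDimensional.proper ℝ E
  have h : ∀ m : ℕ, ∀ᵐ x ∂μ, x ∈ Metric.ball (0 : E) m → DifferentiableAt ℝ f x := by
    intro m
    obtain ⟨K, hK⟩ := LocallyLipschitzOn.exists_lipschitzOnWith_of_compact
      (isCompact_closedBall (0 : E) m) hf.locallyLipschitzOn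
    filter_upwards [hK.ae_differentiableWithinAt_of_mem (μ := μ)] with x hx hxm
    exact (hx (Metric.ball_subset_closedBall hxm)).differentiableAt
      (mem_of_superset (Metric.isOpen_ball.mem_nhds hxm) Metric.ball_subset_closedBall)
  filter_upwards [ae_all_iff.2 h] with x hx
  obtain ⟨m, hm⟩ := exists_nat_gt ‖x‖
  exact hx m (by simpa using hm)

theorem locallyLipschitz_integrable_fderiv_mul {f g : E → ℂ} (hf : LocallyLipschitz f)
    (hg : Continuous g) (hc : HasCompactSupport g) (v : E) :
    Integrable (fun x => fderiv ℝ f x v * g x) μ := by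
  obtain ⟨C, hC⟩ := locallyLipschitz_norm_fderiv_le hf hc.isCompact.isBounded
  have h1 : Integrable (fun x => C * ‖v‖ * ‖g x‖) μ :=
    (hg.norm.integrable_of_hasCompactSupport hc.norm).const_mul _
  refine h1.mono' ((measurable_fderiv_apply_const ℝ f v).mul hg.measurable).aestronglyMeasurable ?_
  filter_upwards with x
  by_cases hx : x ∈ tsupport g
  · rw [norm_mul]
    gcongr
    exact (ContinuousLinearMap.le_opNorm _ _).trans (by gcongr; exact hC x hx)
  · simp [image_eq_zero_of_notMem_tsupport hx]

theorem locallyLipschitz_integral_fderiv_eq_zero_real {f : E → ℝ} (hf : LocallyLipschitz f)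
    (hc : HasCompactSupport f) (v : E) : ∫ x, fderiv ℝ f x v ∂μ = 0 := by
  have : ProperSpace E := FiniteDimensional.proper ℝ E
  obtain ⟨K, hK⟩ := locallyLipschitz_lipschitzWith_of_hasCompactSupport hf hc
  -- Integration by parts against the constant 1; the direction is −v because the formula reverses
  -- it.
  have h := LipschitzWith.integral_lineDeriv_mul_eq (μ := μ) (LipschitzWith.const (1 : ℝ) :
    LipschitzWith 0 (fun _ : E => (1 : ℝ))) hK hc (-v)
  have h0 : ∀ x : E, lineDeriv ℝ (fun _ : E => (1 : ℝ)) x (-v) = 0 := fun x => by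
    simp [lineDeriv]
  simp only [h0, neg_neg, mul_one, zero_mul, integral_zero] at h
  rw [h]
  refine integral_congr_ae ?_
  filter_upwards [locallyLipschitz_ae_differentiableAt μ hf] with x hx
  exact hx.lineDeriv_eq_fderiv.symm

theorem locallyLipschitz_integrable_fderiv {f : E → ℂ} (hf : LocallyLipschitz f)
    (hc : HasCompactSupport f) (v : E) : Integrable (fun x => fderiv ℝ f x v) μ := by
  have : ProperSpace E := FiniteDimensional.proper ℝ E
  obtain ⟨C, hC⟩ := locallyLipschitz_norm_fderiv_le hf hc.isCompact.isBounded
  have h1 : Integrable ((tsupport f).indicator (fun _ => C * ‖v‖)) μ :=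
    (integrable_indicator_iff (isClosed_tsupport f).measurableSet).2
      (integrableOn_const hc.isCompact.measure_lt_top.ne)
  refine h1.mono' (measurable_fderiv_apply_const ℝ f v).aestronglyMeasurable ?_
  filter_upwards with x
  by_cases hx : x ∈ tsupport f
  · rw [indicator_of_mem hx]
    exact (ContinuousLinearMap.le_opNorm _ _).trans (by gcongr; exact hC x hx)
  · rw [indicator_of_notMem hx, fderiv_of_notMem_tsupport ℝ hx]
    simp

theorem locallyLipschitz_integral_fderiv_eq_zero {f : E → ℂ} (hf : LocallyLipschitz f)
    (hc : HasCompactSupport f) (v : E) : ∫ x, fderiv ℝ f x v ∂μ = 0 := by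
  have hint := locallyLipschitz_integrable_fderiv μ hf hc v
  have key : ∀ L : ℂ →L[ℝ] ℝ, L (∫ x, fderiv ℝ f x v ∂μ) = 0 := by
    intro L
    rw [← L.integral_comp_comm hint]
    have hL : LocallyLipschitz (fun x => L (f x)) := L.lipschitz.locallyLipschitz.comp hf
    rw [← locallyLipschitz_integral_fderiv_eq_zero_real μ hL (hc.comp_left (map_zero L)) v]
    refine integral_congr_ae ?_
    filter_upwards [locallyLipschitz_ae_differentiableAt μ hf] with x hx
    have := (L.hasFDerivAt.comp x hx.hasFDerivAt).fderiv
    simp only [Function.comp_def] at this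
    rw [this]
    rfl
  exact Complex.ext (key Complex.reCLM) (key Complex.imCLM)

/-- The derivative of the compactly supported product f g has integral zero, and the product rule
holds almost everywhere. -/
theorem locallyLipschitz_integral_fderiv_mul {f g : E → ℂ} (hf : LocallyLipschitz f)
    (hg : LocallyLipschitz g) (hc : HasCompactSupport g) (v : E) :
    ∫ x, fderiv ℝ f x v * g x ∂μ = -∫ x, f x * fderiv ℝ g x v ∂μ := by
  have h0 := locallyLipschitz_integral_fderiv_eq_zero μ (locallyLipschitz_mul hf hg) hc.mul_left v
  have i1 := locallyLipschitz_integrable_fderiv_mul μ hf hg.continuous hc v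
  have i0 := locallyLipschitz_integrable_fderiv μ (locallyLipschitz_mul hf hg) hc.mul_left v
  have e : ∀ᵐ x ∂μ, fderiv ℝ (fun x => f x * g x) x v
      = fderiv ℝ f x v * g x + f x * fderiv ℝ g x v := by
    filter_upwards [locallyLipschitz_ae_differentiableAt μ hf,
      locallyLipschitz_ae_differentiableAt μ hg] with x hx hy
    rw [fderiv_fun_mul hx hy]
    simp
    ring
  have i2 : Integrable (fun x => f x * fderiv ℝ g x v) μ := by
    refine (i0.sub i1).congr ?_
    filter_upwards [e] with x hx
    simp [hx]
  rw [integral_congr_ae e, integral_add i1 i2] at h0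
  exact eq_neg_of_add_eq_zero_left h0

end Lipschitz

/-! ### Surface measure of a graph -/

section Area

/-- By second countability countably many of the neighbourhoods cover the space. Making them
disjoint lets the local inequalities be summed. -/
theorem measure_le_of_locally_le {X : Type*} [TopologicalSpace X] [SecondCountableTopology X]
    [MeasurableSpace X] [BorelSpace X] {μ ν : Measure X}
    (h : ∀ x, ∃ U : Set X, IsOpen U ∧ x ∈ U ∧ ∀ s ⊆ U, MeasurableSet s → ν s ≤ μ s) : ν ≤ μ := by
  choose U hUo hxU hU using h
  obtain ⟨t, htc, ht⟩ := TopologicalSpace.countable_cover_nhds fun x => (hUo x).mem_nhds (hxU x)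
  refine Measure.le_iff.2 fun s hs => ?_
  rcases t.eq_empty_or_nonempty with rfl | hne
  · have : s = ∅ := by
      rw [← subset_empty_iff]
      refine (subset_univ s).trans (by rw [← ht]; simp)
    simp [this]
  obtain ⟨f, rfl⟩ := htc.exists_eq_range hne
  have hcov : ⋃ n, U (f n) = univ := by rw [← ht, biUnion_range]
  have hm : ∀ n, MeasurableSet (disjointed (fun n => U (f n)) n) :=
    MeasurableSet.disjointed fun n => (hUo _).measurableSet
  have hs' : s = ⋃ n, s ∩ disjointed (fun n => U (f n)) n := by
    rw [← inter_iUnion, iUnion_disjointed, hcov, inter_univ]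
  have hd : Pairwise (Function.onFun Disjoint fun n => s ∩ disjointed (fun n => U (f n)) n) :=
    fun i j hij => (disjoint_disjointed _ hij).mono inter_subset_right inter_subset_right
  rw [hs', measure_iUnion hd fun n => hs.inter (hm n), measure_iUnion hd fun n => hs.inter (hm n)]
  exact ENNReal.tsum_le_tsum fun n =>
    hU (f n) _ (inter_subset_right.trans (disjointed_subset _ _)) (hs.inter (hm n))

/-- The hypothesis forces f to factor through g on s, by a K-Lipschitz map from g(s) onto f(s); such
a map enlarges d-dimensional Hausdorff measure by at most K^d. -/
theorem euclideanHausdorffMeasure_image_le_of_norm_sub_le {X W W' : Type*}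
    [NormedAddCommGroup W] [MeasurableSpace W] [BorelSpace W]
    [NormedAddCommGroup W'] [MeasurableSpace W'] [BorelSpace W'] (d : ℕ)
    {f : X → W} {g : X → W'} {s : Set X} {K : ℝ≥0}
    (h : ∀ x ∈ s, ∀ y ∈ s, ‖f x - f y‖ ≤ K * ‖g x - g y‖) :
    (Measure.euclideanHausdorffMeasure d : Measure W) (f '' s)
      ≤ (K : ℝ≥0∞) ^ d * (Measure.euclideanHausdorffMeasure d : Measure W') (g '' s) := by
  rcases s.eq_empty_or_nonempty with rfl | ⟨x0, hx0⟩
  · simp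
  have : Nonempty X := ⟨x0⟩
  have hinv : ∀ x ∈ s, Function.invFunOn g s (g x) ∈ s ∧ g (Function.invFunOn g s (g x)) = g x :=
    fun x hx => ⟨Function.invFunOn_mem ⟨x, hx, rfl⟩, Function.invFunOn_eq ⟨x, hx, rfl⟩⟩
  have himg : f '' s = (f ∘ Function.invFunOn g s) '' (g '' s) := by
    rw [image_image]
    refine image_congr fun x hx => ?_
    have := h x hx _ (hinv x hx).1
    rw [(hinv x hx).2, sub_self, norm_zero, mul_zero, norm_le_zero_iff, sub_eq_zero] at this
    exact this
  have hl : LipschitzOnWith K (f ∘ Function.invFunOn g s) (g '' s) := by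
    refine LipschitzOnWith.of_dist_le_mul ?_
    rintro _ ⟨x, hx, rfl⟩ _ ⟨y, hy, rfl⟩
    rw [dist_eq_norm, dist_eq_norm]
    have := h _ (hinv x hx).1 _ (hinv y hy).1
    rwa [(hinv x hx).2, (hinv y hy).2] at this
  rw [himg]
  simp only [Measure.euclideanHausdorffMeasure_def, Measure.smul_apply, ENNReal.smul_def,
    smul_eq_mul]
  have := hl.hausdorffMeasure_image_le (d := d) (by positivity)
  rw [ENNReal.rpow_natCast] at this
  calc _ ≤ _ := mul_le_mul_right this _
    _ = _ := by ring

variable {d : ℕ}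

/-- The linear map `x ↦ (x, a x)`. -/
noncomputable def graphLinear (a : Euc d →L[ℝ] ℝ) : Euc d →L[ℝ] WithLp 2 (Euc d × ℝ) :=
  (WithLp.prodContinuousLinearEquiv 2 ℝ (Euc d) ℝ).symm.toContinuousLinearMap ∘L
    ((ContinuousLinearMap.id ℝ (Euc d)).prod a)

theorem graphLinear_apply (a : Euc d →L[ℝ] ℝ) (x : Euc d) :
    graphLinear a x = WithLp.toLp 2 (x, a x) := rfl

theorem norm_le_norm_graphLinear (a : Euc d →L[ℝ] ℝ) (x : Euc d) : ‖x‖ ≤ ‖graphLinear a x‖ := by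
  rw [graphLinear_apply, WithLp.prod_norm_eq_of_L2]
  exact Real.le_sqrt_of_sq_le (by simp [sq_nonneg])

theorem norm_graphLinear_sub_le (a b : Euc d →L[ℝ] ℝ) (x : Euc d) :
    ‖graphLinear a x - graphLinear b x‖ ≤ ‖a - b‖ * ‖x‖ := by
  have : ‖graphLinear a x - graphLinear b x‖ = ‖(a - b) x‖ := by
    rw [graphLinear_apply, graphLinear_apply, ← WithLp.toLp_sub, WithLp.prod_norm_eq_of_L2]
    simp [Real.sqrt_sq_eq_abs]
  rw [this]
  exact (a - b).le_opNorm x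

/-- With v the Riesz representative of a, the adjoint composed with the graph map is the
transvection x ↦ x + a(x) v, whose determinant is 1 + a(v) = 1 + ‖a‖². -/
theorem normDet_graphLinear (a : Euc d →L[ℝ] ℝ) :
    (graphLinear a : Euc d →ₗ[ℝ] WithLp 2 (Euc d × ℝ)).normDet = √(1 + ‖a‖ ^ 2) := by
  have h := ContinuousLinearMap.normDet_sq (graphLinear a)
  set v := (InnerProductSpace.toDual ℝ (Euc d)).symm a with hv
  have hva : ∀ x, inner ℝ v x = a x := fun x => by simp [hv]
  have e : (((graphLinear a).adjoint ∘L graphLinear a : Euc d →L[ℝ] Euc d) : Euc d →ₗ[ℝ] Euc d)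
      = LinearMap.transvection (a : Euc d →ₗ[ℝ] ℝ) v := by
    ext1 x
    refine ext_inner_left ℝ fun y => ?_
    rw [LinearMap.transvection.apply]
    change inner ℝ y ((graphLinear a).adjoint (graphLinear a x)) = inner ℝ y (x + a x • v)
    rw [ContinuousLinearMap.adjoint_inner_right, graphLinear_apply, graphLinear_apply,
      WithLp.prod_inner_apply, inner_add_right, inner_smul_right, real_inner_comm v y, hva]
    simp
  have hn : ‖v‖ = ‖a‖ := by simp [hv]
  have hav : a v = ‖a‖ ^ 2 := by rw [← hva, real_inner_self_eq_norm_sq, hn]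
  rw [ContinuousLinearMap.det, e, LinearMap.transvection.det] at h
  simp only [ContinuousLinearMap.coe_coe, hav] at h
  rw [← h]
  exact (Real.sqrt_sq (LinearMap.normDet_nonneg _)).symm

theorem measure_graphLinear_image (a : Euc d →L[ℝ] ℝ) (s : Set (Euc d)) :
    (Measure.euclideanHausdorffMeasure d : Measure (WithLp 2 (Euc d × ℝ))) (graphLinear a '' s)
      = ENNReal.ofReal (√(1 + ‖a‖ ^ 2)) * volume s := by
  have h := LinearMap.euclideanHausdorffMeasure_image_eq_normDet_mul_volume
    (graphLinear a : Euc d →ₗ[ℝ] WithLp 2 (Euc d × ℝ)) s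
  rw [normDet_graphLinear, finrank_euclideanSpace_fin] at h
  exact h

/-- The parametrization `y ↦ (y, γ y)` of the graph of `γ`. -/
noncomputable def graphMap (γ : Euc d → ℝ) (y : Euc d) : WithLp 2 (Euc d × ℝ) :=
  WithLp.toLp 2 (y, γ y)

theorem continuous_graphMap {γ : Euc d → ℝ} (hγ : Continuous γ) : Continuous (graphMap γ) :=
  (WithLp.prod_continuous_toLp 2 _ _).comp (continuous_id.prodMk hγ)

theorem graphMap_injective (γ : Euc d → ℝ) : Function.Injective (graphMap γ) := by
  intro x y h
  exact congrArg (fun p : WithLp 2 (Euc d × ℝ) => p.fst) h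

theorem measurableEmbedding_graphMap {γ : Euc d → ℝ} (hγ : Continuous γ) :
    MeasurableEmbedding (graphMap γ) :=
  (continuous_graphMap hγ).measurableEmbedding (graphMap_injective γ)

theorem hasStrictFDerivAt_graphMap {γ : Euc d → ℝ} (hγ : ContDiff ℝ 1 γ) (x : Euc d) :
    HasStrictFDerivAt (graphMap γ) (graphLinear (fderiv ℝ γ x)) x := by
  have h1 : HasStrictFDerivAt γ (fderiv ℝ γ x) x :=
    hγ.contDiffAt.hasStrictFDerivAt (by simp)
  exact (WithLp.prodContinuousLinearEquiv 2 ℝ (Euc d) ℝ).symm.hasStrictFDerivAt.comp x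
    ((hasStrictFDerivAt_id x).prodMk h1)

/-- The condition c ≤ 1/2 is what makes 1/(1 − c) ≤ 1 + 2c, so that one constant serves both
inequalities. -/
theorem norm_le_of_norm_sub_le {W : Type*} [NormedAddCommGroup W] {c : ℝ} (hc0 : 0 ≤ c)
    (hc : c ≤ 1 / 2) {u w : W} {z : ℝ} (hz : z ≤ ‖w‖) (h : ‖u - w‖ ≤ c * z) :
    ‖u‖ ≤ (1 + 2 * c) * ‖w‖ ∧ ‖w‖ ≤ (1 + 2 * c) * ‖u‖ := by
  have h1 : ‖u - w‖ ≤ c * ‖w‖ := h.trans (by gcongr)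
  have h2 : ‖u‖ ≤ ‖w‖ + ‖u - w‖ := by
    simpa using norm_add_le w (u - w)
  have h3 : ‖w‖ ≤ ‖u‖ + ‖u - w‖ := by
    have := norm_sub_le u (u - w)
    simpa using this
  have := norm_nonneg w
  have := norm_nonneg u
  constructor <;> nlinarith

/-- **Area formula** for the graph of a `C¹` function. -/
theorem comap_graphMap_euclideanHausdorffMeasure {γ : Euc d → ℝ} (hγ : ContDiff ℝ 1 γ) :
    (Measure.euclideanHausdorffMeasure d : Measure (WithLp 2 (Euc d × ℝ))).comap (graphMap γ)
      = (volume : Measure (Euc d)).withDensity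
          (fun y => ENNReal.ofReal (√(1 + ‖fderiv ℝ γ y‖ ^ 2))) := by
  set ν := (Measure.euclideanHausdorffMeasure d : Measure (WithLp 2 (Euc d × ℝ))).comap
    (graphMap γ) with hν
  set J : Euc d → ℝ≥0∞ := fun y => ENNReal.ofReal (√(1 + ‖fderiv ℝ γ y‖ ^ 2)) with hJ
  have hcont : Continuous (fderiv ℝ γ) := hγ.continuous_fderiv one_ne_zero
  have hνa : ∀ s, ν s = (Measure.euclideanHausdorffMeasure d :
      Measure (WithLp 2 (Euc d × ℝ))) (graphMap γ '' s) := fun s =>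
    (measurableEmbedding_graphMap hγ.continuous).comap_apply _ s
  -- Two linear graph maps with comparable norms have comparable Jacobians: compare the measures of
  -- the images of the unit ball.
  have hJcmp : ∀ (a b : Euc d →L[ℝ] ℝ) (K : ℝ≥0),
      (∀ z, ‖graphLinear a z‖ ≤ K * ‖graphLinear b z‖) →
      ENNReal.ofReal (√(1 + ‖a‖ ^ 2)) ≤ (K : ℝ≥0∞) ^ d * ENNReal.ofReal (√(1 + ‖b‖ ^ 2)) := by
    intro a b K h
    have h1 := euclideanHausdorffMeasure_image_le_of_norm_sub_le (s := Metric.ball (0 : Euc d) 1)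
      d (f := graphLinear a) (g := graphLinear b) (K := K) (fun x _ y _ => by
        rw [← map_sub, ← map_sub]; exact h _)
    rw [measure_graphLinear_image, measure_graphLinear_image, ← mul_assoc] at h1
    exact (ENNReal.mul_le_mul_iff_left (Metric.measure_ball_pos volume _ one_pos).ne'
      measure_ball_lt_top.ne).1 h1
  -- With K = 1 + 2c, the loss K^d · K^d has two sources: replacing the graph by its tangent map at
  -- a base point x, and replacing the density J by its value at x. Letting c → 0 removes both.
  have key : ∀ c : ℝ≥0, 0 < c → c ≤ 1 / 2 →
      ν ≤ (((1 + 2 * c : ℝ≥0) : ℝ≥0∞) ^ d * ((1 + 2 * c : ℝ≥0) : ℝ≥0∞) ^ d) •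
        (volume.withDensity J) ∧
      volume.withDensity J ≤ (((1 + 2 * c : ℝ≥0) : ℝ≥0∞) ^ d *
        ((1 + 2 * c : ℝ≥0) : ℝ≥0∞) ^ d) • ν := by
    intro c hc0 hc
    set K : ℝ≥0 := 1 + 2 * c with hK
    have hKr : (K : ℝ) = 1 + 2 * (c : ℝ) := by simp [hK]
    have hc' : (c : ℝ) ≤ 1 / 2 := by exact_mod_cast hc
    -- U is chosen so that on it the graph map is within c of being its derivative at x, and the
    -- derivative of γ itself varies by less than c.
    have hloc : ∀ x, ∃ U : Set (Euc d), IsOpen U ∧ x ∈ U ∧ ∀ s ⊆ U, MeasurableSet s →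
        (ν s ≤ (K : ℝ≥0∞) ^ d * (K : ℝ≥0∞) ^ d * volume.withDensity J s ∧
        volume.withDensity J s ≤ (K : ℝ≥0∞) ^ d * (K : ℝ≥0∞) ^ d * ν s) := by
      intro x
      obtain ⟨U₀, hU₀, happ⟩ :=
        (hasStrictFDerivAt_graphMap hγ x).approximates_deriv_on_nhds (Or.inr hc0)
      obtain ⟨U₁, hU₁₀, hU₁, hxU₁⟩ := mem_nhds_iff.1 hU₀
      have hU₂ : IsOpen {y | ‖fderiv ℝ γ y - fderiv ℝ γ x‖ < c} :=
        isOpen_lt (hcont.sub continuous_const).norm continuous_const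
      refine ⟨U₁ ∩ {y | ‖fderiv ℝ γ y - fderiv ℝ γ x‖ < c}, hU₁.inter hU₂,
        ⟨hxU₁, by simpa using hc0⟩, fun s hs hsm => ?_⟩
      have e1 : ∀ y ∈ s, ∀ z ∈ s, ‖graphMap γ y - graphMap γ z‖
          ≤ K * ‖graphLinear (fderiv ℝ γ x) y - graphLinear (fderiv ℝ γ x) z‖ ∧
          ‖graphLinear (fderiv ℝ γ x) y - graphLinear (fderiv ℝ γ x) z‖ ≤
            K * ‖graphMap γ y - graphMap γ z‖ := by
        intro y hy z hz
        rw [← map_sub, hKr]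
        exact norm_le_of_norm_sub_le c.2 hc' (norm_le_norm_graphLinear _ _)
          (happ y (hU₁₀ (hs hy).1) z (hU₁₀ (hs hz).1))
      have i1 : ν s ≤ (K : ℝ≥0∞) ^ d * (J x * volume s) := by
        rw [hνa, ← measure_graphLinear_image]
        exact euclideanHausdorffMeasure_image_le_of_norm_sub_le d fun y hy z hz => (e1 y hy z hz).1
      have i2 : J x * volume s ≤ (K : ℝ≥0∞) ^ d * ν s := by
        rw [hνa, ← measure_graphLinear_image]
        exact euclideanHausdorffMeasure_image_le_of_norm_sub_le d fun y hy z hz => (e1 y hy z hz).2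
      have e2 : ∀ y ∈ s, ∀ z, ‖graphLinear (fderiv ℝ γ y) z‖
          ≤ K * ‖graphLinear (fderiv ℝ γ x) z‖ ∧
          ‖graphLinear (fderiv ℝ γ x) z‖ ≤ K * ‖graphLinear (fderiv ℝ γ y) z‖ := by
        intro y hy z
        rw [hKr]
        refine norm_le_of_norm_sub_le c.2 hc' (norm_le_norm_graphLinear _ _)
          ((norm_graphLinear_sub_le _ _ _).trans ?_)
        gcongr
        exact (hs hy).2.le
      have i3 : J x * volume s ≤ (K : ℝ≥0∞) ^ d * volume.withDensity J s := by
        rw [withDensity_apply _ hsm, ← setLIntegral_const, ← lintegral_const_mul' _ _ (by finiteness)]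
        exact setLIntegral_mono' hsm fun y hy => hJcmp _ _ _ fun z => (e2 y hy z).2
      have i4 : volume.withDensity J s ≤ (K : ℝ≥0∞) ^ d * (J x * volume s) := by
        rw [withDensity_apply _ hsm, ← setLIntegral_const, ← lintegral_const_mul' _ _ (by finiteness)]
        exact setLIntegral_mono' hsm fun y hy => hJcmp _ _ _ fun z => (e2 y hy z).1
      rw [mul_assoc, mul_assoc]
      exact ⟨i1.trans (by gcongr), i4.trans (by gcongr)⟩
    constructor
    · refine measure_le_of_locally_le fun x => ?_
      obtain ⟨U, h1, h2, h3⟩ := hloc x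
      exact ⟨U, h1, h2, fun s hs hm => (h3 s hs hm).1⟩
    · refine measure_le_of_locally_le fun x => ?_
      obtain ⟨U, h1, h2, h3⟩ := hloc x
      exact ⟨U, h1, h2, fun s hs hm => (h3 s hs hm).2⟩
  have hlim : ∀ m : ℝ≥0∞, Tendsto (fun c : ℝ≥0 => (((1 + 2 * c : ℝ≥0) : ℝ≥0∞) ^ d *
      ((1 + 2 * c : ℝ≥0) : ℝ≥0∞) ^ d) * m) (𝓝[>] 0) (𝓝 m) := by
    intro m
    have h1 : Tendsto (fun c : ℝ≥0 => (((1 + 2 * c) ^ d * (1 + 2 * c) ^ d : ℝ≥0) : ℝ≥0∞))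
        (𝓝[>] 0) (𝓝 1) := by
      have h2 : Continuous fun c : ℝ≥0 => (((1 + 2 * c) ^ d * (1 + 2 * c) ^ d : ℝ≥0) : ℝ≥0∞) :=
        ENNReal.continuous_coe.comp (by fun_prop)
      have := h2.tendsto 0
      simp only [mul_zero, add_zero, one_pow, mul_one, ENNReal.coe_one] at this
      exact this.mono_left nhdsWithin_le_nhds
    have h3 := ENNReal.Tendsto.mul_const (b := m) h1 (Or.inl one_ne_zero)
    rw [one_mul] at h3
    refine h3.congr fun c => ?_
    push_cast
    ring
  have hev : ∀ᶠ c : ℝ≥0 in 𝓝[>] 0, 0 < c ∧ c ≤ 1 / 2 := by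
    refine (eventually_mem_nhdsWithin).and
      (nhdsWithin_le_nhds (Iic_mem_nhds (by norm_num)))
  refine le_antisymm (Measure.le_iff.2 fun s _ => ?_) (Measure.le_iff.2 fun s _ => ?_)
  · exact ge_of_tendsto (hlim _) (hev.mono fun c hc => (key c hc.1 hc.2).1 s)
  · exact ge_of_tendsto (hlim _) (hev.mono fun c hc => (key c hc.1 hc.2).2 s)

end Area

/-! ### The divergence theorem below a graph -/

section GraphDivergence

theorem deriv_smoothTransition_of_notMem {s : ℝ} (hs : s ∉ Icc (0 : ℝ) 1) :
    deriv Real.smoothTransition s = 0 := by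
  rw [mem_Icc, not_and_or, not_le, not_le] at hs
  rcases hs with hs | hs
  · have : Real.smoothTransition =ᶠ[𝓝 s] fun _ => 0 :=
      (eventually_lt_nhds hs).mono fun x hx => Real.smoothTransition.zero_of_nonpos hx.le
    rw [this.deriv_eq]; simp
  · have : Real.smoothTransition =ᶠ[𝓝 s] fun _ => 1 :=
      (eventually_gt_nhds hs).mono fun x hx => Real.smoothTransition.one_of_one_le hx.le
    rw [this.deriv_eq]; simp

theorem hasCompactSupport_deriv_smoothTransition :
    HasCompactSupport (deriv Real.smoothTransition) :=
  HasCompactSupport.intro isCompact_Icc fun _ hs => deriv_smoothTransition_of_notMem hs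

theorem continuous_deriv_smoothTransition : Continuous (deriv Real.smoothTransition) :=
  (Real.smoothTransition.contDiff (n := 1)).continuous_deriv le_rfl

theorem integrable_deriv_smoothTransition : Integrable (deriv Real.smoothTransition) :=
  continuous_deriv_smoothTransition.integrable_of_hasCompactSupport
    hasCompactSupport_deriv_smoothTransition

/-- The derivative of the transition function is a kernel of mass one supported in [0, 1]. After
rescaling by ε it becomes an approximate identity on the graph. -/
theorem integral_deriv_smoothTransition : ∫ s, deriv Real.smoothTransition s = 1 := by
  have hd : ContDiff ℝ 1 Real.smoothTransition := Real.smoothTransition.contDiff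
  have h0 : Tendsto Real.smoothTransition atBot (𝓝 0) :=
    tendsto_const_nhds.congr' ((eventually_le_atBot 0).mono fun x hx =>
      (Real.smoothTransition.zero_of_nonpos hx).symm)
  have h1 : Tendsto Real.smoothTransition atTop (𝓝 1) :=
    tendsto_const_nhds.congr' ((eventually_ge_atTop 1).mono fun x hx =>
      (Real.smoothTransition.one_of_one_le hx).symm)
  rw [integral_of_hasDerivAt_of_tendsto
    (fun x => (hd.differentiable one_ne_zero x).hasDerivAt) integrable_deriv_smoothTransition
    h0 h1, sub_zero]

variable {d : ℕ}

theorem integral_withLp_prod (f : WithLp 2 (Euc d × ℝ) → ℂ) :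
    ∫ p, f p = ∫ q : Euc d × ℝ, f (WithLp.toLp 2 q) :=
  (((WithLp.volume_preserving_toLp (Euc d) ℝ).integral_comp
    (MeasurableEquiv.toLp 2 (Euc d × ℝ)).measurableEmbedding f)).symm

theorem integral_eq_mul_integral_comp_sub_mul (F : ℝ → ℂ) (a : ℝ) {ε : ℝ} (hε : 0 < ε) :
    ∫ t, F t = ε * ∫ s, F (a - ε * s) := by
  have h1 := Measure.integral_comp_mul_left (fun x => F (a - x)) ε
  rw [h1, integral_sub_left_eq_self F volume a, abs_of_pos (inv_pos.2 hε), Complex.real_smul]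
  have : (ε : ℂ) ≠ 0 := by exact_mod_cast hε.ne'
  push_cast
  field_simp

/-- The cutoff vanishes on and above the graph, and at a fixed point below it the value is 1 once ε
is small; dominated convergence applies. -/
theorem tendsto_integral_cutoff {γ : Euc d → ℝ} {h : WithLp 2 (Euc d × ℝ) → ℂ}
    (hh : Integrable h) (hγ : Continuous γ) :
    Tendsto (fun ε : ℝ => ∫ p, (Real.smoothTransition ((γ p.fst - p.snd) / ε) : ℂ) * h p) (𝓝[>] 0)
      (𝓝 (∫ p in {p : WithLp 2 (Euc d × ℝ) | p.snd < γ p.fst}, h p)) := by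
  have hm : MeasurableSet {p : WithLp 2 (Euc d × ℝ) | p.snd < γ p.fst} :=
    (isOpen_lt (by fun_prop) (by fun_prop)).measurableSet
  rw [← integral_indicator hm]
  refine tendsto_integral_filter_of_dominated_convergence (fun p => ‖h p‖) ?_ ?_ hh.norm ?_
  · refine Eventually.of_forall fun ε => AEStronglyMeasurable.mul ?_ hh.1
    refine Continuous.aestronglyMeasurable ?_
    have := Real.smoothTransition.continuous
    fun_prop
  · refine Eventually.of_forall fun ε => Eventually.of_forall fun p => ?_
    rw [norm_mul, Complex.norm_real, Real.norm_of_nonneg (Real.smoothTransition.nonneg _)]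
    exact mul_le_of_le_one_left (norm_nonneg _) (Real.smoothTransition.le_one _)
  · refine Eventually.of_forall fun p => ?_
    by_cases hp : p.snd < γ p.fst
    · rw [indicator_of_mem (by exact hp)]
      refine tendsto_const_nhds.congr' ?_
      have : ∀ᶠ ε : ℝ in 𝓝[>] 0, 0 < ε ∧ ε < γ p.fst - p.snd :=
        eventually_mem_nhdsWithin.and (nhdsWithin_le_nhds (eventually_lt_nhds (sub_pos.2 hp)))
      filter_upwards [this] with ε hε
      rw [Real.smoothTransition.one_of_one_le ((one_le_div hε.1).2 hε.2.le)]
      simp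
    · rw [indicator_of_notMem (by exact hp)]
      refine tendsto_const_nhds.congr' ?_
      filter_upwards [eventually_mem_nhdsWithin] with ε (hε : 0 < ε)
      rw [Real.smoothTransition.zero_of_nonpos
        (div_nonpos_of_nonpos_of_nonneg (by linarith) hε.le)]
      simp

/-- Substituting t = γ(y) − εs along each vertical line turns the thin layer into integration
against a fixed kernel of mass one in s, while the argument of h tends to the graph point over y.
Dominated convergence is used in s and then in y, where the projection of the support of h bounds
the domain. -/
theorem tendsto_integral_layer {γ : Euc d → ℝ} {h : WithLp 2 (Euc d × ℝ) → ℂ}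
    (hh : Continuous h) (hc : HasCompactSupport h) (hγ : Continuous γ) :
    Tendsto (fun ε : ℝ => ∫ p, ((deriv Real.smoothTransition ((γ p.fst - p.snd) / ε) / ε : ℝ) : ℂ)
      * h p) (𝓝[>] 0) (𝓝 (∫ y, h (graphMap γ y))) := by
  set S := deriv Real.smoothTransition with hS
  have hSc : Continuous S := continuous_deriv_smoothTransition
  have hSi : Integrable S := integrable_deriv_smoothTransition
  obtain ⟨C, hC⟩ := hh.bounded_above_of_compact_support hc
  have htoLp : Continuous (fun q : Euc d × ℝ => (WithLp.toLp 2 q : WithLp 2 (Euc d × ℝ))) :=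
    WithLp.prod_continuous_toLp 2 _ _
  have e1 : ∀ ε : ℝ, 0 < ε → ∫ p, ((S ((γ p.fst - p.snd) / ε) / ε : ℝ) : ℂ) * h p
      = ∫ y, ∫ s, (S s : ℂ) * h (WithLp.toLp 2 (y, γ y - ε * s)) := by
    intro ε hε
    rw [integral_withLp_prod]
    simp only [WithLp.toLp_fst, WithLp.toLp_snd]
    have hi : Integrable (fun q : Euc d × ℝ => ((S ((γ q.1 - q.2) / ε) / ε : ℝ) : ℂ)
        * h (WithLp.toLp 2 q)) := by
      refine Continuous.integrable_of_hasCompactSupport (by fun_prop) (HasCompactSupport.mul_left ?_)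
      exact hc.comp_homeomorph (WithLp.homeomorphProd 2 (Euc d) ℝ).symm
    rw [Measure.volume_eq_prod] at hi ⊢
    rw [integral_prod _ hi]
    refine integral_congr_ae (Eventually.of_forall fun y => ?_)
    simp only
    rw [integral_eq_mul_integral_comp_sub_mul _ (γ y) hε, ← integral_const_mul]
    congr 1
    ext s
    have : (ε : ℂ) ≠ 0 := by exact_mod_cast hε.ne'
    rw [show (γ y - (γ y - ε * s)) / ε = s by field_simp; ring]
    push_cast
    field_simp
  refine Tendsto.congr' (eventually_mem_nhdsWithin.mono fun ε hε => (e1 ε hε).symm) ?_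
  have hK : IsCompact (WithLp.fst '' tsupport h) := hc.isCompact.image (by fun_prop)
  have hcc : ∀ ε : ℝ, Continuous fun q : Euc d × ℝ =>
      (S q.2 : ℂ) * h (WithLp.toLp 2 (q.1, γ q.1 - ε * q.2)) := fun ε => by fun_prop
  refine tendsto_integral_filter_of_dominated_convergence
    ((WithLp.fst '' tsupport h).indicator fun _ => ∫ s, ‖S s‖ * C) ?_ ?_ ?_ ?_
  · refine Eventually.of_forall fun ε => StronglyMeasurable.aestronglyMeasurable ?_
    exact StronglyMeasurable.integral_prod_right (f := fun y s => (S s : ℂ) *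
      h (WithLp.toLp 2 (y, γ y - ε * s))) (hcc ε).stronglyMeasurable
  · refine Eventually.of_forall fun ε => Eventually.of_forall fun y => ?_
    by_cases hy : y ∈ WithLp.fst '' tsupport h
    · rw [indicator_of_mem hy]
      refine norm_integral_le_of_norm_le (hSi.norm.mul_const C) (Eventually.of_forall fun s => ?_)
      rw [norm_mul, Complex.norm_real]
      gcongr
      exact hC _
    · rw [indicator_of_notMem hy]
      have : ∀ s, h (WithLp.toLp 2 (y, γ y - ε * s)) = 0 := fun s =>
        image_eq_zero_of_notMem_tsupport fun hm => hy ⟨_, hm, rfl⟩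
      simp [this]
  · exact (integrable_indicator_iff hK.measurableSet).2 (integrableOn_const hK.measure_lt_top.ne)
  · refine Eventually.of_forall fun y => ?_
    have e2 : h (graphMap γ y) = ∫ s, (S s : ℂ) * h (graphMap γ y) := by
      rw [integral_mul_const, integral_complex_ofReal, hS, integral_deriv_smoothTransition]
      simp
    rw [e2]
    refine tendsto_integral_filter_of_dominated_convergence (fun s => ‖S s‖ * C) ?_ ?_
      (hSi.norm.mul_const C) ?_
    · exact Eventually.of_forall fun ε => ((hcc ε).comp
        (continuous_const.prodMk continuous_id)).aestronglyMeasurable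
    · refine Eventually.of_forall fun ε => Eventually.of_forall fun s => ?_
      rw [norm_mul, Complex.norm_real]
      gcongr
      exact hC _
    · refine Eventually.of_forall fun s => Tendsto.const_mul _ ?_
      have : Continuous fun ε : ℝ => h (WithLp.toLp 2 (y, γ y - ε * s)) := by fun_prop
      have := this.tendsto 0
      simp only [zero_mul, sub_zero] at this
      exact this.mono_left nhdsWithin_le_nhds

theorem fderiv_smoothTransition_comp_div {E : Type*} [NormedAddCommGroup E] [NormedSpace ℝ E]
    {ρ : E → ℝ} {L : E →L[ℝ] ℝ} {p : E} (hρ : HasFDerivAt ρ L p) (ε : ℝ) (e : E) :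
    fderiv ℝ (fun p => (Real.smoothTransition (ρ p / ε) : ℂ)) p e
      = ((deriv Real.smoothTransition (ρ p / ε) / ε : ℝ) : ℂ) * (L e : ℝ) := by
  have h1 : HasDerivAt Real.smoothTransition
      (deriv Real.smoothTransition (ρ p / ε)) (ρ p / ε) :=
    ((Real.smoothTransition.contDiff (n := 1)).differentiable one_ne_zero _).hasDerivAt
  have h2 : HasFDerivAt (fun p => ρ p / ε) (ε⁻¹ • L) p := by
    simp only [div_eq_mul_inv]
    exact hρ.mul_const ε⁻¹
  have h3 := Complex.ofRealCLM.hasFDerivAt.comp p (h1.hasFDerivAt.comp p h2)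
  have h4 : HasFDerivAt (fun p => (Real.smoothTransition (ρ p / ε) : ℂ)) _ p := h3
  rw [h4.fderiv]
  simp [div_eq_mul_inv]
  ring

/-- Multiply by the smooth cutoff of the subgraph and integrate by parts on the whole space. The
derivative falling on the cutoff is a layer that converges to the integral over the graph, with the
unnormalized normal (−∇γ, 1). -/
theorem integral_fderiv_below_graph {γ : Euc d → ℝ} (hγ : ContDiff ℝ 1 γ)
    {g : WithLp 2 (Euc d × ℝ) → ℂ} (hg : LocallyLipschitz g) (hc : HasCompactSupport g)
    (e : WithLp 2 (Euc d × ℝ)) :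
    ∫ p in {p : WithLp 2 (Euc d × ℝ) | p.snd < γ p.fst}, fderiv ℝ g p e
      = ∫ y, g (graphMap γ y) * ((e.snd - fderiv ℝ γ y e.fst : ℝ) : ℂ) := by
  have hγc : Continuous γ := hγ.continuous
  have hρ : ContDiff ℝ 1 fun p : WithLp 2 (Euc d × ℝ) => γ p.fst - p.snd := by
    have h1 : ContDiff ℝ 1 fun p : WithLp 2 (Euc d × ℝ) => p.fst :=
      (WithLp.fstL 2 ℝ (Euc d) ℝ).contDiff
    have h2 : ContDiff ℝ 1 fun p : WithLp 2 (Euc d × ℝ) => p.snd :=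
      (WithLp.sndL 2 ℝ (Euc d) ℝ).contDiff
    exact (hγ.comp h1).sub h2
  have hρd : ∀ p : WithLp 2 (Euc d × ℝ), HasFDerivAt
      (fun p : WithLp 2 (Euc d × ℝ) => γ p.fst - p.snd)
      ((fderiv ℝ γ p.fst).comp (WithLp.fstL 2 ℝ (Euc d) ℝ) - WithLp.sndL 2 ℝ (Euc d) ℝ) p := by
    intro p
    refine HasFDerivAt.sub ?_ (WithLp.sndL 2 ℝ (Euc d) ℝ).hasFDerivAt
    exact ((hγ.differentiable one_ne_zero p.fst).hasFDerivAt).comp p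
      (WithLp.fstL 2 ℝ (Euc d) ℝ).hasFDerivAt
  set χ : ℝ → WithLp 2 (Euc d × ℝ) → ℂ := fun ε p =>
    (Real.smoothTransition ((γ p.fst - p.snd) / ε) : ℂ) with hχ
  have hχL : ∀ ε, LocallyLipschitz (χ ε) := by
    intro ε
    have : ContDiff ℝ 1 (χ ε) := by
      refine Complex.ofRealCLM.contDiff.comp ?_
      exact (Real.smoothTransition.contDiff (n := 1)).comp (hρ.div_const ε)
    exact this.locallyLipschitz
  have hχd : ∀ ε p, fderiv ℝ (χ ε) p e =
      -(((deriv Real.smoothTransition ((γ p.fst - p.snd) / ε) / ε : ℝ) : ℂ) *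
        ((e.snd - fderiv ℝ γ p.fst e.fst : ℝ) : ℂ)) := by
    intro ε p
    rw [hχ, fderiv_smoothTransition_comp_div (hρd p) ε e, ← mul_neg, ← Complex.ofReal_neg]
    congr 2
    change fderiv ℝ γ p.fst e.fst - e.snd = _
    ring
  have hi : Integrable (fun p => fderiv ℝ g p e) := locallyLipschitz_integrable_fderiv _ hg hc e
  have hlim1 := tendsto_integral_cutoff hi hγc
  have hc2 : Continuous fun p : WithLp 2 (Euc d × ℝ) =>
      ((e.snd - fderiv ℝ γ p.fst e.fst : ℝ) : ℂ) := by
    have := hγ.continuous_fderiv one_ne_zero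
    fun_prop
  have hlim2 := tendsto_integral_layer (hg.continuous.mul hc2) hc.mul_right hγc
  refine tendsto_nhds_unique hlim1 (hlim2.congr fun ε => ?_)
  have h := locallyLipschitz_integral_fderiv_mul volume (hχL ε) hg hc e
  rw [← neg_eq_iff_eq_neg] at h
  rw [← h, ← integral_neg]
  refine integral_congr_ae (Eventually.of_forall fun p => ?_)
  simp only [hχd, Pi.mul_apply]
  ring

end GraphDivergence

/-! ### Outward normal -/

section Normal

variable {n : ℕ}

/-- Otherwise, for small t > 0, the normal v forces x + t d into Ω while the normal w forces it out
of Ω. Half of each inner product leaves room for the first-order errors. -/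
theorem IsOutwardUnitNormal.inner_nonpos {Ω : Set (Euc n)} {x v w : Euc n}
    (hv : IsOutwardUnitNormal Ω x v) (hw : IsOutwardUnitNormal Ω x w) {d : Euc n}
    (hd : inner ℝ v d < 0) : inner ℝ w d ≤ 0 := by
  have hd0 : 0 < ‖d‖ := norm_pos_iff.2 (by rintro rfl; simp at hd)
  have hlim : Tendsto (fun t : ℝ => x + t • d) (𝓝[>] 0) (𝓝 x) := by
    have : Continuous fun t : ℝ => x + t • d := by fun_prop
    have := this.tendsto 0
    simp only [zero_smul, add_zero] at this
    exact this.mono_left nhdsWithin_le_nhds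
  by_contra! hc
  have h1 := hlim.eventually (hv.2 (-inner ℝ v d / (2 * ‖d‖)) (by
    apply div_pos <;> linarith))
  have h2 := hlim.eventually (hw.2 (inner ℝ w d / (2 * ‖d‖)) (by positivity))
  obtain ⟨t, ht1, ht2, ht : 0 < t⟩ := (h1.and (h2.and eventually_mem_nhdsWithin)).exists
  simp only [add_sub_cancel_left, inner_smul_right, norm_smul, Real.norm_of_nonneg ht.le] at ht1 ht2
  have e1 : -inner ℝ v d / (2 * ‖d‖) * (t * ‖d‖) = -(t * inner ℝ v d) / 2 := by field_simp
  have e2 : inner ℝ w d / (2 * ‖d‖) * (t * ‖d‖) = t * inner ℝ w d / 2 := by field_simp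
  have p1 : t * inner ℝ v d < 0 := mul_neg_of_pos_of_neg ht hd
  have p2 : 0 < t * inner ℝ w d := mul_pos ht hc
  by_cases hm : x + t • d ∈ Ω
  · have := ht2.1 hm
    rw [e2] at this
    linarith
  · have := ht1.2 hm
    rw [e1] at this
    linarith

theorem IsOutwardUnitNormal.unique {Ω : Set (Euc n)} {x v w : Euc n}
    (hv : IsOutwardUnitNormal Ω x v) (hw : IsOutwardUnitNormal Ω x w) : v = w := by
  have hv1 : inner ℝ v v = (1 : ℝ) := by rw [real_inner_self_eq_norm_sq, hv.1]; norm_num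
  have hw1 : inner ℝ w w = (1 : ℝ) := by rw [real_inner_self_eq_norm_sq, hw.1]; norm_num
  have hpos : 0 ≤ (inner ℝ w v : ℝ) := by
    have := hv.inner_nonpos hw (d := -v) (by rw [inner_neg_right, hv1]; norm_num)
    rw [inner_neg_right] at this
    linarith
  -- The direction w − (⟨w,v⟩ + δ)v has product −δ with v, so it is admissible for `inner_nonpos`.
  -- The choice δ = 1 − ⟨w,v⟩ below excludes ⟨w,v⟩ < 1.
  have hsq : ∀ δ > 0, 1 - (inner ℝ w v : ℝ) ^ 2 ≤ δ * inner ℝ w v := by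
    intro δ hδ
    have := hv.inner_nonpos hw (d := w - ((inner ℝ w v : ℝ) + δ) • v) (by
      rw [inner_sub_right, inner_smul_right, hv1, real_inner_comm v w]; linarith)
    rw [inner_sub_right, inner_smul_right, hw1] at this
    nlinarith
  have h1 : 1 ≤ (inner ℝ w v : ℝ) := by
    by_contra! hlt
    have := hsq (1 - inner ℝ w v) (by linarith)
    nlinarith
  have h2 : ‖v - w‖ ^ 2 ≤ 0 := by
    rw [norm_sub_sq_real, hv.1, hw.1, real_inner_comm]
    linarith
  have : ‖v - w‖ = 0 := by nlinarith [norm_nonneg (v - w)]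
  exact sub_eq_zero.1 (norm_eq_zero.1 this)

theorem IsOutwardUnitNormal.outwardNormal_eq {Ω : Set (Euc n)} {x v : Euc n}
    (hv : IsOutwardUnitNormal Ω x v) : outwardNormal Ω x = v := by
  have h : ∃ v, IsOutwardUnitNormal Ω x v := ⟨v, hv⟩
  rw [outwardNormal, dif_pos h]
  exact h.choose_spec.unique hv

/-- The unit vector `(-∇γ(y), 1) / √(1 + |∇γ(y)|²)`. -/
noncomputable def graphNormal {d : ℕ} (γ : Euc d → ℝ) (y : Euc d) : WithLp 2 (Euc d × ℝ) :=
  (√(1 + ‖fderiv ℝ γ y‖ ^ 2))⁻¹ •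
    WithLp.toLp 2 (-(InnerProductSpace.toDual ℝ (Euc d)).symm (fderiv ℝ γ y), (1 : ℝ))

theorem inner_graphNormal {d : ℕ} (γ : Euc d → ℝ) (y : Euc d) (e : WithLp 2 (Euc d × ℝ)) :
    inner ℝ (graphNormal γ y) e
      = (√(1 + ‖fderiv ℝ γ y‖ ^ 2))⁻¹ * (e.snd - fderiv ℝ γ y e.fst) := by
  rw [graphNormal, real_inner_smul_left, WithLp.prod_inner_apply]
  change _ * (inner ℝ (-_) e.fst + e.snd * (1 : ℝ)) = _
  rw [inner_neg_left, InnerProductSpace.toDual_symm_apply]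
  ring

theorem norm_graphNormal {d : ℕ} (γ : Euc d → ℝ) (y : Euc d) : ‖graphNormal γ y‖ = 1 := by
  have hpos : 0 < √(1 + ‖fderiv ℝ γ y‖ ^ 2) := by positivity
  rw [graphNormal, norm_smul, norm_inv, Real.norm_of_nonneg hpos.le, WithLp.prod_norm_eq_of_L2]
  change _ * √(‖-(InnerProductSpace.toDual ℝ (Euc d)).symm (fderiv ℝ γ y)‖ ^ 2 + ‖(1 : ℝ)‖ ^ 2) = 1
  rw [norm_neg, LinearIsometryEquiv.norm_map, norm_one, one_pow, add_comm (_ ^ 2),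
    inv_mul_cancel₀ hpos.ne']

/-- To first order, membership in Ω is the sign of the product with (−∇γ, 1). Normalizing multiplies
by a factor at most 1, so the Taylor error of γ stays within ε‖z − x‖. -/
theorem isOutwardUnitNormal_graph {d : ℕ} {Ω : Set (Euc n)} (T : Euc n ≃ₗᵢ[ℝ] WithLp 2 (Euc d × ℝ))
    {γ : Euc d → ℝ} (hγ : ContDiff ℝ 1 γ) {U : Set (Euc n)} (hU : IsOpen U)
    (hΩ : ∀ x ∈ U, x ∈ Ω ↔ (T x).snd < γ (T x).fst) {x : Euc n} (hxU : x ∈ U)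
    (hx : (T x).snd = γ (T x).fst) :
    IsOutwardUnitNormal Ω x (T.symm (graphNormal γ (T x).fst)) := by
  refine ⟨by rw [LinearIsometryEquiv.norm_map, norm_graphNormal], fun ε hε => ?_⟩
  set y₀ := (T x).fst with hy₀
  have hdiff : ∀ᶠ y in 𝓝 y₀, ‖γ y - γ y₀ - fderiv ℝ γ y₀ (y - y₀)‖ ≤ ε * ‖y - y₀‖ :=
    ((hγ.differentiable one_ne_zero y₀).hasFDerivAt.isLittleO).def hε
  have hcont : Tendsto (fun z => (T z).fst) (𝓝 x) (𝓝 y₀) := by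
    have : Continuous fun z => (T z).fst := by fun_prop
    exact this.tendsto x
  filter_upwards [hcont.eventually hdiff, hU.mem_nhds hxU] with z hz hzU
  have hin : inner ℝ (T.symm (graphNormal γ y₀)) (z - x) = (√(1 + ‖fderiv ℝ γ y₀‖ ^ 2))⁻¹ *
      ((T z).snd - (T x).snd - fderiv ℝ γ y₀ ((T z).fst - y₀)) := by
    rw [← LinearIsometryEquiv.inner_map_map T, LinearIsometryEquiv.apply_symm_apply,
      inner_graphNormal, map_sub]
    rfl
  have hJ : (√(1 + ‖fderiv ℝ γ y₀‖ ^ 2))⁻¹ ≤ 1 := by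
    refine inv_le_one_of_one_le₀ ?_
    rw [Real.one_le_sqrt]
    nlinarith [norm_nonneg (fderiv ℝ γ y₀)]
  have hJ0 : 0 ≤ (√(1 + ‖fderiv ℝ γ y₀‖ ^ 2))⁻¹ := by positivity
  have hfst : ‖(T z).fst - y₀‖ ≤ ‖z - x‖ := by
    rw [← LinearIsometryEquiv.norm_map T (z - x), map_sub]
    exact WithLp.norm_fst_le _ (T z - T x)
  have hz' : |γ (T z).fst - γ y₀ - fderiv ℝ γ y₀ ((T z).fst - y₀)| ≤ ε * ‖z - x‖ :=
    hz.trans (by gcongr)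
  rw [abs_le] at hz'
  have hε' : 0 ≤ ε * ‖z - x‖ := by positivity
  rw [hin, hx]
  constructor
  · intro hzΩ
    have := (hΩ z hzU).1 hzΩ
    calc _ ≤ (√(1 + ‖fderiv ℝ γ y₀‖ ^ 2))⁻¹ * (ε * ‖z - x‖) := by gcongr; linarith
      _ ≤ _ := mul_le_of_le_one_left hε' hJ
  · intro hzΩ
    have : γ (T z).fst ≤ (T z).snd := not_lt.1 fun h => hzΩ ((hΩ z hzU).2 h)
    calc -(ε * ‖z - x‖) ≤ (√(1 + ‖fderiv ℝ γ y₀‖ ^ 2))⁻¹ * (-(ε * ‖z - x‖)) := by nlinarith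
      _ ≤ _ := by gcongr; linarith

end Normal

/-! ### The divergence theorem -/

section Divergence

variable {n : ℕ}

theorem exists_contDiff_one_nhds_of_isCompact {K W : Set (Euc n)} (hK : IsCompact K)
    (hW : IsOpen W) (hKW : K ⊆ W) :
    ∃ χ : Euc n → ℝ, ContDiff ℝ ∞ χ ∧ HasCompactSupport χ ∧ tsupport χ ⊆ W ∧
      ∀ x ∈ K, ∀ᶠ y in 𝓝 x, χ y = 1 := by
  obtain ⟨L, hL, hKL, hLW⟩ := exists_compact_between hK hW hKW
  obtain ⟨f, h0, h1, -⟩ := exists_contMDiffMap_zero_one_nhds_of_isClosed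
    (modelWithCornersSelf ℝ (Euc n)) (n := (⊤ : ℕ∞)) isOpen_interior.isClosed_compl hK.isClosed
    (disjoint_compl_left.mono_right hKL)
  have hsupp : tsupport f ⊆ L := by
    refine closure_minimal (fun x hx => ?_) hL.isClosed
    by_contra hxL
    exact hx (h0.self_of_nhdsSet x fun h => hxL (interior_subset h))
  exact ⟨f, f.contMDiff.contDiff, HasCompactSupport.of_support_subset_isCompact hL
    ((subset_tsupport _).trans hsupp), hsupp.trans hLW,
    fun x hx => (eventually_nhdsSet_iff_forall.1 h1 x hx)⟩

/-- The divergence theorem for the field `f e`. -/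
def DivergenceFormula (Ω : Set (Euc n)) (e : Euc n) (f : Euc n → ℂ) : Prop :=
  Integrable (fun x => f x * ((inner ℝ (outwardNormal Ω x) e : ℝ) : ℂ)) (surfaceMeasure Ω) ∧
    ∫ x in Ω, fderiv ℝ f x e
      = ∫ x, f x * ((inner ℝ (outwardNormal Ω x) e : ℝ) : ℂ) ∂(surfaceMeasure Ω)

theorem divergenceFormula_of_tsupport_subset {Ω : Set (Euc n)} (hΩ : IsOpen Ω) (e : Euc n)
    {f : Euc n → ℂ} (hf : LocallyLipschitz f) (hc : HasCompactSupport f) (hs : tsupport f ⊆ Ω) :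
    DivergenceFormula Ω e f := by
  have h0 : (fun x => f x * ((inner ℝ (outwardNormal Ω x) e : ℝ) : ℂ))
      =ᵐ[surfaceMeasure Ω] fun _ => 0 := by
    refine (ae_restrict_iff' isClosed_frontier.measurableSet).2 (Eventually.of_forall fun x hx => ?_)
    have : x ∉ tsupport f := fun h => (hΩ.frontier_eq ▸ hx).2 (hs h)
    simp [image_eq_zero_of_notMem_tsupport this]
  refine ⟨(integrable_zero _ _ _).congr h0.symm, ?_⟩
  rw [integral_congr_ae h0, integral_zero,
    setIntegral_eq_integral_of_forall_compl_eq_zero fun x hx => ?_,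
    locallyLipschitz_integral_fderiv_eq_zero volume hf hc e]
  rw [fderiv_of_notMem_tsupport ℝ fun h => hx (hs h)]
  rfl

/-- A point on the graph is approached from both sides along the vertical direction; a point off the
graph has a whole neighbourhood on one side. -/
theorem mem_frontier_iff_of_chart {d : ℕ} {Ω : Set (Euc n)}
    (T : Euc n ≃ₗᵢ[ℝ] WithLp 2 (Euc d × ℝ))
    {γ : Euc d → ℝ} (hγ : Continuous γ) {U : Set (Euc n)} (hU : IsOpen U)
    (hΩ : ∀ x ∈ U, x ∈ Ω ↔ (T x).snd < γ (T x).fst) {x : Euc n} (hxU : x ∈ U) :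
    x ∈ frontier Ω ↔ (T x).snd = γ (T x).fst := by
  have hcs : Continuous fun z => (T z).snd := by fun_prop
  have hcf : Continuous fun z => γ (T z).fst := by fun_prop
  rw [frontier_eq_closure_inter_closure]
  constructor
  · rintro ⟨h1, h2⟩
    refine le_antisymm ?_ ?_
    · by_contra! h
      obtain ⟨z, ⟨hz1, hzU⟩, hz⟩ := mem_closure_iff_nhds.1 h1 _
        (inter_mem ((isOpen_lt hcf hcs).mem_nhds h) (hU.mem_nhds hxU))
      exact lt_asymm ((hΩ z hzU).1 hz) hz1
    · by_contra! h
      obtain ⟨z, ⟨hz1, hzU⟩, hz⟩ := mem_closure_iff_nhds.1 h2 _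
        (inter_mem ((isOpen_lt hcs hcf).mem_nhds h) (hU.mem_nhds hxU))
      exact hz ((hΩ z hzU).2 hz1)
  · intro h
    have hxT : ∀ t : ℝ, (T (x + t • T.symm (WithLp.toLp 2 ((0 : Euc d), (1 : ℝ))))).fst = (T x).fst ∧
        (T (x + t • T.symm (WithLp.toLp 2 ((0 : Euc d), (1 : ℝ))))).snd = (T x).snd + t := by
      intro t
      rw [map_add, map_smul, LinearIsometryEquiv.apply_symm_apply]
      simp
    have hlim : Tendsto (fun t : ℝ => x + t • T.symm (WithLp.toLp 2 ((0 : Euc d), (1 : ℝ))))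
        (𝓝 0) (𝓝 x) := by
      have : Continuous fun t : ℝ => x + t • T.symm (WithLp.toLp 2 ((0 : Euc d), (1 : ℝ))) := by
        fun_prop
      simpa using this.tendsto 0
    have hlimU := hlim.eventually (hU.mem_nhds hxU)
    constructor
    · refine mem_closure_of_tendsto (hlim.mono_left (nhdsWithin_le_nhds (s := Iio 0))) ?_
      filter_upwards [nhdsWithin_le_nhds hlimU, eventually_mem_nhdsWithin] with t ht (ht0 : t < 0)
      rw [hΩ _ ht, (hxT t).1, (hxT t).2]
      linarith
    · refine mem_closure_of_tendsto (hlim.mono_left (nhdsWithin_le_nhds (s := Ioi 0))) ?_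
      filter_upwards [nhdsWithin_le_nhds hlimU, eventually_mem_nhdsWithin] with t ht (ht0 : 0 < t)
      rw [mem_compl_iff, hΩ _ ht, (hxT t).1, (hxT t).2]
      linarith

/-- Hausdorff measure on the graph is the image, under the parametrization, of its own pullback, and
the area formula gives the density of that pullback. -/
theorem integral_euclideanHausdorffMeasure_graph {d : ℕ} {γ : Euc d → ℝ} (hγ : ContDiff ℝ 1 γ)
    (F : WithLp 2 (Euc d × ℝ) → ℂ) :
    (Integrable (fun y => √(1 + ‖fderiv ℝ γ y‖ ^ 2) • F (graphMap γ y)) →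
      IntegrableOn F (range (graphMap γ)) (Measure.euclideanHausdorffMeasure d)) ∧
    ∫ p in range (graphMap γ), F p ∂(Measure.euclideanHausdorffMeasure d)
      = ∫ y, √(1 + ‖fderiv ℝ γ y‖ ^ 2) • F (graphMap γ y) := by
  have hemb := measurableEmbedding_graphMap hγ.continuous
  have hcont : Continuous (fderiv ℝ γ) := hγ.continuous_fderiv one_ne_zero
  have hJm : Measurable fun y => ENNReal.ofReal (√(1 + ‖fderiv ℝ γ y‖ ^ 2)) :=
    (ENNReal.continuous_ofReal.comp (by fun_prop : Continuous fun y =>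
      √(1 + ‖fderiv ℝ γ y‖ ^ 2))).measurable
  have hJt : ∀ᵐ y ∂(volume : Measure (Euc d)),
      ENNReal.ofReal (√(1 + ‖fderiv ℝ γ y‖ ^ 2)) < (⊤ : ℝ≥0∞) := by simp
  have hr : ∀ y, (ENNReal.ofReal (√(1 + ‖fderiv ℝ γ y‖ ^ 2))).toReal = √(1 + ‖fderiv ℝ γ y‖ ^ 2) :=
    fun y => ENNReal.toReal_ofReal (Real.sqrt_nonneg _)
  constructor
  · intro h
    rw [IntegrableOn, ← hemb.map_comap, hemb.integrable_map_iff,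
      comap_graphMap_euclideanHausdorffMeasure hγ,
      integrable_withDensity_iff_integrable_smul' hJm hJt]
    simp only [hr]
    exact h
  · rw [← hemb.map_comap, hemb.integral_map, comap_graphMap_euclideanHausdorffMeasure hγ,
      integral_withDensity_eq_integral_toReal_smul hJm hJt]
    simp only [hr]

/-- The isometry T preserves both Lebesgue and Hausdorff measure, so the claim reduces to the
subgraph. -/
theorem divergenceFormula_of_chart {Ω : Set (Euc n)} (hΩm : MeasurableSet Ω)
    (T : Euc n ≃ₗᵢ[ℝ] WithLp 2 (Euc (n - 1) × ℝ))
    {γ : Euc (n - 1) → ℝ} (hγ : ContDiff ℝ 1 γ) {U : Set (Euc n)} (hU : IsOpen U)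
    (hΩ : ∀ x ∈ U, x ∈ Ω ↔ (T x).snd < γ (T x).fst) (e : Euc n)
    {f : Euc n → ℂ} (hf : LocallyLipschitz f) (hc : HasCompactSupport f) (hs : tsupport f ⊆ U) :
    DivergenceFormula Ω e f := by
  have hemb := measurableEmbedding_graphMap hγ.continuous
  set F : Euc n → ℂ := fun x => f x * ((inner ℝ (outwardNormal Ω x) e : ℝ) : ℂ) with hF
  set g : WithLp 2 (Euc (n - 1) × ℝ) → ℂ := fun p => f (T.symm p) with hg
  have hgL : LocallyLipschitz g := hf.comp T.symm.lipschitz.locallyLipschitz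
  have hgc : HasCompactSupport g := hc.comp_homeomorph T.symm.toHomeomorph
  have hvol := integral_fderiv_below_graph hγ hgL hgc (T e)
  -- The area density cancels the normalization of the unit normal. Outside U, where the graph need
  -- not be the boundary of Ω, both sides vanish with f.
  have hpt : ∀ y, √(1 + ‖fderiv ℝ γ y‖ ^ 2) • F (T.symm (graphMap γ y))
      = g (graphMap γ y) * (((T e).snd - fderiv ℝ γ y (T e).fst : ℝ) : ℂ) := by
    intro y
    by_cases hy : T.symm (graphMap γ y) ∈ U
    · have hn := isOutwardUnitNormal_graph T hγ hU hΩ hy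
        (by rw [LinearIsometryEquiv.apply_symm_apply]; rfl)
      rw [hF]
      simp only
      rw [hn.outwardNormal_eq, LinearIsometryEquiv.apply_symm_apply,
        ← LinearIsometryEquiv.inner_map_map T, LinearIsometryEquiv.apply_symm_apply,
        inner_graphNormal, Complex.real_smul]
      have h0 : (√(1 + ‖fderiv ℝ γ y‖ ^ 2) : ℂ) ≠ 0 := by
        exact_mod_cast (by positivity : 0 < √(1 + ‖fderiv ℝ γ y‖ ^ 2)).ne'
      simp only [graphMap, WithLp.toLp_fst, hg]
      push_cast
      field_simp
    · have h0 : f (T.symm (graphMap γ y)) = 0 :=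
        image_eq_zero_of_notMem_tsupport fun h => hy (hs h)
      simp [hF, hg, h0]
  have hind : (frontier Ω).indicator F = (T ⁻¹' range (graphMap γ)).indicator F := by
    ext x
    by_cases hx : x ∈ U
    · have : x ∈ T ⁻¹' range (graphMap γ) ↔ x ∈ frontier Ω := by
        rw [mem_frontier_iff_of_chart T hγ.continuous hU hΩ hx]
        constructor
        · rintro ⟨y, hy⟩
          rw [← hy]; rfl
        · intro h
          refine ⟨(T x).fst, ?_⟩
          rw [graphMap, ← h]
          rfl
      by_cases hx' : x ∈ frontier Ω
      · rw [indicator_of_mem hx', indicator_of_mem (this.2 hx')]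
      · rw [indicator_of_notMem hx', indicator_of_notMem fun h => hx' (this.1 h)]
    · have h0 : F x = 0 := by
        simp [hF, image_eq_zero_of_notMem_tsupport fun h => hx (hs h)]
      rw [indicator_apply_eq_zero.2 fun _ => h0, indicator_apply_eq_zero.2 fun _ => h0]
  have hmr : MeasurableSet (T ⁻¹' range (graphMap γ)) :=
    T.continuous.measurable hemb.measurableSet_range
  have hTp : MeasurePreserving T (Measure.euclideanHausdorffMeasure (n - 1))
      (Measure.euclideanHausdorffMeasure (n - 1)) :=
    T.toIsometryEquiv.measurePreserving_euclideanHausdorffMeasure (n - 1)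
  have hTe : MeasurableEmbedding T := T.toHomeomorph.measurableEmbedding
  have hFT : ∀ x, F x = (fun p => F (T.symm p)) (T x) := fun x => by simp
  obtain ⟨hgi, hge⟩ := integral_euclideanHausdorffMeasure_graph hγ (fun p => F (T.symm p))
  simp only [hpt] at hgi hge
  constructor
  · rw [surfaceMeasure, ← IntegrableOn, ← integrable_indicator_iff isClosed_frontier.measurableSet,
      hind, integrable_indicator_iff hmr]
    have := (hTp.integrableOn_comp_preimage hTe (f := fun p => F (T.symm p))
      (s := range (graphMap γ))).2 (hgi ?_)
    · refine this.congr_fun (fun x _ => ?_) hmr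
      simp
    · have hc1 := hγ.continuous_fderiv one_ne_zero
      refine Continuous.integrable_of_hasCompactSupport ?_ (HasCompactSupport.mul_right ?_)
      · have := hgL.continuous
        have := continuous_graphMap hγ.continuous
        fun_prop
      · refine HasCompactSupport.intro (hgc.isCompact.image (f := WithLp.fst) (by fun_prop))
          fun y hy => ?_
        exact image_eq_zero_of_notMem_tsupport fun h => hy ⟨_, h, rfl⟩
  · have hR : ∫ x, F x ∂(surfaceMeasure Ω)
        = ∫ y, g (graphMap γ y) * (((T e).snd - fderiv ℝ γ y (T e).fst : ℝ) : ℂ) := by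
      rw [surfaceMeasure, ← integral_indicator isClosed_frontier.measurableSet, hind,
        integral_indicator hmr, ← hge, ← hTp.setIntegral_preimage_emb hTe]
      simp
    have hD : MeasurableSet {p : WithLp 2 (Euc (n - 1) × ℝ) | p.snd < γ p.fst} := by
      have := hγ.continuous
      exact (isOpen_lt (by fun_prop) (by fun_prop)).measurableSet
    have hL : ∫ x in Ω, fderiv ℝ f x e
        = ∫ p in {p : WithLp 2 (Euc (n - 1) × ℝ) | p.snd < γ p.fst}, fderiv ℝ g p (T e) := by
      have hgd : ∀ x, fderiv ℝ g (T x) (T e) = fderiv ℝ f x e := by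
        intro x
        have := T.symm.toContinuousLinearEquiv.comp_right_fderiv (f := f) (x := T x)
        change fderiv ℝ g (T x) = _ at this
        rw [this]
        simp
      rw [← (T.measurePreserving).setIntegral_preimage_emb hTe]
      simp only [hgd]
      rw [← integral_indicator hΩm, ← integral_indicator (T.continuous.measurable hD)]
      congr 1
      ext x
      by_cases hx : x ∈ U
      · by_cases hx' : x ∈ Ω
        · rw [indicator_of_mem hx', indicator_of_mem (by exact (hΩ x hx).1 hx')]
        · rw [indicator_of_notMem hx', indicator_of_notMem
            (s := T ⁻¹' {p : WithLp 2 (Euc (n - 1) × ℝ) | p.snd < γ p.fst})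
            fun h => hx' ((hΩ x hx).2 h)]
      · have h0 : fderiv ℝ f x e = 0 := by
          rw [fderiv_of_notMem_tsupport ℝ fun h => hx (hs h)]; rfl
        have h1 : ∀ s : Set (Euc n), s.indicator (fun x => fderiv ℝ f x e) x = 0 := fun s =>
          indicator_apply_eq_zero.2 fun _ => h0
        rw [h1, h1]
    rw [hL, hvol, hR]

/-- The derivative is additive only where both functions are differentiable, so Rademacher is needed
even here. -/
theorem DivergenceFormula.add {Ω : Set (Euc n)} {e : Euc n} {f g : Euc n → ℂ}
    (hf : LocallyLipschitz f) (hfc : HasCompactSupport f)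
    (hg : LocallyLipschitz g) (hgc : HasCompactSupport g)
    (h1 : DivergenceFormula Ω e f) (h2 : DivergenceFormula Ω e g) :
    DivergenceFormula Ω e (fun x => f x + g x) := by
  have i1 := (locallyLipschitz_integrable_fderiv volume hf hfc e).integrableOn (s := Ω)
  have i2 := (locallyLipschitz_integrable_fderiv volume hg hgc e).integrableOn (s := Ω)
  refine ⟨by simp only [add_mul]; exact h1.1.add h2.1, ?_⟩
  simp only [add_mul]
  rw [integral_add h1.1 h2.1, ← h1.2, ← h2.2, ← integral_add i1 i2]
  refine integral_congr_ae (ae_restrict_of_ae ?_)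
  filter_upwards [locallyLipschitz_ae_differentiableAt volume hf,
    locallyLipschitz_ae_differentiableAt volume hg] with x hx hy
  rw [fderiv_fun_add hx hy]
  rfl

/-- **Divergence theorem** on a bounded domain with `C^{1,1}` boundary, for the field `f e` with
`f` locally Lipschitz. -/
theorem divergenceFormula {Ω : Opens (Euc n)} (hΩ : IsAdmissibleDomain Ω) (e : Euc n)
    {f : Euc n → ℂ} (hf : LocallyLipschitz f) : DivergenceFormula (Ω : Set (Euc n)) e f := by
  have hK : IsCompact (closure (Ω : Set (Euc n))) := hΩ.bounded.isCompact_closure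
  -- Compact induction plays the role of a partition of unity: the property of a set is to have an
  -- open neighbourhood W such that the formula holds for every f supported in W.
  obtain ⟨W, hWo, hKW, hW⟩ : ∃ W : Set (Euc n), IsOpen W ∧ closure (Ω : Set (Euc n)) ⊆ W ∧
      ∀ f : Euc n → ℂ, LocallyLipschitz f → HasCompactSupport f → tsupport f ⊆ W →
        DivergenceFormula (Ω : Set (Euc n)) e f := by
    refine hK.induction_on (p := fun s => ∃ W : Set (Euc n), IsOpen W ∧ s ⊆ W ∧
      ∀ f : Euc n → ℂ, LocallyLipschitz f → HasCompactSupport f → tsupport f ⊆ W →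
        DivergenceFormula (Ω : Set (Euc n)) e f) ?_ ?_ ?_ ?_
    · exact ⟨∅, isOpen_empty, subset_rfl, fun f hf hc hs =>
        divergenceFormula_of_tsupport_subset Ω.isOpen e hf hc (hs.trans (empty_subset _))⟩
    · rintro s t hst ⟨W, h1, h2, h3⟩
      exact ⟨W, h1, hst.trans h2, h3⟩
    · rintro s t ⟨W₁, ho₁, hs₁, h₁⟩ ⟨W₂, ho₂, hs₂, h₂⟩
      refine ⟨W₁ ∪ W₂, ho₁.union ho₂, union_subset_union hs₁ hs₂, fun f hf hc hs => ?_⟩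
      -- χ is 1 near the part of the support of f outside W₂, so χ f is supported in W₁ and (1 − χ)
      -- f in W₂.
      obtain ⟨χ, hχ, hχc, hχs, hχ1⟩ := exists_contDiff_one_nhds_of_isCompact
        (hc.isCompact.diff ho₂) ho₁ (fun x hx => (hs hx.1).resolve_right hx.2)
      have hχL : LocallyLipschitz fun x => (χ x : ℂ) :=
        (Complex.ofRealCLM.contDiff.comp (hχ.of_le (by simp))).locallyLipschitz
      have hχL' : LocallyLipschitz fun x => 1 - (χ x : ℂ) :=
        (contDiff_const.sub (Complex.ofRealCLM.contDiff.comp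
          (hχ.of_le (by simp)) : ContDiff ℝ 1 fun x => (χ x : ℂ))).locallyLipschitz
      have l1 := locallyLipschitz_mul hχL hf
      have l2 := locallyLipschitz_mul hχL' hf
      have t1 : tsupport (fun x => (χ x : ℂ) * f x) ⊆ W₁ := by
        refine (tsupport_mul_subset_left.trans ?_).trans hχs
        exact closure_mono fun x hx => by simpa using hx
      have t2 : tsupport (fun x => (1 - (χ x : ℂ)) * f x) ⊆ W₂ := by
        intro x hx
        by_contra hxW
        have hxf : x ∈ tsupport f := tsupport_mul_subset_right hx
        refine (notMem_tsupport_iff_eventuallyEq.2 ?_) hx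
        filter_upwards [hχ1 x ⟨hxf, hxW⟩] with y hy
        simp [hy]
      have := DivergenceFormula.add l1 hc.mul_left l2 hc.mul_left
        (h₁ _ l1 hc.mul_left t1) (h₂ _ l2 hc.mul_left t2)
      refine (funext fun x => ?_ : f = _) ▸ this
      ring
    · intro x hx
      by_cases hxΩ : x ∈ (Ω : Set (Euc n))
      · exact ⟨Ω, nhdsWithin_le_nhds (Ω.isOpen.mem_nhds hxΩ), Ω, Ω.isOpen, subset_rfl,
          fun f hf hc hs => divergenceFormula_of_tsupport_subset Ω.isOpen e hf hc hs⟩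
      · obtain ⟨T, γ, K, U, hγ, -, hU, hxU, h⟩ := hΩ.c11 x
          (by rw [Ω.isOpen.frontier_eq]; exact ⟨hx, hxΩ⟩)
        exact ⟨U, nhdsWithin_le_nhds (hU.mem_nhds hxU), U, hU, subset_rfl,
          fun f hf hc hs => divergenceFormula_of_chart Ω.isOpen.measurableSet T hγ hU h e hf hc hs⟩
  -- A cutoff equal to 1 near the closure of Ω removes the compact support assumption without
  -- changing f or its derivative there.
  obtain ⟨χ, hχ, hχc, hχs, hχ1⟩ := exists_contDiff_one_nhds_of_isCompact hK hWo hKW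
  have hχL : LocallyLipschitz fun x => (χ x : ℂ) :=
    (Complex.ofRealCLM.contDiff.comp (hχ.of_le (by simp))).locallyLipschitz
  have hc : HasCompactSupport fun x => (χ x : ℂ) * f x :=
    (hχc.comp_left Complex.ofReal_zero).mul_right
  obtain ⟨d1, d2⟩ := hW _ (locallyLipschitz_mul hχL hf) hc (by
    refine (tsupport_mul_subset_left.trans ?_).trans hχs
    exact closure_mono fun x hx => by simpa using hx)
  have hb : (fun x => (χ x : ℂ) * f x * ((inner ℝ (outwardNormal (Ω : Set (Euc n)) x) e : ℝ) : ℂ))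
      =ᵐ[surfaceMeasure (Ω : Set (Euc n))]
      fun x => f x * ((inner ℝ (outwardNormal (Ω : Set (Euc n)) x) e : ℝ) : ℂ) := by
    refine (ae_restrict_iff' isClosed_frontier.measurableSet).2 (Eventually.of_forall fun x hx => ?_)
    simp [(hχ1 x (frontier_subset_closure hx)).self_of_nhds]
  refine ⟨d1.congr hb, ?_⟩
  rw [← integral_congr_ae hb, ← d2]
  refine setIntegral_congr_fun Ω.isOpen.measurableSet fun x hx => ?_
  have : (fun x => (χ x : ℂ) * f x) =ᶠ[𝓝 x] f := by
    filter_upwards [hχ1 x (subset_closure hx)] with y hy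
    simp [hy]
  simp only [this.fderiv_eq]

end Divergence

/-! ### Lipschitz extension of `C¹` fields -/

section Extension

variable {n : ℕ}

/-- The closure of Ω is not convex, so being C¹ on it does not at once give a Lipschitz bound.
Flattening the boundary by τ makes it locally a half space, which is convex; the bound obtained
there is pulled back. -/
theorem locallyLipschitzOn_closure_of_contDiffOn {Ω : Opens (Euc n)} (hΩ : IsAdmissibleDomain Ω)
    {A : Euc n → Euc n} (hA : ContDiffOn ℝ 1 A (closure (Ω : Set (Euc n)))) :
    LocallyLipschitzOn (closure (Ω : Set (Euc n))) A := by
  intro x hx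
  by_cases hxΩ : x ∈ (Ω : Set (Euc n))
  · have h1 : ContDiffAt ℝ 1 A x :=
      hA.contDiffAt (mem_of_superset (Ω.isOpen.mem_nhds hxΩ) subset_closure)
    obtain ⟨K, t, ht, hK⟩ := h1.exists_lipschitzOnWith
    exact ⟨K, t, mem_nhdsWithin_of_mem_nhds ht, hK⟩
  obtain ⟨T, γ, -, U, hγ, -, hU, hxU, hΩU⟩ := hΩ.c11 x
    (by rw [Ω.isOpen.frontier_eq]; exact ⟨hx, hxΩ⟩)
  have hfst : ContDiff ℝ 1 fun z : Euc n => (T z).fst :=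
    (WithLp.fstL 2 ℝ (Euc (n - 1)) ℝ).contDiff.comp T.toContinuousLinearEquiv.contDiff
  have hsnd : ContDiff ℝ 1 fun z : Euc n => (T z).snd :=
    (WithLp.sndL 2 ℝ (Euc (n - 1)) ℝ).contDiff.comp T.toContinuousLinearEquiv.contDiff
  set τ : Euc n → Euc (n - 1) × ℝ := fun z => ((T z).fst, (T z).snd - γ (T z).fst) with hτ
  have hτc : ContDiff ℝ 1 τ := hfst.prodMk (hsnd.sub (hγ.comp hfst))
  set σ : Euc (n - 1) × ℝ → Euc n := fun q => T.symm (WithLp.toLp 2 (q.1, γ q.1 + q.2)) with hσ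
  have hσc : ContDiff ℝ 1 σ := by
    refine T.symm.toContinuousLinearEquiv.contDiff.comp
      ((WithLp.prodContinuousLinearEquiv 2 ℝ (Euc (n - 1)) ℝ).symm.contDiff.comp
        (contDiff_fst.prodMk ((hγ.comp contDiff_fst).add contDiff_snd)))
  have hστ : ∀ z, σ (τ z) = z := by
    intro z
    simp only [hσ, hτ, add_sub_cancel]
    exact T.symm_apply_apply z
  have hTσ1 : ∀ q, (T (σ q)).fst = q.1 := fun q => by
    simp only [hσ, LinearIsometryEquiv.apply_symm_apply]
    rfl
  have hTσ2 : ∀ q, (T (σ q)).snd = γ q.1 + q.2 := fun q => by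
    simp only [hσ, LinearIsometryEquiv.apply_symm_apply]
    rfl
  set H : Set (Euc (n - 1) × ℝ) := {q | q.2 ≤ 0} with hH
  have hHc : Convex ℝ H := convex_halfSpace_le (LinearMap.snd ℝ (Euc (n - 1)) ℝ).isLinear 0
  have hclos : ∀ z ∈ U, z ∈ closure (Ω : Set (Euc n)) ↔ τ z ∈ H := by
    intro z hz
    rw [closure_eq_self_union_frontier, mem_union,
      mem_frontier_iff_of_chart T hγ.continuous hU hΩU hz, hΩU z hz, ← le_iff_lt_or_eq]
    simp [hH, hτ]
  have hmaps : MapsTo σ (H ∩ σ ⁻¹' U) (closure (Ω : Set (Euc n))) := by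
    rintro q ⟨hqH, hqU⟩
    rw [hclos _ hqU]
    simpa [hτ, hTσ1, hTσ2] using hqH
  have hBx : ContDiffWithinAt ℝ 1 (A ∘ σ) (H ∩ σ ⁻¹' U) (τ x) := by
    refine ContDiffWithinAt.comp (τ x) (t := closure (Ω : Set (Euc n))) ?_
      hσc.contDiffAt.contDiffWithinAt hmaps
    rw [hστ]
    exact hA x hx
  -- The neighbourhood U is dropped because only the half space itself is known to be convex.
  have hB : ContDiffWithinAt ℝ 1 (A ∘ σ) H (τ x) := by
    refine (contDiffWithinAt_inter ?_).1 hBx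
    exact (hU.preimage hσc.continuous).mem_nhds (by rw [mem_preimage, hστ]; exact hxU)
  obtain ⟨K, t, ht, hK⟩ := hB.exists_lipschitzOnWith hHc
  obtain ⟨L, s, hs, hL⟩ := (hτc.contDiffAt (x := x)).exists_lipschitzOnWith
  have htend : Tendsto τ (𝓝[closure (Ω : Set (Euc n))] x) (𝓝[H] (τ x)) := by
    refine tendsto_nhdsWithin_iff.2
      ⟨hτc.continuous.continuousAt.tendsto.mono_left nhdsWithin_le_nhds, ?_⟩
    filter_upwards [self_mem_nhdsWithin, nhdsWithin_le_nhds (hU.mem_nhds hxU)] with z hz hzU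
    exact (hclos z hzU).1 hz
  refine ⟨K * L, s ∩ τ ⁻¹' t, inter_mem (nhdsWithin_le_nhds hs) (htend ht), ?_⟩
  have := hK.comp (hL.mono (inter_subset_left (t := τ ⁻¹' t))) (fun z hz => hz.2)
  rwa [show (A ∘ σ) ∘ τ = A from funext fun z => congrArg A (hστ z)] at this

/-- A field which is `C¹` up to the boundary of an admissible domain agrees on the closure with a
Lipschitz field on the whole space. -/
theorem exists_lipschitzWith_eqOn_closure {Ω : Opens (Euc n)} (hΩ : IsAdmissibleDomain Ω)
    {A : Euc n → Euc n} (hA : ContDiffOn ℝ 1 A (closure (Ω : Set (Euc n)))) :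
    ∃ (A' : Euc n → Euc n) (K : ℝ≥0), LipschitzWith K A' ∧
      EqOn A A' (closure (Ω : Set (Euc n))) := by
  obtain ⟨K, hK⟩ := LocallyLipschitzOn.exists_lipschitzOnWith_of_compact
    hΩ.bounded.isCompact_closure (locallyLipschitzOn_closure_of_contDiffOn hΩ hA)
  obtain ⟨A', h1, h2⟩ := hK.extend_finite_dimension
  exact ⟨A', _, h1, h2⟩

end Extension

/-! ### Sobolev spaces -/

section Sobolev

variable {n : ℕ} {Ω : Opens (Euc n)}

theorem coeFn_toL2 {f : Euc n → ℂ} (hf : MemLp f 2 (volume.restrict (Ω : Set (Euc n)))) :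
    toL2 Ω f =ᵐ[volume.restrict (Ω : Set (Euc n))] f := by
  rw [toL2, dif_pos hf]
  exact hf.coeFn_toLp

theorem toL2_eq_of_ae_eq {f : Euc n → ℂ} {u : L2 Ω}
    (h : u =ᵐ[volume.restrict (Ω : Set (Euc n))] f) : toL2 Ω f = u := by
  have hf : MemLp f 2 (volume.restrict (Ω : Set (Euc n))) := (memLp_congr_ae h).1 (Lp.memLp u)
  exact Lp.ext ((coeFn_toL2 hf).trans h.symm)

theorem toL2_congr_ae {f g : Euc n → ℂ} (h : f =ᵐ[volume.restrict (Ω : Set (Euc n))] g) :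
    toL2 Ω f = toL2 Ω g := by
  by_cases hf : MemLp f 2 (volume.restrict (Ω : Set (Euc n)))
  · exact (toL2_eq_of_ae_eq ((coeFn_toL2 hf).trans h).symm.symm).symm
  · have hg : ¬ MemLp g 2 (volume.restrict (Ω : Set (Euc n))) := fun hg =>
      hf ((memLp_congr_ae h).2 hg)
    rw [toL2, toL2, dif_neg hf, dif_neg hg]

theorem toL2_add {f g : Euc n → ℂ} (hf : MemLp f 2 (volume.restrict (Ω : Set (Euc n))))
    (hg : MemLp g 2 (volume.restrict (Ω : Set (Euc n)))) :
    toL2 Ω (f + g) = toL2 Ω f + toL2 Ω g :=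
  toL2_eq_of_ae_eq ((Lp.coeFn_add _ _).trans ((coeFn_toL2 hf).add (coeFn_toL2 hg)))

theorem toL2_const_smul {f : Euc n → ℂ} (hf : MemLp f 2 (volume.restrict (Ω : Set (Euc n))))
    (c : ℂ) : toL2 Ω (c • f) = c • toL2 Ω f :=
  toL2_eq_of_ae_eq ((Lp.coeFn_smul _ _).trans ((coeFn_toL2 hf).const_smul c))

theorem integrable_L2_mul (u : L2 Ω) {f : Euc n → ℂ}
    (hf : MemLp f 2 (volume.restrict (Ω : Set (Euc n)))) :
    Integrable (fun x => u x * f x) (volume.restrict (Ω : Set (Euc n))) :=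
  (Lp.memLp u).integrable_mul hf

theorem inner_L2_eq (u v : L2 Ω) : inner ℂ u v = ∫ x in (Ω : Set (Euc n)), v x * conj (u x) := by
  rw [L2.inner_def]
  rfl

theorem memLp_of_bound_of_isBounded (hΩ : Bornology.IsBounded (Ω : Set (Euc n))) {f : Euc n → ℂ}
    {p : ℝ≥0∞} (hf : AEStronglyMeasurable f (volume.restrict (Ω : Set (Euc n)))) (C : ℝ)
    (hC : ∀ x ∈ (Ω : Set (Euc n)), ‖f x‖ ≤ C) :
    MemLp f p (volume.restrict (Ω : Set (Euc n))) := by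
  have : IsFiniteMeasure (volume.restrict (Ω : Set (Euc n))) :=
    ⟨by simpa using hΩ.measure_lt_top⟩
  exact MemLp.of_bound hf C ((ae_restrict_iff' Ω.isOpen.measurableSet).2 (ae_of_all _ hC))

theorem memLp_of_continuous (hΩ : Bornology.IsBounded (Ω : Set (Euc n))) {f : Euc n → ℂ}
    {p : ℝ≥0∞} (hf : Continuous f) : MemLp f p (volume.restrict (Ω : Set (Euc n))) := by
  obtain ⟨C, hC⟩ := hΩ.isCompact_closure.exists_bound_of_continuousOn hf.continuousOn
  exact memLp_of_bound_of_isBounded hΩ hf.aestronglyMeasurable C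
    fun x hx => hC x (subset_closure hx)

theorem norm_grad_le (f : Euc n → ℂ) (x : Euc n) (k : Fin n) : ‖grad f x k‖ ≤ ‖fderiv ℝ f x‖ := by
  simpa [grad] using (fderiv ℝ f x).le_opNorm (EuclideanSpace.single k 1)

theorem measurable_grad (f : Euc n → ℂ) (k : Fin n) : Measurable fun x => grad f x k :=
  measurable_fderiv_apply_const ℝ f _

theorem memLp_grad (hΩ : Bornology.IsBounded (Ω : Set (Euc n))) {f : Euc n → ℂ}
    {p : ℝ≥0∞} (hf : LocallyLipschitz f) (k : Fin n) :
    MemLp (fun x => grad f x k) p (volume.restrict (Ω : Set (Euc n))) := by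
  obtain ⟨C, hC⟩ := locallyLipschitz_norm_fderiv_le hf hΩ
  exact memLp_of_bound_of_isBounded hΩ (measurable_grad f k).aestronglyMeasurable C
    fun x hx => (norm_grad_le f x k).trans (hC x hx)

theorem grad_conj (f : Euc n → ℂ) (x : Euc n) (k : Fin n) :
    grad (fun x => conj (f x)) x k = conj (grad f x k) := by
  have := Complex.conjCLE.comp_fderiv (f := f) (x := x)
  change fderiv ℝ (fun x => conj (f x)) x = _ at this
  rw [grad, this]
  rfl

/-! Test functions -/

theorem testFunction_differentiable (φ : 𝓓(Ω, ℂ)) : Differentiable ℝ φ :=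
  φ.contDiff.differentiable (by simp)

theorem testFunction_locallyLipschitz (φ : 𝓓(Ω, ℂ)) : LocallyLipschitz φ :=
  (φ.contDiff.of_le (by simp)).locallyLipschitz

theorem testFunction_memLp (φ : 𝓓(Ω, ℂ)) {p : ℝ≥0∞} :
    MemLp φ p (volume.restrict (Ω : Set (Euc n))) :=
  (φ.continuous.memLp_of_hasCompactSupport φ.hasCompactSupport).restrict _

theorem testFunction_continuous_grad (φ : 𝓓(Ω, ℂ)) (k : Fin n) :
    Continuous fun x => grad φ x k :=
  (φ.contDiff.continuous_fderiv (by simp)).clm_apply continuous_const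

theorem testFunction_memLp_grad (φ : 𝓓(Ω, ℂ)) (k : Fin n) {p : ℝ≥0∞} :
    MemLp (fun x => grad φ x k) p (volume.restrict (Ω : Set (Euc n))) := by
  refine ((testFunction_continuous_grad φ k).memLp_of_hasCompactSupport ?_).restrict _
  exact (φ.hasCompactSupport.fderiv ℝ).comp_left (g := fun L : Euc n →L[ℝ] ℂ =>
    L (EuclideanSpace.single k 1)) rfl

/-- The complex conjugate of a test function. -/
noncomputable def conjTest (φ : 𝓓(Ω, ℂ)) : 𝓓(Ω, ℂ) where
  toFun x := conj (φ x)
  contDiff' := Complex.conjCLE.contDiff.comp φ.contDiff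
  hasCompactSupport' := φ.hasCompactSupport.comp_left (map_zero (starRingEnd ℂ))
  tsupport_subset' := by
    refine Subset.trans ?_ φ.tsupport_subset
    exact closure_mono fun x hx => by
      simpa using hx

theorem conjTest_apply (φ : 𝓓(Ω, ℂ)) (x : Euc n) : conjTest φ x = conj (φ x) := rfl

theorem grad_conjTest (φ : 𝓓(Ω, ℂ)) (x : Euc n) (k : Fin n) :
    grad (conjTest φ) x k = conj (grad φ x k) := grad_conj φ x k

theorem conjTest_conjTest (φ : 𝓓(Ω, ℂ)) : conjTest (conjTest φ) = φ := by
  ext x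
  simp [conjTest_apply]

/-- The fundamental lemma of the calculus of variations; real-valued test functions already suffice.
It makes weak derivatives and weak divergences unique, hence independent of the choices in their
definitions. -/
theorem L2_ext_of_testFunction {u v : L2 Ω}
    (h : ∀ φ : 𝓓(Ω, ℂ), ∫ x in (Ω : Set (Euc n)), u x * φ x = ∫ x in (Ω : Set (Euc n)), v x * φ x) :
    u = v := by
  have hae : ∀ᵐ x ∂(volume : Measure (Euc n)), x ∈ (Ω : Set (Euc n)) → (u - v) x = 0 := by
    refine Ω.isOpen.ae_eq_zero_of_integral_contDiff_smul_eq_zero ?_ fun g hg hgc hgs => ?_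
    · exact locallyIntegrableOn_of_locallyIntegrable_restrict
        ((Lp.memLp (u - v)).locallyIntegrable one_le_two)
    · let φ : 𝓓(Ω, ℂ) := ⟨fun x => (g x : ℂ), Complex.ofRealCLM.contDiff.comp hg,
        hgc.comp_left Complex.ofReal_zero, by
          refine Subset.trans ?_ hgs
          exact closure_mono fun x hx => by simpa using hx⟩
      have h1 := h φ
      rw [← setIntegral_eq_integral_of_forall_compl_eq_zero (s := (Ω : Set (Euc n)))]
      · have h2 : ∫ x in (Ω : Set (Euc n)), (u x * φ x - v x * φ x) = 0 := by
          rw [integral_sub (integrable_L2_mul u (testFunction_memLp φ))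
            (integrable_L2_mul v (testFunction_memLp φ)), h1, sub_self]
        rw [← h2]
        refine integral_congr_ae ?_
        filter_upwards [Lp.coeFn_sub u v] with x hx
        rw [hx, Complex.real_smul]
        simp only [Pi.sub_apply]
        change (g x : ℂ) * (u x - v x) = u x * (g x : ℂ) - v x * (g x : ℂ)
        ring
      · intro x hx
        rw [image_eq_zero_of_notMem_tsupport fun h => hx (hgs h), zero_smul]
  refine sub_eq_zero.1 (Lp.ext ?_)
  refine (ae_restrict_iff' Ω.isOpen.measurableSet).2 ?_
  have h0 : ∀ᵐ x ∂(volume : Measure (Euc n)), x ∈ (Ω : Set (Euc n)) → (0 : L2 Ω) x = 0 :=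
    (ae_restrict_iff' Ω.isOpen.measurableSet).1 (Lp.coeFn_zero ℂ 2 _)
  filter_upwards [hae, h0] with x h1 h2 hx
  rw [h1 hx, h2 hx]

theorem HasWeakPartial.unique {k : Fin n} {u g g' : L2 Ω} (h : HasWeakPartial k u g)
    (h' : HasWeakPartial k u g') : g = g' :=
  L2_ext_of_testFunction fun φ => by
    have := (h φ).symm.trans (h' φ)
    exact neg_injective this

theorem HasWeakPartial.weakPartial_eq {k : Fin n} {u g : L2 Ω} (h : HasWeakPartial k u g) :
    weakPartial k u = g := by
  have h' : ∃ g : L2 Ω, HasWeakPartial k u g := ⟨g, h⟩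
  rw [weakPartial, dif_pos h']
  exact h'.choose_spec.unique h

theorem MemH1.hasWeakPartial {u : L2 Ω} (h : MemH1 u) (k : Fin n) :
    HasWeakPartial k u (weakPartial k u) := by
  rw [weakPartial, dif_pos (h k)]
  exact (h k).choose_spec

theorem HasWeakDiv.weakDiv_eq {X : Fin n → L2 Ω} {d : L2 Ω} (h : HasWeakDiv X d) :
    weakDiv X = d := by
  have h' : ∃ d : L2 Ω, HasWeakDiv X d := ⟨d, h⟩
  rw [weakDiv, dif_pos h']
  exact L2_ext_of_testFunction fun φ => neg_injective ((h'.choose_spec φ).symm.trans (h φ))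

/-- As φ and its gradient vanish outside Ω, both integrals are integrals over the whole space. -/
theorem setIntegral_fderiv_mul_testFunction {f : Euc n → ℂ} (hf : LocallyLipschitz f)
    (φ : 𝓓(Ω, ℂ)) (k : Fin n) :
    ∫ x in (Ω : Set (Euc n)), f x * grad φ x k = -∫ x in (Ω : Set (Euc n)), grad f x k * φ x := by
  have h := locallyLipschitz_integral_fderiv_mul volume hf (testFunction_locallyLipschitz φ)
    φ.hasCompactSupport (EuclideanSpace.single k 1)
  rw [setIntegral_eq_integral_of_forall_compl_eq_zero,
    setIntegral_eq_integral_of_forall_compl_eq_zero]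
  · exact (neg_eq_iff_eq_neg.2 h).symm
  · intro x hx
    rw [image_eq_zero_of_notMem_tsupport fun h => hx (φ.tsupport_subset h), mul_zero]
  · intro x hx
    rw [grad, fderiv_of_notMem_tsupport ℝ fun h => hx (φ.tsupport_subset h)]
    simp

theorem hasWeakPartial_toL2 (hΩ : Bornology.IsBounded (Ω : Set (Euc n))) {f : Euc n → ℂ}
    (hf : LocallyLipschitz f) (k : Fin n) :
    HasWeakPartial k (toL2 Ω f) (toL2 Ω fun x => grad f x k) := by
  intro φ
  have e1 : ∫ x in (Ω : Set (Euc n)), toL2 Ω f x * grad φ x k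
      = ∫ x in (Ω : Set (Euc n)), f x * grad φ x k :=
    integral_congr_ae ((coeFn_toL2 (memLp_of_continuous hΩ hf.continuous)).mul (ae_eq_refl _))
  have e2 : ∫ x in (Ω : Set (Euc n)), toL2 Ω (fun x => grad f x k) x * φ x
      = ∫ x in (Ω : Set (Euc n)), grad f x k * φ x :=
    integral_congr_ae ((coeFn_toL2 (memLp_grad hΩ hf k)).mul (ae_eq_refl _))
  rw [e1, e2, setIntegral_fderiv_mul_testFunction hf]

end Sobolev

/-! ### The space `H¹₀(Ω)` as a Hilbert space of pairs `(u, ∇u)` -/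

section H10

variable {n : ℕ} {Ω : Opens (Euc n)}

/-- Pairs `(u, g)` of a function and a field in `L²(Ω)`: the function is the component `none`. -/
abbrev Jet (Ω : Opens (Euc n)) : Type := PiLp 2 fun _ : Option (Fin n) => L2 Ω

/-- The pair `(u, ∇u)`. -/
noncomputable def jet (u : L2 Ω) : Jet Ω :=
  WithLp.toLp 2 fun o => o.elim u fun k => weakPartial k u

theorem hasWeakPartial_testFunction (φ : 𝓓(Ω, ℂ)) (k : Fin n) :
    HasWeakPartial k (toL2 Ω φ) (toL2 Ω fun x => grad φ x k) := by
  intro ψ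
  have e1 : ∫ x in (Ω : Set (Euc n)), toL2 Ω φ x * grad ψ x k
      = ∫ x in (Ω : Set (Euc n)), φ x * grad ψ x k :=
    integral_congr_ae ((coeFn_toL2 (testFunction_memLp φ)).mul (ae_eq_refl _))
  have e2 : ∫ x in (Ω : Set (Euc n)), toL2 Ω (fun x => grad φ x k) x * ψ x
      = ∫ x in (Ω : Set (Euc n)), grad φ x k * ψ x :=
    integral_congr_ae ((coeFn_toL2 (testFunction_memLp_grad φ k)).mul (ae_eq_refl _))
  rw [e1, e2, setIntegral_fderiv_mul_testFunction (testFunction_locallyLipschitz φ)]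

theorem grad_add_testFunction (φ ψ : 𝓓(Ω, ℂ)) (k : Fin n) :
    (fun x => grad (φ + ψ : 𝓓(Ω, ℂ)) x k) = (fun x => grad φ x k) + fun x => grad ψ x k := by
  ext x
  have : fderiv ℝ (⇑(φ + ψ)) x = fderiv ℝ φ x + fderiv ℝ ψ x :=
    fderiv_add (testFunction_differentiable φ x) (testFunction_differentiable ψ x)
  simp only [grad, this, Pi.add_apply]
  rfl

theorem grad_smul_testFunction (c : ℂ) (φ : 𝓓(Ω, ℂ)) (k : Fin n) :
    (fun x => grad (c • φ : 𝓓(Ω, ℂ)) x k) = c • fun x => grad φ x k := by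
  ext x
  have : fderiv ℝ (⇑(c • φ)) x = c • fderiv ℝ φ x :=
    fderiv_const_smul (testFunction_differentiable φ x) c
  simp only [grad, this, Pi.smul_apply]
  rfl

/-- The pair `(φ, ∇φ)` of a test function `φ`. -/
noncomputable def testJet : 𝓓(Ω, ℂ) →ₗ[ℂ] Jet Ω where
  toFun φ := WithLp.toLp 2 fun o => o.elim (toL2 Ω φ) fun k => toL2 Ω fun x => grad φ x k
  map_add' φ ψ := by
    ext1 o
    cases o with
    | none => exact toL2_add (testFunction_memLp φ) (testFunction_memLp ψ)
    | some k =>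
      change toL2 Ω _ = toL2 Ω _ + toL2 Ω _
      rw [grad_add_testFunction, toL2_add (testFunction_memLp_grad φ k)
        (testFunction_memLp_grad ψ k)]
  map_smul' c φ := by
    ext1 o
    cases o with
    | none => exact toL2_const_smul (testFunction_memLp φ) c
    | some k =>
      change toL2 Ω _ = c • toL2 Ω _
      rw [grad_smul_testFunction, toL2_const_smul (testFunction_memLp_grad φ k)]

theorem testJet_none (φ : 𝓓(Ω, ℂ)) : testJet φ none = toL2 Ω φ := rfl

theorem testJet_some (φ : 𝓓(Ω, ℂ)) (k : Fin n) :
    testJet φ (some k) = toL2 Ω fun x => grad φ x k := rfl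

variable (Ω) in
/-- The closure of the set of pairs `(φ, ∇φ)`. -/
noncomputable def H10 : Submodule ℂ (Jet Ω) := (LinearMap.range (testJet (Ω := Ω))).topologicalClosure

theorem isClosed_H10 : IsClosed (H10 Ω : Set (Jet Ω)) :=
  Submodule.isClosed_topologicalClosure _

theorem testJet_mem_H10 (φ : 𝓓(Ω, ℂ)) : testJet φ ∈ H10 Ω :=
  Submodule.le_topologicalClosure _ ⟨φ, rfl⟩

/-- A closed condition need only be checked on test functions; this is how each identity below
passes to all of H¹₀. -/
theorem H10_induction {p : Jet Ω → Prop} (hp : IsClosed {q | p q}) (h : ∀ φ, p (testJet φ))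
    {q : Jet Ω} (hq : q ∈ H10 Ω) : p q := by
  have : (H10 Ω : Set (Jet Ω)) ⊆ {q | p q} := by
    rw [H10, Submodule.topologicalClosure_coe]
    refine closure_minimal ?_ hp
    rintro _ ⟨φ, rfl⟩
    exact h φ
  exact this hq

theorem integral_L2_mul_eq_inner (u : L2 Ω) {f : Euc n → ℂ}
    (hf : MemLp f 2 (volume.restrict (Ω : Set (Euc n)))) :
    ∫ x in (Ω : Set (Euc n)), u x * f x = inner ℂ (toL2 Ω fun x => conj (f x)) u := by
  rw [inner_L2_eq]
  have hf' : MemLp (fun x => conj (f x)) 2 (volume.restrict (Ω : Set (Euc n))) :=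
    hf.star
  refine integral_congr_ae ?_
  filter_upwards [coeFn_toL2 hf'] with x hx
  rw [hx, Complex.conj_conj]

/-- For a fixed test function the defining identity is continuous in the pair. So the closure of the
pairs (ψ, ∇ψ) still consists of pairs (u, ∇u), and H¹₀ is a closed subspace of a Hilbert space. -/
theorem hasWeakPartial_of_mem_H10 {q : Jet Ω} (hq : q ∈ H10 Ω) (k : Fin n) :
    HasWeakPartial k (q none) (q (some k)) := by
  intro φ
  refine H10_induction (p := fun q => ∫ x in (Ω : Set (Euc n)), q none x * grad φ x k
    = -∫ x in (Ω : Set (Euc n)), q (some k) x * φ x) ?_ (fun ψ => ?_) hq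
  · simp only [integral_L2_mul_eq_inner _ (testFunction_memLp φ),
      integral_L2_mul_eq_inner _ (testFunction_memLp_grad φ k)]
    exact isClosed_eq (by fun_prop) (by fun_prop)
  · exact hasWeakPartial_testFunction ψ k φ

theorem jet_eq_of_mem_H10 {q : Jet Ω} (hq : q ∈ H10 Ω) : jet (q none) = q := by
  ext1 o
  cases o with
  | none => rfl
  | some k => exact (hasWeakPartial_of_mem_H10 hq k).weakPartial_eq

theorem memH1_of_mem_H10 {q : Jet Ω} (hq : q ∈ H10 Ω) : MemH1 (q none) := fun k =>
  ⟨_, hasWeakPartial_of_mem_H10 hq k⟩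

theorem memH10_iff {u : L2 Ω} : MemH10 u ↔ jet u ∈ H10 Ω := by
  constructor
  · rintro ⟨-, h⟩
    rw [H10, ← SetLike.mem_coe, Submodule.topologicalClosure_coe, Metric.mem_closure_iff]
    intro ε hε
    -- A pair has n + 1 components in ℓ² norm, so this bound on each gives ε/2 in total, which
    -- leaves the strict inequality.
    obtain ⟨φ, h1, h2⟩ := h (ε / (2 * √(n + 1))) (by positivity)
    refine ⟨testJet φ, ⟨φ, rfl⟩, ?_⟩
    rw [dist_eq_norm, PiLp.norm_eq_of_L2]
    have hle : ∀ o : Option (Fin n), ‖(jet u - testJet φ) o‖ ^ 2 ≤ (ε / (2 * √(n + 1))) ^ 2 := by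
      intro o
      cases o with
      | none => exact pow_le_pow_left₀ (norm_nonneg _) h1 2
      | some k => exact pow_le_pow_left₀ (norm_nonneg _) (h2 k) 2
    have hn : (0 : ℝ) < n + 1 := by positivity
    calc √(∑ o, ‖(jet u - testJet φ) o‖ ^ 2)
        ≤ √(∑ _o : Option (Fin n), (ε / (2 * √(n + 1))) ^ 2) :=
          Real.sqrt_le_sqrt (Finset.sum_le_sum fun o _ => hle o)
      _ = ε / 2 := by
          rw [Finset.sum_const, Finset.card_univ, Fintype.card_option, Fintype.card_fin,
            nsmul_eq_mul, div_pow, mul_pow, Real.sq_sqrt hn.le]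
          rw [show ((n + 1 : ℕ) : ℝ) * (ε ^ 2 / (2 ^ 2 * (n + 1))) = (ε / 2) ^ 2 by
            push_cast; field_simp]
          exact Real.sqrt_sq (by positivity)
      _ < ε := by linarith
  · intro hq
    refine ⟨memH1_of_mem_H10 hq, fun ε hε => ?_⟩
    rw [H10, ← SetLike.mem_coe, Submodule.topologicalClosure_coe, Metric.mem_closure_iff] at hq
    obtain ⟨_, ⟨φ, rfl⟩, h⟩ := hq ε hε
    rw [dist_eq_norm] at h
    exact ⟨φ, (PiLp.norm_apply_le (jet u - testJet φ) none).trans h.le,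
      fun k => (PiLp.norm_apply_le (jet u - testJet φ) (some k)).trans h.le⟩

/-! ### The magnetic form -/

/-- Multiplication by a bounded function on `L²(Ω)`. -/
noncomputable def mulL {m : Euc n → ℂ}
    (hm : MemLp m (⊤ : ℝ≥0∞) (volume.restrict (Ω : Set (Euc n)))) : L2 Ω →L[ℂ] L2 Ω :=
  (ContinuousLinearMap.mul ℂ ℂ).holderL (volume.restrict (Ω : Set (Euc n))) ⊤ 2 2 (hm.toLp m)

theorem coeFn_mulL {m : Euc n → ℂ}
    (hm : MemLp m (⊤ : ℝ≥0∞) (volume.restrict (Ω : Set (Euc n)))) (u : L2 Ω) :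
    mulL hm u =ᵐ[volume.restrict (Ω : Set (Euc n))] fun x => m x * u x := by
  have h1 := ContinuousLinearMap.coeFn_holder (r := 2) (ContinuousLinearMap.mul ℂ ℂ)
    (hm.toLp m) u
  filter_upwards [h1, hm.coeFn_toLp] with x h2 h3
  rw [h3] at h2
  exact h2

/-- The `L^∞` bounds on the coefficients of the magnetic Schrödinger operator. -/
structure BoundedCoefficients (Ω : Opens (Euc n)) (A : Euc n → Euc n) (V : Euc n → ℝ) : Prop where
  field : ∀ k, MemLp (fun x => toC (A x) k) (⊤ : ℝ≥0∞) (volume.restrict (Ω : Set (Euc n)))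
  potential : MemLp (fun x => (V x : ℂ)) (⊤ : ℝ≥0∞) (volume.restrict (Ω : Set (Euc n)))

variable {A : Euc n → Euc n} {V : Euc n → ℝ}

/-- The `k`-th component of `(-i∇ + A) u`. -/
noncomputable def momentum (h : BoundedCoefficients Ω A V) (k : Fin n) : Jet Ω →L[ℂ] L2 Ω :=
  (-Complex.I) • PiLp.proj 2 (fun _ : Option (Fin n) => L2 Ω) (some k)
    + (mulL (h.field k)).comp (PiLp.proj 2 (fun _ : Option (Fin n) => L2 Ω) none)

theorem momentum_apply (h : BoundedCoefficients Ω A V) (k : Fin n) (q : Jet Ω) :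
    momentum h k q = (-Complex.I) • q (some k) + mulL (h.field k) (q none) := rfl

theorem coeFn_momentum (h : BoundedCoefficients Ω A V) (k : Fin n) (q : Jet Ω) :
    momentum h k q =ᵐ[volume.restrict (Ω : Set (Euc n))]
      fun x => -Complex.I * q (some k) x + toC (A x) k * q none x := by
  rw [momentum_apply]
  filter_upwards [Lp.coeFn_add ((-Complex.I) • q (some k)) (mulL (h.field k) (q none)),
    Lp.coeFn_smul (-Complex.I) (q (some k)), coeFn_mulL (h.field k) (q none)] with x h1 h2 h3
  rw [h1, Pi.add_apply, h2, h3]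
  rfl

/-- The operator of the form `⟨(-i∇ + A) u, (-i∇ + A) v⟩ + ⟨V u, v⟩` on pairs. -/
noncomputable def formOp (h : BoundedCoefficients Ω A V) : Jet Ω →L[ℂ] Jet Ω :=
  (∑ k, (momentum h k).adjoint.comp (momentum h k))
    + (PiLp.proj 2 (fun _ : Option (Fin n) => L2 Ω) none).adjoint.comp
      ((mulL h.potential).comp (PiLp.proj 2 (fun _ : Option (Fin n) => L2 Ω) none))

theorem inner_formOp (h : BoundedCoefficients Ω A V) (q p : Jet Ω) :
    inner ℂ q (formOp h p) = (∑ k, inner ℂ (momentum h k q) (momentum h k p))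
      + inner ℂ (q none) (mulL h.potential (p none)) := by
  simp only [formOp, _root_.add_apply, _root_.sum_apply,
    ContinuousLinearMap.comp_apply, inner_add_right, inner_sum,
    ContinuousLinearMap.adjoint_inner_right, PiLp.proj_apply]

/-- The inner product conjugates its first argument, so testing with the conjugate of φ turns the
sesquilinear form into the bilinear expression of `SolvesMagnetic`; as A is real, −i∇ + A becomes i∇
+ A on φ. -/
theorem inner_testJet_formOp (h : BoundedCoefficients Ω A V) (φ : 𝓓(Ω, ℂ)) (p : Jet Ω) :
    inner ℂ (testJet (conjTest φ)) (formOp h p)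
      = (∑ k, ∫ x in (Ω : Set (Euc n)), (-Complex.I * p (some k) x + toC (A x) k * p none x) *
          (Complex.I * grad φ x k + toC (A x) k * φ x))
      + ∫ x in (Ω : Set (Euc n)), (V x : ℂ) * p none x * φ x := by
  rw [inner_formOp]
  congr 1
  · refine Finset.sum_congr rfl fun k _ => ?_
    rw [inner_L2_eq]
    refine integral_congr_ae ?_
    filter_upwards [coeFn_momentum h k p, coeFn_momentum h k (testJet (conjTest φ)),
      coeFn_toL2 (testFunction_memLp (conjTest φ)),
      coeFn_toL2 (testFunction_memLp_grad (conjTest φ) k)] with x h1 h2 h3 h4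
    rw [h1, h2, testJet_none, testJet_some, h3, h4, grad_conjTest, conjTest_apply]
    simp [toC]
  · rw [inner_L2_eq]
    refine integral_congr_ae ?_
    filter_upwards [coeFn_mulL h.potential (p none),
      coeFn_toL2 (testFunction_memLp (conjTest φ))] with x h1 h2
    rw [h1, testJet_none, h2, conjTest_apply, Complex.conj_conj]

theorem inner_testFunction (φ : 𝓓(Ω, ℂ)) (f : L2 Ω) :
    inner ℂ (testJet (conjTest φ) none) f = ∫ x in (Ω : Set (Euc n)), f x * φ x := by
  rw [integral_L2_mul_eq_inner f (testFunction_memLp φ)]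
  rfl

/-- Conjugation permutes the test functions, and both sides are continuous in the test element, so
the weak equation extends from test functions to H¹₀. -/
theorem solvesMagnetic_iff (h : BoundedCoefficients Ω A V) {u f : L2 Ω} :
    SolvesMagnetic A V u f ↔ MemH1 u ∧ ∀ q ∈ H10 Ω,
      inner ℂ q (formOp h (jet u)) = inner ℂ (q none) f := by
  refine and_congr_right fun _ => ?_
  constructor
  · intro hs q hq
    refine H10_induction (p := fun q => inner ℂ q (formOp h (jet u)) = inner ℂ (q none) f)
      (isClosed_eq (by fun_prop) (by fun_prop)) (fun φ => ?_) hq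
    rw [← conjTest_conjTest φ, inner_testJet_formOp, inner_testFunction]
    exact hs (conjTest φ)
  · intro hs φ
    have := hs _ (testJet_mem_H10 (conjTest φ))
    rw [inner_testJet_formOp, inner_testFunction] at this
    exact this

end H10

/-! ### The resolvent -/

section Resolvent

variable {n : ℕ} {Ω : Opens (Euc n)} {A : Euc n → Euc n} {V : Euc n → ℝ}

theorem im_inner_mulL_real (h : BoundedCoefficients Ω A V) (u : L2 Ω) :
    (inner ℂ u (mulL h.potential u)).im = 0 := by
  rw [inner_L2_eq]
  have : ∫ x in (Ω : Set (Euc n)), mulL h.potential u x * conj (u x)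
      = ∫ x in (Ω : Set (Euc n)), ((V x * Complex.normSq (u x) : ℝ) : ℂ) := by
    refine integral_congr_ae ?_
    filter_upwards [coeFn_mulL h.potential u] with x hx
    rw [hx, mul_assoc, Complex.mul_conj]
    push_cast
    rfl
  rw [this, integral_complex_ofReal, Complex.ofReal_im]

/-- The operator of the form of `H - lam`. -/
noncomputable def shiftedFormOp (h : BoundedCoefficients Ω A V) (lam : ℂ) : Jet Ω →L[ℂ] Jet Ω :=
  formOp h - lam • (PiLp.proj 2 (fun _ : Option (Fin n) => L2 Ω) none).adjoint.comp
    (PiLp.proj 2 (fun _ : Option (Fin n) => L2 Ω) none)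

theorem inner_shiftedFormOp (h : BoundedCoefficients Ω A V) (lam : ℂ) (q p : Jet Ω) :
    inner ℂ q (shiftedFormOp h lam p)
      = inner ℂ q (formOp h p) - lam * inner ℂ (q none) (p none) := by
  simp only [shiftedFormOp, _root_.sub_apply, _root_.smul_apply, ContinuousLinearMap.comp_apply,
    inner_sub_right, inner_smul_right, ContinuousLinearMap.adjoint_inner_right, PiLp.proj_apply]

theorem inner_self_shiftedFormOp (h : BoundedCoefficients Ω A V) (lam : ℂ) (p : Jet Ω) :
    inner ℂ p (shiftedFormOp h lam p) = ((∑ k, ‖momentum h k p‖ ^ 2 : ℝ) : ℂ)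
      + inner ℂ (p none) (mulL h.potential (p none)) - lam * ((‖p none‖ ^ 2 : ℝ) : ℂ) := by
  have e : ∀ u : L2 Ω, inner ℂ u u = ((‖u‖ ^ 2 : ℝ) : ℂ) := fun u => by
    rw [inner_self_eq_norm_sq_to_K]
    push_cast
    rfl
  rw [inner_shiftedFormOp, inner_formOp, e (p none), Complex.ofReal_sum]
  congr 3
  funext k
  exact e _

/-- The form value is z = s + v − λa, with s the squared momentum, v the potential term and a =
‖u‖². Since s and v are real, |Im λ| a ≤ |z|. Then s ≤ |z| + (‖V‖ + |λ|)a, and the gradient is the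
momentum up to the bounded term A u. -/
theorem norm_sq_le_norm_inner_shiftedFormOp (h : BoundedCoefficients Ω A V) {lam : ℂ}
    (hlam : lam.im ≠ 0) : ∃ c : ℝ≥0, 0 < c ∧
      ∀ p : Jet Ω, ‖p‖ ^ 2 * c ≤ ‖inner ℂ p (shiftedFormOp h lam p)‖ := by
  obtain ⟨CV, hCV⟩ : ∃ c : ℝ, c = ‖mulL h.potential‖ := ⟨_, rfl⟩
  obtain ⟨CA, hCA⟩ : ∃ c : ℝ, c = ∑ k, ‖mulL (h.field k)‖ ^ 2 := ⟨_, rfl⟩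
  have hCV0 : 0 ≤ CV := hCV ▸ norm_nonneg _
  have hCA0 : 0 ≤ CA := hCA ▸ Finset.sum_nonneg fun k _ => sq_nonneg _
  have hl0 : 0 < |lam.im| := abs_pos.2 hlam
  -- Collects ‖p‖² ≤ 2s + (1 + 2C_A)a, s ≤ |z| + (C_V + |λ|)a and a ≤ |z|/|Im λ|.
  obtain ⟨D, hD⟩ : ∃ D : ℝ, D = 2 + (2 * (CV + ‖lam‖) + 1 + 2 * CA) / |lam.im| := ⟨_, rfl⟩
  have hD0 : 0 < D := by rw [hD]; positivity
  refine ⟨Real.toNNReal D⁻¹, Real.toNNReal_pos.2 (inv_pos.2 hD0), fun p => ?_⟩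
  set z := inner ℂ p (shiftedFormOp h lam p) with hz
  set a : ℝ := ‖p none‖ ^ 2 with ha
  set s : ℝ := ∑ k, ‖momentum h k p‖ ^ 2 with hs
  set v := inner ℂ (p none) (mulL h.potential (p none)) with hv
  have hzv : z = (s : ℂ) + v - lam * (a : ℂ) := inner_self_shiftedFormOp h lam p
  have hvim : v.im = 0 := im_inner_mulL_real h _
  have hvn : ‖v‖ ≤ CV * a := by
    calc ‖v‖ ≤ ‖p none‖ * ‖mulL h.potential (p none)‖ := norm_inner_le_norm _ _
      _ ≤ ‖p none‖ * (CV * ‖p none‖) := by gcongr; rw [hCV]; exact ContinuousLinearMap.le_opNorm _ _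
      _ = CV * a := by rw [ha]; ring
  have ha0 : 0 ≤ a := sq_nonneg _
  have h1 : |lam.im| * a ≤ ‖z‖ := by
    have : z.im = -(lam.im * a) := by rw [hzv]; simp [hvim]
    calc |lam.im| * a = |z.im| := by rw [this, abs_neg, abs_mul, abs_of_nonneg ha0]
      _ ≤ ‖z‖ := Complex.abs_im_le_norm z
  have h2 : s ≤ ‖z‖ + (CV + ‖lam‖) * a := by
    have e : (s : ℂ) = z - v + lam * a := by rw [hzv]; ring
    have hs0 : 0 ≤ s := Finset.sum_nonneg fun k _ => sq_nonneg _
    calc s = ‖(s : ℂ)‖ := by rw [Complex.norm_real, Real.norm_of_nonneg hs0]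
      _ ≤ ‖z‖ + ‖v‖ + ‖lam * a‖ := by
          rw [e]; exact (norm_add_le _ _).trans (by gcongr; exact norm_sub_le _ _)
      _ ≤ ‖z‖ + CV * a + ‖lam‖ * a := by
          gcongr
          rw [norm_mul, Complex.norm_real, Real.norm_of_nonneg ha0]
      _ = _ := by ring
  have h3 : ‖p‖ ^ 2 ≤ 2 * s + (1 + 2 * CA) * a := by
    rw [PiLp.norm_sq_eq_of_L2, Fintype.sum_option]
    have hk : ∀ k, ‖p (some k)‖ ^ 2 ≤ 2 * ‖momentum h k p‖ ^ 2 + 2 * (‖mulL (h.field k)‖ ^ 2 * a) := by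
      intro k
      have e : (-Complex.I) • p (some k) = momentum h k p - mulL (h.field k) (p none) := by
        rw [momentum_apply]; abel
      have e2 : ‖p (some k)‖ ≤ ‖momentum h k p‖ + ‖mulL (h.field k)‖ * ‖p none‖ := by
        calc ‖p (some k)‖ = ‖(-Complex.I) • p (some k)‖ := by rw [norm_smul]; simp
          _ ≤ _ := by
            rw [e]
            exact (norm_sub_le _ _).trans (by gcongr; exact ContinuousLinearMap.le_opNorm _ _)
      calc ‖p (some k)‖ ^ 2 ≤ (‖momentum h k p‖ + ‖mulL (h.field k)‖ * ‖p none‖) ^ 2 := by gcongr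
        _ ≤ _ := by
          rw [ha]
          nlinarith [sq_nonneg (‖momentum h k p‖ - ‖mulL (h.field k)‖ * ‖p none‖)]
    have := Finset.sum_le_sum fun k (_ : k ∈ Finset.univ) => hk k
    rw [Finset.sum_add_distrib, ← Finset.mul_sum, ← Finset.mul_sum, ← Finset.sum_mul, ← hCA] at this
    linarith
  have h4 : ‖p‖ ^ 2 ≤ D * ‖z‖ := by
    have h5 : a ≤ ‖z‖ / |lam.im| := by rw [le_div_iff₀ hl0]; linarith
    calc ‖p‖ ^ 2 ≤ 2 * ‖z‖ + (2 * (CV + ‖lam‖) + 1 + 2 * CA) * a := by linarith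
      _ ≤ 2 * ‖z‖ + (2 * (CV + ‖lam‖) + 1 + 2 * CA) * (‖z‖ / |lam.im|) := by gcongr
      _ = D * ‖z‖ := by rw [hD]; ring
  rw [Real.coe_toNNReal _ (inv_nonneg.2 hD0.le), ← div_eq_mul_inv, div_le_iff₀ hD0]
  linarith

/-- Lax–Milgram for the compression R of the form operator to H¹₀. No sign of V is needed, because
coercivity comes from the imaginary part of λ. -/
theorem resolventExists (h : BoundedCoefficients Ω A V) {lam : ℂ} (hlam : lam.im ≠ 0) :
    ResolventExists Ω A V lam := by
  have : CompleteSpace (H10 Ω) := isClosed_H10.completeSpace_coe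
  set R : H10 Ω →L[ℂ] H10 Ω :=
    (H10 Ω).subtypeL.adjoint.comp ((shiftedFormOp h lam).comp (H10 Ω).subtypeL) with hR
  have hRi : ∀ q p : H10 Ω, inner ℂ q (R p) = inner ℂ (q : Jet Ω) (shiftedFormOp h lam p) := by
    intro q p
    simp only [hR, ContinuousLinearMap.comp_apply, ContinuousLinearMap.adjoint_inner_right]
    rfl
  obtain ⟨c, hc, hcoe⟩ := norm_sq_le_norm_inner_shiftedFormOp h hlam
  have hbij : Function.Bijective R := by
    rw [← ContinuousLinearMap.isUnit_iff_bijective]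
    refine ContinuousLinearMap.isUnit_of_forall_le_norm_inner_map R hc fun p => ?_
    rw [norm_inner_symm, hRi]
    exact hcoe p
  intro f
  set P := PiLp.proj (𝕜 := ℂ) 2 (fun _ : Option (Fin n) => L2 Ω) none with hP
  -- The Riesz representative in H¹₀ of the functional given by f; solving (H − λ)v = f is solving R
  -- p = y.
  set y : H10 Ω := (H10 Ω).subtypeL.adjoint (P.adjoint f) with hy
  have hyi : ∀ q : H10 Ω, inner ℂ q y = inner ℂ ((q : Jet Ω) none) f := by
    intro q
    rw [hy, ContinuousLinearMap.adjoint_inner_right, ContinuousLinearMap.adjoint_inner_right]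
    rfl
  have hiff : ∀ p : H10 Ω, ((p : Jet Ω) none, f + lam • (p : Jet Ω) none) ∈ schrodingerGraph Ω A V
      ↔ R p = y := by
    intro p
    have hj := jet_eq_of_mem_H10 p.2
    simp only [schrodingerGraph, Set.mem_ofPred_eq, memH10_iff, hj, solvesMagnetic_iff h, p.2, true_and,
      memH1_of_mem_H10 p.2]
    constructor
    · intro hq
      refine ext_inner_left ℂ fun q => ?_
      rw [hRi, hyi, inner_shiftedFormOp, hq q q.2, inner_add_right, inner_smul_right]
      ring
    · intro hq q hqm
      have := hRi ⟨q, hqm⟩ p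
      rw [hq, hyi, inner_shiftedFormOp] at this
      rw [inner_add_right, inner_smul_right, this]
      ring
  obtain ⟨p, hp⟩ := hbij.2 y
  refine ⟨(p : Jet Ω) none, (hiff p).2 hp, fun v hv => ?_⟩
  have hm : jet v ∈ H10 Ω := memH10_iff.1 hv.1
  have := (hiff ⟨jet v, hm⟩).1 hv
  have := hbij.1 (this.trans hp.symm)
  rw [← this]
  rfl

theorem schrodingerResolvent_mem_graph {lam : ℂ} (h : ResolventExists Ω A V lam) (f : L2 Ω) :
    (schrodingerResolvent Ω A V lam f, f + lam • schrodingerResolvent Ω A V lam f)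
      ∈ schrodingerGraph Ω A V := by
  have h' := (h f).exists
  rw [schrodingerResolvent, dif_pos h']
  exact h'.choose_spec

/-- `weakPartial` is defined by choice with default value 0, so it respects differences only once
both functions are known to lie in H¹. -/
theorem jet_sub {u v : L2 Ω} (hu : MemH1 u) (hv : MemH1 v) : jet (u - v) = jet u - jet v := by
  ext1 o
  cases o with
  | none => rfl
  | some k =>
    refine HasWeakPartial.weakPartial_eq fun φ => ?_
    have i1 := hu.hasWeakPartial k φ
    have i2 := hv.hasWeakPartial k φ
    rw [integral_L2_mul_eq_inner _ (testFunction_memLp_grad φ k),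
      integral_L2_mul_eq_inner _ (testFunction_memLp φ)] at i1 i2 ⊢
    change _ = - inner ℂ _ (weakPartial k u - weakPartial k v)
    rw [inner_sub_right, inner_sub_right, i1, i2]
    ring

theorem memH1_sub {u v : L2 Ω} (hu : MemH1 u) (hv : MemH1 v) : MemH1 (u - v) := by
  intro k
  refine ⟨weakPartial k u - weakPartial k v, fun φ => ?_⟩
  have i1 := hu.hasWeakPartial k φ
  have i2 := hv.hasWeakPartial k φ
  rw [integral_L2_mul_eq_inner _ (testFunction_memLp_grad φ k),
    integral_L2_mul_eq_inner _ (testFunction_memLp φ)] at i1 i2 ⊢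
  rw [inner_sub_right, inner_sub_right, i1, i2]
  ring

theorem SolvesMagnetic.sub (h : BoundedCoefficients Ω A V) {u v f g : L2 Ω}
    (hu : SolvesMagnetic A V u f) (hv : SolvesMagnetic A V v g) :
    SolvesMagnetic A V (u - v) (f - g) := by
  rw [solvesMagnetic_iff h] at hu hv ⊢
  refine ⟨memH1_sub hu.1 hv.1, fun q hq => ?_⟩
  rw [jet_sub hu.1 hv.1, map_sub, inner_sub_right, inner_sub_right, hu.2 q hq, hv.2 q hq]

theorem MemH10.sub {u v : L2 Ω} (hu : MemH10 u) (hv : MemH10 v) : MemH10 (u - v) := by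
  rw [memH10_iff] at *
  have h1 : MemH1 u := memH1_of_mem_H10 hu
  have h2 : MemH1 v := memH1_of_mem_H10 hv
  rw [jet_sub h1 h2]
  exact (H10 Ω).sub_mem hu hv

/-- If `H F = f + lam F` weakly, the Dirichlet problem with datum `F` has the unique solution
`F - (H - lam)⁻¹ f`. -/
theorem isDirichletSolution_iff (h : BoundedCoefficients Ω A V) {lam : ℂ} (hlam : lam.im ≠ 0)
    {F f u : L2 Ω} (hF : SolvesMagnetic A V F (f + lam • F)) :
    IsDirichletSolution A V lam F u ↔ u = F - schrodingerResolvent Ω A V lam f := by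
  have hres := resolventExists h hlam
  obtain ⟨hw1, hw2⟩ := schrodingerResolvent_mem_graph hres f
  set w := schrodingerResolvent Ω A V lam f
  constructor
  · rintro ⟨h1, h2⟩
    have h3 : (F - u, f + lam • (F - u)) ∈ schrodingerGraph Ω A V := by
      refine ⟨?_, ?_⟩
      -- Here −a is written as a − a − a, so that closure under subtraction suffices.
      · have : MemH10 (u - F - (u - F) - (u - F)) := (h2.sub h2).sub h2
        simpa using this
      · have := hF.sub h h1
        rw [smul_sub, ← add_sub_assoc]
        exact this
    have := (hres f).unique h3 ⟨hw1, hw2⟩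
    rw [← this]
    abel
  · rintro rfl
    refine ⟨?_, ?_⟩
    · have := hF.sub h hw2
      rwa [add_sub_add_left_eq_sub, ← smul_sub] at this
    · have : MemH10 (w - w - w) := (hw1.sub hw1).sub hw1
      simpa using this

end Resolvent

/-! ### Integrals along half lines -/

section Phase

variable {n : ℕ} {η : Euc n}

theorem isClosedEmbedding_line (hη : ‖η‖ = 1) (x : Euc n) :
    IsClosedEmbedding fun s : ℝ => x + s • η := by
  refine Isometry.isClosedEmbedding (Isometry.of_dist_eq fun s t => ?_)
  rw [dist_add_left, dist_eq_norm, ← sub_smul, norm_smul, hη, mul_one, dist_eq_norm]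

theorem integrable_line {F : Type} [NormedAddCommGroup F] (hη : ‖η‖ = 1) {h : Euc n → F} (hh : Continuous h)
    (hc : HasCompactSupport h) (x : Euc n) : Integrable fun s : ℝ => h (x + s • η) :=
  (hh.comp (by fun_prop)).integrable_of_hasCompactSupport
    (hc.comp_isClosedEmbedding (isClosedEmbedding_line hη x))

variable {F : Type} [NormedAddCommGroup F] [NormedSpace ℝ F]

theorem hasFDerivAt_lineIntegral (hη : ‖η‖ = 1) {h : Euc n → F} (hh : ContDiff ℝ 1 h)
    (hc : HasCompactSupport h) (x₀ : Euc n) :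
    HasFDerivAt (fun x => ∫ s in Iic (0 : ℝ), h (x + s • η))
      (∫ s in Iic (0 : ℝ), fderiv ℝ h (x₀ + s • η)) x₀ := by
  have hc' : HasCompactSupport (fderiv ℝ h) := hc.fderiv ℝ
  have hcont : Continuous (fderiv ℝ h) := hh.continuous_fderiv one_ne_zero
  obtain ⟨C, hC⟩ := hcont.bounded_above_of_compact_support hc'
  obtain ⟨R, hR⟩ := hc'.isCompact.isBounded.subset_closedBall (0 : Euc n)
  -- For x within 1 of x₀, the point x + sη can lie in the support only if |s| = ‖sη‖ ≤ R + ‖x₀‖ +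
  -- 1. This gives a dominating function independent of x.
  set M := R + (‖x₀‖ + 1)
  have hint : Integrable ((Icc (-M) M).indicator fun _ => C) (volume.restrict (Iic (0 : ℝ))) :=
    ((integrable_indicator_iff measurableSet_Icc).2
      (integrableOn_const (by simp))).restrict
  refine hasFDerivAt_integral_of_dominated_of_fderiv_le
    (bound := (Icc (-M) M).indicator fun _ => C)
    (F := fun x s => h (x + s • η)) (F' := fun x s => fderiv ℝ h (x + s • η))
    (Metric.ball_mem_nhds x₀ one_pos) ?_ ?_ ?_ ?_ hint ?_
  · exact Eventually.of_forall fun x => (integrable_line hη hh.continuous hc x).1.restrict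
  · exact (integrable_line hη hh.continuous hc x₀).restrict
  · exact (integrable_line hη hcont hc' x₀).1.restrict
  · refine Eventually.of_forall fun s x hx => ?_
    by_cases hs : s ∈ Icc (-M) M
    · rw [indicator_of_mem hs]
      exact hC _
    · suffices hm : x + s • η ∉ tsupport (fderiv ℝ h) by
        rw [indicator_of_notMem hs, image_eq_zero_of_notMem_tsupport hm, norm_zero]
      intro hm
      have h1 : ‖x + s • η‖ ≤ R := by simpa using hR hm
      have h2 : ‖x‖ ≤ ‖x₀‖ + 1 := by
        have := mem_ball_iff_norm.1 hx
        linarith [norm_le_norm_add_norm_sub' x x₀]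
      have h3 : |s| ≤ M := by
        calc |s| = ‖s • η‖ := by rw [norm_smul, hη, mul_one, Real.norm_eq_abs]
          _ = ‖(x + s • η) - x‖ := by rw [add_sub_cancel_left]
          _ ≤ M := (norm_sub_le _ _).trans (add_le_add h1 h2)
      exact hs (abs_le.1 h3)
  · refine Eventually.of_forall fun s x _ => ?_
    have h1 := ((hh.differentiable one_ne_zero) (x + s • η)).hasFDerivAt
    exact h1.comp x ((hasFDerivAt_id x).add_const (s • η))

/-- The derivative of a line integral is the line integral of the derivative, with values in a
larger space; hence the induction over all target spaces. -/
theorem contDiff_lineIntegral (hη : ‖η‖ = 1) (m : ℕ) {F : Type} [NormedAddCommGroup F]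
    [NormedSpace ℝ F] {h : Euc n → F} (hh : ContDiff ℝ ∞ h) (hc : HasCompactSupport h) :
    ContDiff ℝ m fun x => ∫ s in Iic (0 : ℝ), h (x + s • η) := by
  induction m generalizing F with
  | zero =>
    refine contDiff_zero.2 (continuous_iff_continuousAt.2 fun x => ?_)
    exact (hasFDerivAt_lineIntegral hη (hh.of_le (by norm_cast)) hc x).continuousAt
  | succ m ih =>
    have hd := hasFDerivAt_lineIntegral hη (hh.of_le (by norm_cast)) hc
    rw [Nat.cast_succ, contDiff_succ_iff_fderiv]
    refine ⟨fun x => (hd x).differentiableAt, by simp, ?_⟩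
    rw [funext fun x => (hd x).fderiv]
    exact ih (hh.fderiv_right (by simp)) (hc.fderiv ℝ)

/-- Along η the derivative is the total derivative in s, and h vanishes far out on the line. -/
theorem lineIntegral_fderiv_apply [CompleteSpace F] (hη : ‖η‖ = 1) {h : Euc n → F}
    (hh : ContDiff ℝ 1 h) (hc : HasCompactSupport h) (x : Euc n) :
    (∫ s in Iic (0 : ℝ), fderiv ℝ h (x + s • η)) η = h x := by
  have hcont : Continuous (fderiv ℝ h) := hh.continuous_fderiv one_ne_zero
  have hi := (integrable_line hη hcont (hc.fderiv ℝ) x).restrict (s := Iic (0 : ℝ))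
  rw [ContinuousLinearMap.integral_apply hi]
  have hd : ∀ s ∈ Iic (0 : ℝ), HasDerivAt (fun s : ℝ => h (x + s • η))
      (fderiv ℝ h (x + s • η) η) s := by
    intro s _
    have h1 := ((hh.differentiable one_ne_zero) (x + s • η)).hasFDerivAt
    have h2 : HasDerivAt (fun s : ℝ => x + s • η) η s := by
      simpa using ((hasDerivAt_id s).smul_const η).const_add x
    exact h1.comp_hasDerivAt s h2
  have ht : Tendsto (fun s : ℝ => h (x + s • η)) atBot (𝓝 0) := by
    have := (hc.comp_isClosedEmbedding (isClosedEmbedding_line hη x)).is_zero_at_infty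
    exact this.mono_left atBot_le_cocompact
  have := integral_Iic_of_hasDerivAt_of_tendsto' hd (hi.apply_continuousLinearMap η) ht
  simpa using this

theorem contDiff_phase (hη : ‖η‖ = 1) {As : Euc n → Euc n} (hAs : ContDiff ℝ ∞ As)
    (hc : HasCompactSupport As) : ContDiff ℝ 2 (phase η As) := by
  have h1 : ContDiff ℝ ∞ fun x => (inner ℝ η (As x) : ℝ) := contDiff_const.inner ℝ hAs
  have h2 : HasCompactSupport fun x => (inner ℝ η (As x) : ℝ) :=
    hc.comp_left (g := fun y => (inner ℝ η y : ℝ)) (inner_zero_right _)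
  exact Complex.ofRealCLM.contDiff.comp (contDiff_lineIntegral hη 2 h1 h2).neg

/-- The transport equation for the phase. It is the reason why A appears at order √λ only through A
− A_♯. -/
theorem fderiv_phase (hη : ‖η‖ = 1) {As : Euc n → Euc n} (hAs : ContDiff ℝ ∞ As)
    (hc : HasCompactSupport As) (x : Euc n) :
    fderiv ℝ (phase η As) x η = -rdot η (As x) := by
  have h1 : ContDiff ℝ 1 fun x => (inner ℝ η (As x) : ℝ) :=
    contDiff_const.inner ℝ (hAs.of_le (by norm_cast))
  have h2 : HasCompactSupport fun x => (inner ℝ η (As x) : ℝ) :=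
    hc.comp_left (g := fun y => (inner ℝ η y : ℝ)) (inner_zero_right _)
  have h3 := Complex.ofRealCLM.hasFDerivAt.comp x (hasFDerivAt_lineIntegral hη h1 h2 x).neg
  have h4 : HasFDerivAt (phase η As) _ x := h3
  rw [h4.fderiv, ContinuousLinearMap.comp_apply, _root_.neg_apply,
    lineIntegral_fderiv_apply hη h1 h2]
  simp [rdot]

end Phase

/-! ### Calculus of complex gradients -/

section Gradient

variable {n : ℕ} {x : Euc n}

theorem toC_dotProduct_toC (v w : Euc n) : toC v ⬝ᵥ toC w = rdot v w := by
  simp [toC, rdot, dotProduct, PiLp.inner_apply, mul_comm]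

theorem rdot_self (v : Euc n) : rdot v v = (‖v‖ : ℂ) ^ 2 := by
  simp [rdot]

theorem toC_dotProduct_grad (v : Euc n) (f : Euc n → ℂ) (x : Euc n) :
    toC v ⬝ᵥ grad f x = fderiv ℝ f x v := by
  conv_rhs => rw [← (EuclideanSpace.basisFun (Fin n) ℝ).sum_repr v]
  simp [dotProduct, toC, grad, EuclideanSpace.basisFun_repr]

theorem laplacian_eq_sum (f : Euc n → ℂ) (x : Euc n) :
    Laplacian.laplacian f x = ∑ k : Fin n,
      fderiv ℝ (fderiv ℝ f) x (EuclideanSpace.single k 1) (EuclideanSpace.single k 1) := by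
  rw [InnerProductSpace.laplacian_eq_iteratedFDeriv_orthonormalBasis f
    (EuclideanSpace.basisFun (Fin n) ℝ)]
  simp [iteratedFDeriv_two_apply]

theorem grad_mul {f g : Euc n → ℂ} (hf : DifferentiableAt ℝ f x) (hg : DifferentiableAt ℝ g x)
    (k : Fin n) :
    grad (fun y => f y * g y) x k = grad f x k * g x + f x * grad g x k := by
  simp only [grad]
  rw [fderiv_fun_mul hf hg]
  simp [mul_comm, add_comm]

theorem grad_add {f g : Euc n → ℂ} (hf : DifferentiableAt ℝ f x) (hg : DifferentiableAt ℝ g x)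
    (k : Fin n) : grad (fun y => f y + g y) x k = grad f x k + grad g x k := by
  simp only [grad]
  rw [fderiv_fun_add hf hg]
  simp

theorem grad_const_mul {f : Euc n → ℂ} (hf : DifferentiableAt ℝ f x) (c : ℂ) (k : Fin n) :
    grad (fun y => c * f y) x k = c * grad f x k := by
  simp only [grad]
  rw [fderiv_const_mul hf]
  simp

theorem grad_const (c : ℂ) (x : Euc n) (k : Fin n) : grad (fun _ => c) x k = 0 := by
  simp [grad]

theorem grad_cexp {f : Euc n → ℂ} (hf : DifferentiableAt ℝ f x) (k : Fin n) :
    grad (fun y => Complex.exp (f y)) x k = Complex.exp (f x) * grad f x k := by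
  simp only [grad]
  rw [hf.hasFDerivAt.cexp.fderiv]
  simp

theorem contDiff_rdot (η : Euc n) : ContDiff ℝ ω (rdot η) :=
  Complex.ofRealCLM.contDiff.comp (contDiff_const.inner ℝ contDiff_id)

theorem grad_rdot (η x : Euc n) (k : Fin n) : grad (rdot η) x k = toC η k := by
  have h : HasFDerivAt (rdot η) (Complex.ofRealCLM.comp (innerSL ℝ η)) x :=
    (Complex.ofRealCLM.comp (innerSL ℝ η)).hasFDerivAt
  simp [grad, h.fderiv, toC, EuclideanSpace.inner_single_right]

/-- The `k`-th coordinate, as a complex number. -/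
noncomputable def coordC (k : Fin n) : Euc n →L[ℝ] ℂ :=
  Complex.ofRealCLM.comp (innerSL ℝ (EuclideanSpace.single k 1))

theorem coordC_apply (k : Fin n) (v : Euc n) : coordC k v = toC v k := by
  simp [coordC, toC, EuclideanSpace.inner_single_left]

theorem hasFDerivAt_toC {A : Euc n → Euc n} (hA : DifferentiableAt ℝ A x) (k : Fin n) :
    HasFDerivAt (fun y => toC (A y) k) ((coordC k).comp (fderiv ℝ A x)) x := by
  have := (coordC k).hasFDerivAt.comp x hA.hasFDerivAt
  simpa only [Function.comp_def, coordC_apply] using this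

theorem grad_toC {A : Euc n → Euc n} (hA : DifferentiableAt ℝ A x) (k j : Fin n) :
    grad (fun y => toC (A y) k) x j = ((fderiv ℝ A x (EuclideanSpace.single j 1) k : ℝ) : ℂ) := by
  rw [grad, (hasFDerivAt_toC hA k).fderiv, ContinuousLinearMap.comp_apply, coordC_apply]
  rfl

theorem hasFDerivAt_grad {f : Euc n → ℂ} (hf : DifferentiableAt ℝ (fderiv ℝ f) x) (k : Fin n) :
    HasFDerivAt (fun y => grad f y k)
      ((fderiv ℝ (fderiv ℝ f) x).flip (EuclideanSpace.single k 1)) x := by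
  have := hf.hasFDerivAt.clm_apply (hasFDerivAt_const (EuclideanSpace.single k (1 : ℝ)) x)
  simpa [grad] using this

theorem grad_grad {f : Euc n → ℂ} (hf : DifferentiableAt ℝ (fderiv ℝ f) x) (k : Fin n) :
    grad (fun y => grad f y k) x k
      = fderiv ℝ (fderiv ℝ f) x (EuclideanSpace.single k 1) (EuclideanSpace.single k 1) := by
  rw [grad, (hasFDerivAt_grad hf k).fderiv]
  rfl

end Gradient

/-! ### The momentum of modulated plane waves -/

section Wave

variable {n : ℕ} {ι r : ℂ} {η : Euc n} {ψ b : Euc n → ℂ} {A : Euc n → Euc n} {x : Euc n}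

/-- The modulated plane wave `e^{-ι (r η·x + ψ)}`. -/
noncomputable def wave (ι r : ℂ) (η : Euc n) (ψ : Euc n → ℂ) (x : Euc n) : ℂ :=
  Complex.exp (-ι * (r * rdot η x + ψ x))

/-- The field `(ι∇ + A) Φ`. -/
noncomputable def momentumField (ι : ℂ) (A : Euc n → Euc n) (Φ : Euc n → ℂ) (x : Euc n) :
    Fin n → ℂ :=
  ι • grad Φ x + Φ x • toC (A x)

/-- The vector `r η + ∇ψ + A`. -/
noncomputable def waveVector (r : ℂ) (η : Euc n) (ψ : Euc n → ℂ) (A : Euc n → Euc n) (x : Euc n) :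
    Fin n → ℂ :=
  r • toC η + grad ψ x + toC (A x)

theorem differentiableAt_exponent (hψ : DifferentiableAt ℝ ψ x) :
    DifferentiableAt ℝ (fun y => r * rdot η y + ψ y) x :=
  (((contDiff_rdot η).differentiable (by simp) x).const_mul r).add hψ

theorem contDiff_wave {m : WithTop ℕ∞} (hψ : ContDiff ℝ m ψ) : ContDiff ℝ m (wave ι r η ψ) :=
  (contDiff_const.mul ((contDiff_const.mul ((contDiff_rdot η).of_le le_top)).add hψ)).cexp

theorem grad_wave (hψ : DifferentiableAt ℝ ψ x) (k : Fin n) :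
    grad (wave ι r η ψ) x k = -ι * (r * toC η k + grad ψ x k) * wave ι r η ψ x := by
  have h := differentiableAt_exponent (r := r) (η := η) hψ
  unfold wave
  rw [grad_cexp (h.const_mul (-ι)), grad_const_mul h,
    grad_add (((contDiff_rdot η).differentiable (by simp) x).const_mul r) hψ,
    grad_const_mul ((contDiff_rdot η).differentiable (by simp) x), grad_rdot]
  ring

/-- Keeping ι with ι² = −1 treats both ansatz functions at once: ι = −i for Φ₁ and ι = i for Φ₂. As
ι·(−ι) = 1, conjugation by the wave turns ι∇ + A into ι∇ + B, with B the wave vector. -/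
theorem momentumField_mul_wave (hι : ι * ι = -1) (hψ : DifferentiableAt ℝ ψ x)
    (hb : DifferentiableAt ℝ b x) (k : Fin n) :
    momentumField ι A (fun y => b y * wave ι r η ψ y) x k
      = (ι * grad b x k + b x * waveVector r η ψ A x k) * wave ι r η ψ x := by
  have hw : DifferentiableAt ℝ (wave ι r η ψ) x :=
    ((differentiableAt_exponent hψ).const_mul (-ι)).cexp
  simp only [momentumField, waveVector, Pi.add_apply, Pi.smul_apply, smul_eq_mul]
  rw [grad_mul hb hw, grad_wave hψ]
  linear_combination (-b x * (r * toC η k + grad ψ x k) * wave ι r η ψ x) * hι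

theorem grad_waveVector (hψ : DifferentiableAt ℝ (fderiv ℝ ψ) x) (hA : DifferentiableAt ℝ A x)
    (k : Fin n) :
    DifferentiableAt ℝ (fun y => waveVector r η ψ A y k) x ∧
    grad (fun y => waveVector r η ψ A y k) x k
      = fderiv ℝ (fderiv ℝ ψ) x (EuclideanSpace.single k 1) (EuclideanSpace.single k 1)
        + ((fderiv ℝ A x (EuclideanSpace.single k 1) k : ℝ) : ℂ) := by
  have h1 := (hasFDerivAt_grad hψ k).differentiableAt
  have h2 := (hasFDerivAt_toC hA k).differentiableAt
  have h3 : DifferentiableAt ℝ (fun y => r * toC η k + grad ψ y k) x :=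
    (differentiableAt_const _).add h1
  simp only [waveVector, Pi.add_apply, Pi.smul_apply, smul_eq_mul]
  refine ⟨h3.add h2, ?_⟩
  rw [grad_add h3 h2, grad_add (differentiableAt_const _) h1, grad_const, zero_add, grad_grad hψ,
    grad_toC hA]

/-- The expansion of `(ι∇ + A)² (b w)` for a modulated plane wave `w`. -/
theorem momentum_momentumField_mul_wave (hι : ι * ι = -1) (hψ : ContDiff ℝ 2 ψ)
    (hb : Differentiable ℝ b) (hbx : DifferentiableAt ℝ (fderiv ℝ b) x)
    (hA : DifferentiableAt ℝ A x) :
    ∑ k, (ι * grad (fun y => momentumField ι A (fun y => b y * wave ι r η ψ y) y k) x k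
        + toC (A x) k * momentumField ι A (fun y => b y * wave ι r η ψ y) x k)
      = (-Laplacian.laplacian b x + ι * (Laplacian.laplacian ψ x + divergence A x) * b x
          + 2 * ι * (waveVector r η ψ A x ⬝ᵥ grad b x)
          + (waveVector r η ψ A x ⬝ᵥ waveVector r η ψ A x) * b x) * wave ι r η ψ x := by
  have hψ1 : Differentiable ℝ ψ := hψ.differentiable two_ne_zero
  have hψ2 : DifferentiableAt ℝ (fderiv ℝ ψ) x :=
    (hψ.fderiv_right (m := 1) (by norm_num)).differentiable one_ne_zero x
  have hw : DifferentiableAt ℝ (wave ι r η ψ) x :=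
    ((differentiableAt_exponent (hψ1 x)).const_mul (-ι)).cexp
  have key : ∀ k, ι * grad (fun y => momentumField ι A (fun y => b y * wave ι r η ψ y) y k) x k
        + toC (A x) k * momentumField ι A (fun y => b y * wave ι r η ψ y) x k
      = (-fderiv ℝ (fderiv ℝ b) x (EuclideanSpace.single k 1) (EuclideanSpace.single k 1)
        + ι * (fderiv ℝ (fderiv ℝ ψ) x (EuclideanSpace.single k 1) (EuclideanSpace.single k 1)
          + ((fderiv ℝ A x (EuclideanSpace.single k 1) k : ℝ) : ℂ)) * b x
        + 2 * ι * (waveVector r η ψ A x k * grad b x k)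
        + waveVector r η ψ A x k * waveVector r η ψ A x k * b x) * wave ι r η ψ x := by
    intro k
    obtain ⟨hB, hBg⟩ := grad_waveVector (r := r) (η := η) hψ2 hA k
    have hg := (hasFDerivAt_grad hbx k).differentiableAt
    have h1 : DifferentiableAt ℝ (fun y => ι * grad b y k) x := hg.const_mul ι
    have h2 : DifferentiableAt ℝ (fun y => b y * waveVector r η ψ A y k) x := (hb x).mul hB
    have h3 : DifferentiableAt ℝ (fun y => ι * grad b y k + b y * waveVector r η ψ A y k) x :=
      h1.add h2
    -- Written this way, the phase gradient inside A cancels the term produced when the outer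
    -- derivative hits the wave.
    have hA' : toC (A x) k = waveVector r η ψ A x k - (r * toC η k + grad ψ x k) := by
      simp [waveVector]
    simp only [momentumField_mul_wave hι (hψ1 _) (hb _)]
    rw [grad_mul h3 hw, grad_add h1 h2, grad_const_mul hg, grad_mul (hb x) hB, grad_grad hbx, hBg,
      grad_wave (hψ1 x), hA']
    linear_combination (fderiv ℝ (fderiv ℝ b) x (EuclideanSpace.single k 1)
      (EuclideanSpace.single k 1) - (ι * grad b x k + b x * waveVector r η ψ A x k)
        * (r * toC η k + grad ψ x k)) * wave ι r η ψ x * hι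
  rw [Finset.sum_congr rfl fun k _ => key k, ← Finset.sum_mul, laplacian_eq_sum, laplacian_eq_sum]
  simp only [Finset.sum_add_distrib, Finset.sum_neg_distrib, ← Finset.mul_sum, ← Finset.sum_mul,
    divergence, dotProduct, Complex.ofReal_sum]

theorem locallyLipschitz_toC (hA : LocallyLipschitz A) (k : Fin n) :
    LocallyLipschitz fun y => toC (A y) k := by
  have := (coordC k).lipschitz.locallyLipschitz.comp hA
  simpa only [Function.comp_def, coordC_apply] using this

theorem locallyLipschitz_grad {f : Euc n → ℂ} (hf : LocallyLipschitz (fderiv ℝ f)) (k : Fin n) :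
    LocallyLipschitz fun y => grad f y k :=
  (ContinuousLinearMap.apply ℝ ℂ (EuclideanSpace.single k (1 : ℝ))).lipschitz.locallyLipschitz.comp
    hf

theorem locallyLipschitz_momentumField {Φ : Euc n → ℂ} (hΦ : LocallyLipschitz Φ)
    (hg : ∀ k, LocallyLipschitz fun y => grad Φ y k) (hA : LocallyLipschitz A) (k : Fin n) :
    LocallyLipschitz fun y => momentumField ι A Φ y k :=
  (locallyLipschitz_mul (LocallyLipschitz.const ι) (hg k)).add
    (locallyLipschitz_mul hΦ (locallyLipschitz_toC hA k))

theorem locallyLipschitz_grad_mul_wave (hψ : ContDiff ℝ 2 ψ) (hb : ContDiff ℝ 1 b)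
    (hb' : LocallyLipschitz (fderiv ℝ b)) (k : Fin n) :
    LocallyLipschitz fun y => grad (fun y => b y * wave ι r η ψ y) y k := by
  have hw : ContDiff ℝ 2 (wave ι r η ψ) := contDiff_wave hψ
  have hw1 : ContDiff ℝ 1 (fderiv ℝ (wave ι r η ψ)) := hw.fderiv_right (by norm_num)
  have e : (fun y => grad (fun y => b y * wave ι r η ψ y) y k)
      = fun y => grad b y k * wave ι r η ψ y + b y * grad (wave ι r η ψ) y k := by
    funext y
    exact grad_mul (hb.differentiable one_ne_zero y) (hw.differentiable two_ne_zero y) k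
  rw [e]
  exact (locallyLipschitz_mul (locallyLipschitz_grad hb' k)
      (hw.of_le one_le_two).locallyLipschitz).add
    (locallyLipschitz_mul hb.locallyLipschitz (locallyLipschitz_grad hw1.locallyLipschitz k))

end Wave

/-! ### Weak solutions and Green's formula -/

section Green

variable {n : ℕ} {Ω : Opens (Euc n)} {A : Euc n → Euc n} {V : Euc n → ℝ}

theorem boundedCoefficients (hΩ : Bornology.IsBounded (Ω : Set (Euc n))) (hA : LocallyLipschitz A)
    (hV : MemLp V (⊤ : ℝ≥0∞) (volume.restrict (Ω : Set (Euc n)))) : BoundedCoefficients Ω A V where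
  field k := memLp_of_continuous hΩ (locallyLipschitz_toC hA k).continuous
  potential := hV.ofReal

theorem weakPartial_toL2 (hΩ : Bornology.IsBounded (Ω : Set (Euc n))) {f : Euc n → ℂ}
    (hf : LocallyLipschitz f) (k : Fin n) :
    weakPartial k (toL2 Ω f) =ᵐ[volume.restrict (Ω : Set (Euc n))] fun x => grad f x k := by
  rw [(hasWeakPartial_toL2 hΩ hf k).weakPartial_eq]
  exact coeFn_toL2 (memLp_grad hΩ hf k)

theorem memH1_toL2 (hΩ : Bornology.IsBounded (Ω : Set (Euc n))) {f : Euc n → ℂ}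
    (hf : LocallyLipschitz f) : MemH1 (toL2 Ω f) := fun k => ⟨_, hasWeakPartial_toL2 hΩ hf k⟩

theorem weakPartial_sub {u v : L2 Ω} (hu : MemH1 u) (hv : MemH1 v) (k : Fin n) :
    weakPartial k (u - v) = weakPartial k u - weakPartial k v :=
  congrArg (fun q : Jet Ω => q (some k)) (jet_sub hu hv)

theorem integrable_L2_mul_mul (u : L2 Ω) {f g : Euc n → ℂ}
    (hf : MemLp f (⊤ : ℝ≥0∞) (volume.restrict (Ω : Set (Euc n))))
    (hg : MemLp g 2 (volume.restrict (Ω : Set (Euc n)))) :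
    Integrable (fun x => u x * (f x * g x)) (volume.restrict (Ω : Set (Euc n))) :=
  integrable_L2_mul u (hg.mul' hf)

/-- A function with locally Lipschitz gradient solves the magnetic Schrödinger equation weakly as
soon as it does so almost everywhere. -/
theorem solvesMagnetic_toL2 (hΩ : Bornology.IsBounded (Ω : Set (Euc n))) (hA : LocallyLipschitz A)
    (hV : MemLp V (⊤ : ℝ≥0∞) (volume.restrict (Ω : Set (Euc n)))) {Φ G : Euc n → ℂ}
    (hΦ : LocallyLipschitz Φ) (hΦ' : ∀ k, LocallyLipschitz fun y => grad Φ y k)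
    (hG : MemLp G 2 (volume.restrict (Ω : Set (Euc n))))
    (h : ∀ᵐ x ∂(volume.restrict (Ω : Set (Euc n))),
      ∑ k, (-Complex.I * grad (fun y => momentumField (-Complex.I) A Φ y k) x k
        + toC (A x) k * momentumField (-Complex.I) A Φ x k) + V x * Φ x = G x) :
    SolvesMagnetic A V (toL2 Ω Φ) (toL2 Ω G) := by
  refine ⟨memH1_toL2 hΩ hΦ, fun φ => ?_⟩
  set μ := volume.restrict (Ω : Set (Euc n))
  set Z := momentumField (-Complex.I) A Φ with hZ
  have hZl : ∀ k, LocallyLipschitz fun y => Z y k := locallyLipschitz_momentumField hΦ hΦ' hA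
  have hφ : MemLp φ 2 μ := testFunction_memLp φ
  have hφ' : ∀ k, MemLp (fun x => grad φ x k) 2 μ := fun k =>
    testFunction_memLp_grad φ k
  have hAm : ∀ k, MemLp (fun x => toC (A x) k) ⊤ μ := (boundedCoefficients hΩ hA hV).field
  have hZm : ∀ k, MemLp (fun x => Z x k) 2 μ := fun k => memLp_of_continuous hΩ (hZl k).continuous
  have hZgm : ∀ k, MemLp (fun x => grad (fun y => Z y k) x k) 2 μ := fun k =>
    memLp_grad hΩ (hZl k) k
  have hΦm : MemLp Φ 2 μ := memLp_of_continuous hΩ hΦ.continuous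
  have hAZ : ∀ k, MemLp (fun x => toC (A x) k * Z x k) 2 μ := fun k => (hZm k).mul' (hAm k)
  have hVΦ : MemLp (fun x => (V x : ℂ) * Φ x) 2 μ := hΦm.mul' hV.ofReal
  have i1 : ∀ k, Integrable (fun x => Z x k * grad φ x k) μ := fun k =>
    (hZm k).integrable_mul (hφ' k)
  have i2 : ∀ k, Integrable (fun x => toC (A x) k * Z x k * φ x) μ := fun k =>
    (hAZ k).integrable_mul hφ
  have i3 : ∀ k, Integrable (fun x => grad (fun y => Z y k) x k * φ x) μ := fun k =>
    (hZgm k).integrable_mul hφ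
  have i4 : Integrable (fun x => (V x : ℂ) * Φ x * φ x) μ :=
    hVΦ.integrable_mul hφ
  -- The derivative is moved from the test function onto the locally Lipschitz field Z.
  have e1 : ∀ k, ∫ x, (-Complex.I * weakPartial k (toL2 Ω Φ) x + toC (A x) k * toL2 Ω Φ x) *
      (Complex.I * grad φ x k + toC (A x) k * φ x) ∂μ
      = ∫ x, (-Complex.I * grad (fun y => Z y k) x k + toC (A x) k * Z x k) * φ x ∂μ := by
    intro k
    have s1 : ∫ x, (-Complex.I * weakPartial k (toL2 Ω Φ) x + toC (A x) k * toL2 Ω Φ x) *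
        (Complex.I * grad φ x k + toC (A x) k * φ x) ∂μ
        = ∫ x, (Complex.I * (Z x k * grad φ x k) + toC (A x) k * Z x k * φ x) ∂μ := by
      refine integral_congr_ae ?_
      filter_upwards [weakPartial_toL2 hΩ hΦ k, coeFn_toL2 hΦm] with x h1 h2
      rw [h1, h2, hZ]
      simp only [momentumField, Pi.add_apply, Pi.smul_apply, smul_eq_mul]
      ring
    have s2 : ∫ x, (-Complex.I * grad (fun y => Z y k) x k + toC (A x) k * Z x k) * φ x ∂μ
        = ∫ x, (-Complex.I * (grad (fun y => Z y k) x k * φ x) + toC (A x) k * Z x k * φ x) ∂μ := by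
      congr 1; ext x; ring
    rw [s1, s2, integral_add ((i1 k).const_mul _) (i2 k), integral_add ((i3 k).const_mul _) (i2 k),
      integral_const_mul, integral_const_mul, setIntegral_fderiv_mul_testFunction (hZl k)]
    ring
  have i5 : ∀ k, Integrable (fun x =>
      (-Complex.I * grad (fun y => Z y k) x k + toC (A x) k * Z x k) * φ x) μ := fun k => by
    have := ((i3 k).const_mul (-Complex.I)).add (i2 k)
    refine this.congr (ae_of_all _ fun x => ?_)
    simp only [Pi.add_apply]
    ring
  have e2 : ∫ x, (V x : ℂ) * toL2 Ω Φ x * φ x ∂μ = ∫ x, (V x : ℂ) * Φ x * φ x ∂μ := by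
    refine integral_congr_ae ?_
    filter_upwards [coeFn_toL2 hΦm] with x h2
    rw [h2]
  rw [e2, Finset.sum_congr rfl fun k _ => e1 k, ← integral_finsetSum _ fun k _ => i5 k,
    ← integral_add (integrable_finsetSum _ fun k _ => i5 k) i4]
  refine integral_congr_ae ?_
  filter_upwards [h, coeFn_toL2 hG] with x h1 h2
  rw [h2, ← h1, add_mul, Finset.sum_mul]

/-- True for test functions and closed under limits in H¹₀; this is why v leaves no boundary term.
-/
theorem integral_weakPartial_mul_of_memH10 (hΩ : Bornology.IsBounded (Ω : Set (Euc n))) {v : L2 Ω}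
    (hv : MemH10 v) {f : Euc n → ℂ} (hf : LocallyLipschitz f) (k : Fin n) :
    ∫ x in (Ω : Set (Euc n)), weakPartial k v x * f x
      = -∫ x in (Ω : Set (Euc n)), v x * grad f x k := by
  have hfm := memLp_of_continuous (p := 2) hΩ hf.continuous
  have hfm' := memLp_grad (p := 2) hΩ hf k
  refine H10_induction (p := fun q => ∫ x in (Ω : Set (Euc n)), q (some k) x * f x
    = -∫ x in (Ω : Set (Euc n)), q none x * grad f x k) ?_ (fun φ => ?_) (memH10_iff.1 hv)
  · simp only [integral_L2_mul_eq_inner _ hfm, integral_L2_mul_eq_inner _ hfm']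
    exact isClosed_eq (by fun_prop) (by fun_prop)
  · have e1 : ∫ x in (Ω : Set (Euc n)), testJet φ (some k) x * f x
        = ∫ x in (Ω : Set (Euc n)), f x * grad φ x k := by
      refine integral_congr_ae ?_
      filter_upwards [coeFn_toL2 (testFunction_memLp_grad φ k)] with x hx
      rw [testJet_some, hx, mul_comm]
    have e2 : ∫ x in (Ω : Set (Euc n)), testJet φ none x * grad f x k
        = ∫ x in (Ω : Set (Euc n)), grad f x k * φ x := by
      refine integral_congr_ae ?_
      filter_upwards [coeFn_toL2 (testFunction_memLp φ)] with x hx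
      rw [testJet_none, hx, mul_comm]
    rw [e1, e2, setIntegral_fderiv_mul_testFunction hf]

/-- Integration by parts against a locally Lipschitz function. -/
theorem integral_weakPartial_mul (hΩ : IsAdmissibleDomain Ω) {v : L2 Ω} (hv : MemH10 v)
    {Φ f : Euc n → ℂ} (hΦ : LocallyLipschitz Φ) (hf : LocallyLipschitz f) (k : Fin n) :
    ∫ x in (Ω : Set (Euc n)), weakPartial k (toL2 Ω Φ - v) x * f x
      = ∫ x, Φ x * f x * toC (outwardNormal (Ω : Set (Euc n)) x) k
          ∂(surfaceMeasure (Ω : Set (Euc n)))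
        - ∫ x in (Ω : Set (Euc n)), (toL2 Ω Φ - v) x * grad f x k := by
  have hΩb := hΩ.bounded
  have hfm := memLp_of_continuous (p := 2) hΩb hf.continuous
  have hfm' := memLp_grad (p := 2) hΩb hf k
  have hΦm := memLp_of_continuous (p := 2) hΩb hΦ.continuous
  have hΦm' := memLp_grad (p := 2) hΩb hΦ k
  -- The boundary integral comes from the product Φ f alone; the part with v is integrated by parts
  -- separately.
  have d := (divergenceFormula hΩ (EuclideanSpace.single k 1) (locallyLipschitz_mul hΦ hf)).2
  have hdΦ := locallyLipschitz_ae_differentiableAt (volume : Measure (Euc n)) hΦ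
  have hdf := locallyLipschitz_ae_differentiableAt (volume : Measure (Euc n)) hf
  have d1 : ∫ x in (Ω : Set (Euc n)), fderiv ℝ (fun y => Φ y * f y) x (EuclideanSpace.single k 1)
      = (∫ x in (Ω : Set (Euc n)), toL2 Ω Φ x * grad f x k)
        + ∫ x in (Ω : Set (Euc n)), weakPartial k (toL2 Ω Φ) x * f x := by
    rw [← integral_add (integrable_L2_mul _ hfm') (integrable_L2_mul _ hfm)]
    refine integral_congr_ae ?_
    filter_upwards [ae_restrict_of_ae hdΦ, ae_restrict_of_ae hdf, coeFn_toL2 hΦm,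
      weakPartial_toL2 hΩb hΦ k] with x h1 h2 h3 h4
    rw [h3, h4, add_comm]
    exact grad_mul h1 h2 k
  have d2 : ∫ x in (Ω : Set (Euc n)), weakPartial k (toL2 Ω Φ - v) x * f x
      = (∫ x in (Ω : Set (Euc n)), weakPartial k (toL2 Ω Φ) x * f x)
        - ∫ x in (Ω : Set (Euc n)), weakPartial k v x * f x := by
    rw [weakPartial_sub (memH1_toL2 hΩb hΦ) hv.1,
      ← integral_sub (integrable_L2_mul _ hfm) (integrable_L2_mul _ hfm)]
    refine integral_congr_ae ?_
    filter_upwards [Lp.coeFn_sub (weakPartial k (toL2 Ω Φ)) (weakPartial k v)] with x h1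
    rw [h1, Pi.sub_apply, sub_mul]
  have d3 : ∫ x in (Ω : Set (Euc n)), (toL2 Ω Φ - v) x * grad f x k
      = (∫ x in (Ω : Set (Euc n)), toL2 Ω Φ x * grad f x k)
        - ∫ x in (Ω : Set (Euc n)), v x * grad f x k := by
    rw [← integral_sub (integrable_L2_mul _ hfm') (integrable_L2_mul _ hfm')]
    refine integral_congr_ae ?_
    filter_upwards [Lp.coeFn_sub (toL2 Ω Φ) v] with x h1
    rw [h1, Pi.sub_apply, sub_mul]
  have d4 : ∀ x, ((inner ℝ (outwardNormal (Ω : Set (Euc n)) x) (EuclideanSpace.single k 1) : ℝ) : ℂ)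
      = toC (outwardNormal (Ω : Set (Euc n)) x) k := fun x => by
    simp [toC, EuclideanSpace.inner_single_right]
  simp only [d4] at d
  rw [d2, d3, integral_weakPartial_mul_of_memH10 hΩb hv hf, ← d, d1]
  ring

theorem integrable_surfaceMeasure (hΩ : IsAdmissibleDomain Ω) {f : Euc n → ℂ}
    (hf : LocallyLipschitz f) (k : Fin n) :
    Integrable (fun x => f x * toC (outwardNormal (Ω : Set (Euc n)) x) k)
      (surfaceMeasure (Ω : Set (Euc n))) := by
  refine (divergenceFormula hΩ (EuclideanSpace.single k 1) hf).1.congr (ae_of_all _ fun x => ?_)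
  simp [toC, EuclideanSpace.inner_single_right]

theorem covariantGrad_ae (hA : BoundedCoefficients Ω A V) (u : L2 Ω) (k : Fin n) :
    covariantGrad A u k =ᵐ[volume.restrict (Ω : Set (Euc n))]
      fun x => weakPartial k u x + Complex.I * toC (A x) k * u x := by
  have h1 : MemLp (fun x => Complex.I * toC (A x) k * u x) 2
      (volume.restrict (Ω : Set (Euc n))) := (Lp.memLp u).mul' ((hA.field k).const_mul Complex.I)
  have h2 : MemLp (fun x => weakPartial k u x + Complex.I * toC (A x) k * u x) 2
      (volume.restrict (Ω : Set (Euc n))) := (Lp.memLp (weakPartial k u)).add h1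
  exact coeFn_toL2 h2

/-- With X = (∇ + iA)u one has (−i∇ + A)²u = −div X − iA·X, so the equation itself exhibits the
divergence of X as an L² function. -/
theorem weakDiv_covariantGrad (hA : BoundedCoefficients Ω A V) {lam : ℂ} {u : L2 Ω}
    (hu : SolvesMagnetic A V u (lam • u)) :
    weakDiv (covariantGrad A u) =ᵐ[volume.restrict (Ω : Set (Euc n))]
      fun x => (V x - lam) * u x - ∑ k, Complex.I * (toC (A x) k * covariantGrad A u k x) := by
  set μ := volume.restrict (Ω : Set (Euc n))
  have m1 : ∀ k, MemLp (fun x => toC (A x) k * covariantGrad A u k x) 2 μ := fun k =>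
    (Lp.memLp _).mul' (hA.field k)
  have m2 : MemLp (fun x => (V x : ℂ) * u x) 2 μ := (Lp.memLp _).mul' hA.potential
  have m3 : MemLp (fun x => lam * u x) 2 μ := (Lp.memLp u).const_mul lam
  have m4 : MemLp (fun x => (V x - lam) * u x
      - ∑ k, Complex.I * (toC (A x) k * covariantGrad A u k x)) 2 μ := by
    have := (m2.sub m3).sub (memLp_finsetSum Finset.univ fun k _ => (m1 k).const_mul Complex.I)
    refine this.ae_eq (ae_of_all _ fun x => ?_)
    simp only [Pi.sub_apply]
    ring
  suffices HasWeakDiv (covariantGrad A u) (toL2 Ω fun x => (V x - lam) * u x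
      - ∑ k, Complex.I * (toC (A x) k * covariantGrad A u k x)) by
    rw [this.weakDiv_eq]
    exact coeFn_toL2 m4
  intro φ
  have hφ : MemLp φ 2 μ := testFunction_memLp φ
  have hφ' : ∀ k, MemLp (fun x => grad φ x k) 2 μ := fun k =>
    testFunction_memLp_grad φ k
  have i1 : ∀ k, Integrable (fun x => covariantGrad A u k x * grad φ x k) μ := fun k =>
    integrable_L2_mul _ (hφ' k)
  have i2 : ∀ k, Integrable (fun x => toC (A x) k * covariantGrad A u k x * φ x) μ := fun k =>
    (m1 k).integrable_mul hφ
  have i3 : Integrable (fun x => (V x : ℂ) * u x * φ x) μ := m2.integrable_mul hφ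
  have i4 : Integrable (fun x => lam * u x * φ x) μ := m3.integrable_mul hφ
  have i34 : Integrable (fun x => (V x : ℂ) * u x * φ x - lam * u x * φ x) μ := i3.sub i4
  have h := hu.2 φ
  have e1 : ∀ k, ∫ x, (-Complex.I * weakPartial k u x + toC (A x) k * u x) *
      (Complex.I * grad φ x k + toC (A x) k * φ x) ∂μ
      = (∫ x, covariantGrad A u k x * grad φ x k ∂μ)
        - Complex.I * ∫ x, toC (A x) k * covariantGrad A u k x * φ x ∂μ := by
    intro k
    rw [← integral_const_mul, ← integral_sub (i1 k) ((i2 k).const_mul _)]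
    refine integral_congr_ae ?_
    filter_upwards [covariantGrad_ae hA u k] with x hx
    rw [hx]
    linear_combination (-weakPartial k u x * grad φ x k
      + toC (A x) k * u x * toC (A x) k * φ x) * Complex.I_mul_I
  have e2 : ∫ x, (lam • u) x * φ x ∂μ = ∫ x, lam * u x * φ x ∂μ := by
    refine integral_congr_ae ?_
    filter_upwards [Lp.coeFn_smul lam u] with x hx
    rw [hx]
    rfl
  have e3 : ∫ x, toL2 Ω (fun x => (V x - lam) * u x
      - ∑ k, Complex.I * (toC (A x) k * covariantGrad A u k x)) x * φ x ∂μ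
      = ((∫ x, (V x : ℂ) * u x * φ x ∂μ) - ∫ x, lam * u x * φ x ∂μ)
        - ∑ k, Complex.I * ∫ x, toC (A x) k * covariantGrad A u k x * φ x ∂μ := by
    simp only [← integral_const_mul]
    rw [← integral_finsetSum _ fun k _ => (i2 k).const_mul _, ← integral_sub i3 i4,
      ← integral_sub i34 (integrable_finsetSum _ fun k _ => (i2 k).const_mul _)]
    refine integral_congr_ae ?_
    filter_upwards [coeFn_toL2 m4] with x hx
    rw [hx]
    simp only [sub_mul, Finset.sum_mul, mul_assoc]
  rw [Finset.sum_congr rfl fun k _ => e1 k, Finset.sum_sub_distrib, e2] at h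
  rw [e3]
  linear_combination h

/-- The pairing of the magnetic normal derivative of a solution with a function having a locally
Lipschitz gradient. -/
theorem normalTracePairing_covariantGrad (hΩ : IsAdmissibleDomain Ω) (hA : LocallyLipschitz A)
    (hV : MemLp V (⊤ : ℝ≥0∞) (volume.restrict (Ω : Set (Euc n)))) {lam : ℂ} {v : L2 Ω}
    (hv : MemH10 v) {Φ₁ Φ₂ G : Euc n → ℂ} (hΦ₁ : LocallyLipschitz Φ₁) (hΦ₂ : LocallyLipschitz Φ₂)
    (hΦ₂' : ∀ k, LocallyLipschitz fun y => grad Φ₂ y k)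
    (hu : SolvesMagnetic A V (toL2 Ω Φ₁ - v) (lam • (toL2 Ω Φ₁ - v)))
    (h : ∀ᵐ x ∂(volume.restrict (Ω : Set (Euc n))),
      ∑ k, (Complex.I * grad (fun y => momentumField Complex.I A Φ₂ y k) x k
        + toC (A x) k * momentumField Complex.I A Φ₂ x k) + (V x - lam) * Φ₂ x = G x) :
    normalTracePairing (covariantGrad A (toL2 Ω Φ₁ - v)) (toL2 Ω fun x => conj (Φ₂ x))
      = (∫ x in (Ω : Set (Euc n)), (toL2 Ω Φ₁ - v) x * G x)
        - Complex.I * ∫ x, Φ₁ x * (momentumField Complex.I A Φ₂ x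
            ⬝ᵥ toC (outwardNormal (Ω : Set (Euc n)) x)) ∂(surfaceMeasure (Ω : Set (Euc n))) := by
  have hΩb := hΩ.bounded
  have hb := boundedCoefficients hΩb hA hV
  set μ := volume.restrict (Ω : Set (Euc n))
  set u := toL2 Ω Φ₁ - v with hudef
  set Z := momentumField Complex.I A Φ₂ with hZ
  have hZl : ∀ k, LocallyLipschitz fun y => Z y k := locallyLipschitz_momentumField hΦ₂ hΦ₂' hA
  have hZm : ∀ k, MemLp (fun x => Z x k) 2 μ := fun k => memLp_of_continuous hΩb (hZl k).continuous
  have hZgm : ∀ k, MemLp (fun x => grad (fun y => Z y k) x k) 2 μ := fun k =>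
    memLp_grad hΩb (hZl k) k
  have hΦm : MemLp Φ₂ 2 μ := memLp_of_continuous hΩb hΦ₂.continuous
  have hΦm' : ∀ k, MemLp (fun x => grad Φ₂ x k) 2 μ := fun k => memLp_grad hΩb hΦ₂ k
  have hcl : LocallyLipschitz fun x => conj (Φ₂ x) :=
    Complex.conjCLE.lipschitz.locallyLipschitz.comp hΦ₂
  have hcm : MemLp (fun x => conj (Φ₂ x)) 2 μ := memLp_of_continuous hΩb hcl.continuous
  have i1 : ∀ k, Integrable (fun x => covariantGrad A u k x * grad Φ₂ x k) μ := fun k =>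
    integrable_L2_mul _ (hΦm' k)
  have i2 : Integrable (fun x => weakDiv (covariantGrad A u) x * Φ₂ x) μ := integrable_L2_mul _ hΦm
  have i3 : ∀ k, Integrable (fun x => weakPartial k u x * Z x k) μ := fun k =>
    integrable_L2_mul _ (hZm k)
  have i4 : ∀ k, Integrable (fun x => u x * grad (fun y => Z y k) x k) μ := fun k =>
    integrable_L2_mul _ (hZgm k)
  have i5 : ∀ k, Integrable (fun x => u x * (toC (A x) k * Z x k)) μ := fun k =>
    integrable_L2_mul_mul _ (hb.field k) (hZm k)
  have i6 : Integrable (fun x => u x * ((V x - lam) * Φ₂ x)) μ := by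
    have := (integrable_L2_mul_mul u hb.potential hΦm).sub
      ((integrable_L2_mul u (hΦm.const_mul lam)))
    refine this.congr (ae_of_all _ fun x => ?_)
    simp only [Pi.sub_apply]
    ring
  have i7 : Integrable (fun x => (∑ k, u x * (toC (A x) k * Z x k)) + u x * ((V x - lam) * Φ₂ x)) μ :=
    (integrable_finsetSum _ fun k _ => i5 k).add i6
  have e1 : normalTracePairing (covariantGrad A u) (toL2 Ω fun x => conj (Φ₂ x))
      = (∑ k, ∫ x, covariantGrad A u k x * grad Φ₂ x k ∂μ)
        + ∫ x, weakDiv (covariantGrad A u) x * Φ₂ x ∂μ := by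
    rw [normalTracePairing]
    congr 1
    · refine Finset.sum_congr rfl fun k _ => integral_congr_ae ?_
      filter_upwards [weakPartial_toL2 hΩb hcl k] with x hx
      rw [hx, grad_conj, Complex.conj_conj]
    · refine integral_congr_ae ?_
      filter_upwards [coeFn_toL2 hcm] with x hx
      rw [hx, Complex.conj_conj]
  -- As Z = i(∇ − iA)Φ₂, the integrand X·∇Φ₂ + (div X)Φ₂ becomes −i∇u·Z + u A·Z + (V − λ)u Φ₂.
  have e2 : normalTracePairing (covariantGrad A u) (toL2 Ω fun x => conj (Φ₂ x))
      = (∑ k, -Complex.I * ∫ x, weakPartial k u x * Z x k ∂μ)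
        + ∫ x, ((∑ k, u x * (toC (A x) k * Z x k)) + u x * ((V x - lam) * Φ₂ x)) ∂μ := by
    rw [e1, ← integral_finsetSum _ fun k _ => i1 k,
      ← integral_add (integrable_finsetSum _ fun k _ => i1 k) i2]
    simp only [← integral_const_mul]
    rw [← integral_finsetSum _ fun k _ => (i3 k).const_mul _,
      ← integral_add (integrable_finsetSum _ fun k _ => (i3 k).const_mul _) i7]
    refine integral_congr_ae ?_
    filter_upwards [weakDiv_covariantGrad hb hu,
      ae_all_iff.2 fun k => covariantGrad_ae hb u k] with x h1 h2
    rw [h1, sub_mul, Finset.sum_mul, ← add_assoc, ← Finset.sum_add_distrib, add_sub,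
      add_sub_right_comm, ← Finset.sum_sub_distrib]
    congr 1
    · refine Finset.sum_congr rfl fun k _ => ?_
      rw [h2 k, hZ]
      simp only [momentumField, Pi.add_apply, Pi.smul_apply, smul_eq_mul]
      linear_combination (weakPartial k u x * grad Φ₂ x k
        - toC (A x) k * u x * toC (A x) k * Φ₂ x) * Complex.I_mul_I
    · ring
  -- The second integration by parts moves the gradient off u; on the boundary u is replaced by its
  -- datum Φ₁.
  have e3 : ∀ k, ∫ x, weakPartial k u x * Z x k ∂μ = _ := fun k =>
    integral_weakPartial_mul hΩ hv hΦ₁ (hZl k) k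
  have e4 : ∫ x, Φ₁ x * (Z x ⬝ᵥ toC (outwardNormal (Ω : Set (Euc n)) x))
      ∂(surfaceMeasure (Ω : Set (Euc n)))
      = ∑ k, ∫ x, Φ₁ x * Z x k * toC (outwardNormal (Ω : Set (Euc n)) x) k
        ∂(surfaceMeasure (Ω : Set (Euc n))) := by
    rw [← integral_finsetSum _ fun k _ =>
      integrable_surfaceMeasure hΩ (locallyLipschitz_mul hΦ₁ (hZl k)) k]
    simp only [dotProduct, Finset.mul_sum, mul_assoc]
  have e5 : ∫ x, u x * G x ∂μ = (∑ k, Complex.I * ∫ x, u x * grad (fun y => Z y k) x k ∂μ)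
      + ∫ x, ((∑ k, u x * (toC (A x) k * Z x k)) + u x * ((V x - lam) * Φ₂ x)) ∂μ := by
    simp only [← integral_const_mul]
    rw [← integral_finsetSum _ fun k _ => (i4 k).const_mul _,
      ← integral_add (integrable_finsetSum _ fun k _ => (i4 k).const_mul _) i7]
    refine integral_congr_ae ?_
    filter_upwards [h] with x hx
    rw [← hx, mul_add, Finset.mul_sum, ← add_assoc, ← Finset.sum_add_distrib]
    congr 1
    refine Finset.sum_congr rfl fun k _ => ?_
    ring
  rw [e2, e5, e4, Finset.sum_congr rfl fun k _ => congrArg (-Complex.I * ·) (e3 k), Finset.mul_sum,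
    add_sub_right_comm, ← Finset.sum_sub_distrib]
  congr 1
  refine Finset.sum_congr rfl fun k _ => ?_
  ring

end Green

/-! ### The ansatz functions -/

section Ansatz

variable {n : ℕ} {r : ℂ} {η : Euc n} {ψ b : Euc n → ℂ} {A As : Euc n → Euc n} {V : Euc n → ℝ}
  {x : Euc n}

theorem ansatz₁_eq (r : ℂ) (η : Euc n) (ψ : Euc n → ℂ) :
    ansatz₁ r η ψ = fun y => (fun _ => 1 : Euc n → ℂ) y * wave (-Complex.I) r η ψ y := by
  funext y
  rw [ansatz₁, wave, ← Complex.exp_add, one_mul]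
  congr 1
  ring

theorem expFactor₂_eq (r : ℂ) (η : Euc n) (ψ : Euc n → ℂ) (x : Euc n) :
    expFactor₂ r η ψ x = wave Complex.I r η ψ x := by
  rw [expFactor₂, wave, ← Complex.exp_add]
  congr 1
  ring

theorem ansatz₂_eq (r : ℂ) (η : Euc n) (b ψ : Euc n → ℂ) :
    ansatz₂ r η b ψ = fun y => b y * wave Complex.I r η ψ y := by
  funext y
  rw [← expFactor₂_eq, ansatz₂, expFactor₂]
  ring

theorem ansatz₁_mul_expFactor₂ (r : ℂ) (η₁ η₂ : Euc n) (ψ₁ ψ₂ : Euc n → ℂ) (x : Euc n) :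
    ansatz₁ r η₁ ψ₁ x * expFactor₂ r η₂ ψ₂ x = expFactor₁₂ r η₁ η₂ ψ₁ ψ₂ x := by
  rw [ansatz₁, expFactor₂, expFactor₁₂, ← Complex.exp_add, ← Complex.exp_add, ← Complex.exp_add,
    ← Complex.exp_add]
  congr 1
  simp only [rdot, inner_sub_left, Complex.ofReal_sub]
  ring

theorem rdot_sub (η v w : Euc n) : rdot η (v - w) = rdot η v - rdot η w := by
  simp [rdot, inner_sub_right]

/-- The cross term 2r η·(A + ∇ψ) becomes 2r η·(A − A_♯) by the transport equation, and η·η = 1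
leaves r². -/
theorem waveVector_dotProduct_self (hη : ‖η‖ = 1) (hψ : toC η ⬝ᵥ grad ψ x = -rdot η (As x)) :
    waveVector r η ψ A x ⬝ᵥ waveVector r η ψ A x
      = r ^ 2 + 2 * r * rdot η (A x - As x) + grad ψ x ⬝ᵥ grad ψ x
        + 2 * (toC (A x) ⬝ᵥ grad ψ x) + (‖A x‖ : ℂ) ^ 2 := by
  have h1 : toC η ⬝ᵥ toC η = 1 := by
    rw [toC_dotProduct_toC, rdot_self, hη]
    simp
  have h2 : toC (A x) ⬝ᵥ toC (A x) = (‖A x‖ : ℂ) ^ 2 := by rw [toC_dotProduct_toC, rdot_self]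
  simp only [waveVector, add_dotProduct, dotProduct_add, smul_dotProduct, dotProduct_smul,
    smul_eq_mul, rdot_sub, h1, h2, hψ, dotProduct_comm (grad ψ x) (toC η),
    dotProduct_comm (grad ψ x) (toC (A x)), dotProduct_comm (toC (A x)) (toC η),
    toC_dotProduct_toC]
  ring

theorem laplacian_const (c : ℂ) (x : Euc n) : Laplacian.laplacian (fun _ : Euc n => c) x = 0 := by
  simp [laplacian_eq_sum]

theorem momentum_ansatz₁ (hη : ‖η‖ = 1) (hψ : ContDiff ℝ 2 ψ)
    (hψη : toC η ⬝ᵥ grad ψ x = -rdot η (As x)) (hA : DifferentiableAt ℝ A x) :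
    ∑ k, (-Complex.I * grad (fun y => momentumField (-Complex.I) A (ansatz₁ r η ψ) y k) x k
        + toC (A x) k * momentumField (-Complex.I) A (ansatz₁ r η ψ) x k)
        + V x * ansatz₁ r η ψ x
      = (2 * r * rdot η (A x - As x) + q₁ A V ψ x) * ansatz₁ r η ψ x
        + r ^ 2 * ansatz₁ r η ψ x := by
  have hI : -Complex.I * -Complex.I = -1 := by simp
  have hd : fderiv ℝ (fun _ : Euc n => (1 : ℂ)) = fun _ => 0 := by ext; simp
  have hg : grad (fun _ : Euc n => (1 : ℂ)) x = 0 := by ext k; simp [grad_const]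
  rw [ansatz₁_eq, momentum_momentumField_mul_wave hI hψ (differentiable_const 1)
    (by rw [hd]; exact differentiableAt_const _) hA, laplacian_const, hg, dotProduct_zero,
    waveVector_dotProduct_self hη hψη, q₁]
  ring

/-- Since η·∇b = 0, the product of the wave vector with ∇b has no part of order r and is absorbed
into `q₂`; r² cancels λ. -/
theorem momentum_ansatz₂ (hη : ‖η‖ = 1) (hψ : ContDiff ℝ 2 ψ)
    (hψη : toC η ⬝ᵥ grad ψ x = -rdot η (As x)) (hA : DifferentiableAt ℝ A x)
    (hb : Differentiable ℝ b) (hbx : DifferentiableAt ℝ (fderiv ℝ b) x)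
    (hηb : toC η ⬝ᵥ grad b x = 0) :
    ∑ k, (Complex.I * grad (fun y => momentumField Complex.I A (ansatz₂ r η b ψ) y k) x k
        + toC (A x) k * momentumField Complex.I A (ansatz₂ r η b ψ) x k)
        + (V x - r ^ 2) * ansatz₂ r η b ψ x
      = (2 * r * rdot η (A x - As x) * b x + V x * b x - q₂ A b ψ x) * expFactor₂ r η ψ x := by
  have hB : waveVector r η ψ A x ⬝ᵥ grad b x
      = grad ψ x ⬝ᵥ grad b x + grad b x ⬝ᵥ toC (A x) := by
    rw [waveVector, add_dotProduct, add_dotProduct, smul_dotProduct, hηb, smul_zero, zero_add,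
      dotProduct_comm (toC (A x))]
  rw [expFactor₂_eq, ansatz₂_eq, momentum_momentumField_mul_wave Complex.I_mul_I hψ hb hbx hA, hB,
    waveVector_dotProduct_self hη hψη, q₂, dotProduct_comm (grad ψ x) (toC (A x))]
  ring

theorem momentumField_ansatz₂ (hψ : DifferentiableAt ℝ ψ x) (hb : DifferentiableAt ℝ b x) :
    momentumField Complex.I A (ansatz₂ r η b ψ) x
      = expFactor₂ r η ψ x • ((b x * r) • toC η + b x • grad ψ x + Complex.I • grad b x
          + b x • toC (A x)) := by
  ext k
  rw [ansatz₂_eq, momentumField_mul_wave Complex.I_mul_I hψ hb, expFactor₂_eq]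
  simp only [waveVector, Pi.add_apply, Pi.smul_apply, smul_eq_mul]
  ring

end Ansatz

/-! ### The Dirichlet-to-Neumann pairing for Lipschitz magnetic potentials -/

section Representation

variable {n : ℕ} {Ω : Opens (Euc n)} {A : Euc n → Euc n} {V : Euc n → ℝ}

/-- Used to see that the sources g and G are square integrable: they agree almost everywhere with
this expression, which involves only first derivatives of locally Lipschitz fields. -/
theorem memLp_momentum (hΩ : Bornology.IsBounded (Ω : Set (Euc n))) (hA : LocallyLipschitz A)
    (hV : MemLp V (⊤ : ℝ≥0∞) (volume.restrict (Ω : Set (Euc n)))) (ι c : ℂ) {Φ : Euc n → ℂ}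
    (hΦ : LocallyLipschitz Φ) (hΦ' : ∀ k, LocallyLipschitz fun y => grad Φ y k) :
    MemLp (fun x => ∑ k, (ι * grad (fun y => momentumField ι A Φ y k) x k
      + toC (A x) k * momentumField ι A Φ x k) + (V x - c) * Φ x) 2
      (volume.restrict (Ω : Set (Euc n))) := by
  set μ := volume.restrict (Ω : Set (Euc n))
  have hZ : ∀ k, LocallyLipschitz fun y => momentumField ι A Φ y k :=
    locallyLipschitz_momentumField hΦ hΦ' hA
  have hΦm : MemLp Φ 2 μ := memLp_of_continuous hΩ hΦ.continuous
  have h1 : ∀ k, MemLp (fun x => ι * grad (fun y => momentumField ι A Φ y k) x k) 2 μ := fun k =>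
    (memLp_grad hΩ (hZ k) k).const_mul ι
  have h2 : ∀ k, MemLp (fun x => toC (A x) k * momentumField ι A Φ x k) 2 μ := fun k =>
    memLp_of_continuous hΩ ((locallyLipschitz_toC hA k).continuous.mul (hZ k).continuous)
  have h3 : MemLp (fun x => (V x : ℂ) * Φ x) 2 μ := hΦm.mul' hV.ofReal
  have h4 : MemLp (fun x => c * Φ x) 2 μ := hΦm.const_mul c
  have h5 : MemLp (fun x => ∑ k, (ι * grad (fun y => momentumField ι A Φ y k) x k
      + toC (A x) k * momentumField ι A Φ x k)) 2 μ :=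
    memLp_finsetSum Finset.univ fun k _ => (h1 k).add (h2 k)
  simp only [sub_mul]
  exact h5.add (h3.sub h4)

/-- The unique solvability of the Dirichlet problem with datum `Φ₁`, and the representation of the
pairing `S`. -/
theorem pairingS_eq (hΩ : IsAdmissibleDomain Ω) (hA : LocallyLipschitz A)
    (hV : MemLp V (⊤ : ℝ≥0∞) (volume.restrict (Ω : Set (Euc n))))
    {lam r : ℂ} (hlam : lam.im ≠ 0) (hr : r ^ 2 = lam) {η₁ η₂ : Euc n}
    (hη₁ : ‖η₁‖ = 1) (hη₂ : ‖η₂‖ = 1) {As₁ As₂ : Euc n → Euc n} {ψ₁ ψ₂ b : Euc n → ℂ}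
    (hψ₁ : ContDiff ℝ 2 ψ₁) (hψ₂ : ContDiff ℝ 2 ψ₂)
    (hψη₁ : ∀ x, toC η₁ ⬝ᵥ grad ψ₁ x = -rdot η₁ (As₁ x))
    (hψη₂ : ∀ x, toC η₂ ⬝ᵥ grad ψ₂ x = -rdot η₂ (As₂ x))
    (hb : ContDiff ℝ 1 b) (hb' : LocallyLipschitz (fderiv ℝ b))
    (hηb : ∀ x, toC η₂ ⬝ᵥ grad b x = 0) :
    (∃! u : L2 Ω, IsDirichletSolution A V lam (toL2 Ω (ansatz₁ r η₁ ψ₁)) u) ∧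
    IntegrableOn (fun x => (2 * r * rdot η₂ (A x - As₂ x) * b x + (V x : ℂ) * b x - q₂ A b ψ₂ x)
      * expFactor₁₂ r η₁ η₂ ψ₁ ψ₂ x) (Ω : Set (Euc n)) ∧
    pairingS Ω A V lam r η₁ η₂ b ψ₁ ψ₂ =
      (∫ x in (Ω : Set (Euc n)),
          (2 * r * rdot η₂ (A x - As₂ x) * b x + (V x : ℂ) * b x - q₂ A b ψ₂ x)
            * expFactor₁₂ r η₁ η₂ ψ₁ ψ₂ x)
      - Complex.I * (∫ x, expFactor₁₂ r η₁ η₂ ψ₁ ψ₂ x *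
          (((b x * r) • toC η₂ + b x • grad ψ₂ x + Complex.I • grad b x + b x • toC (A x))
            ⬝ᵥ toC (outwardNormal (Ω : Set (Euc n)) x)) ∂(surfaceMeasure (Ω : Set (Euc n))))
      - (∫ x in (Ω : Set (Euc n)),
          schrodingerResolvent Ω A V lam (toL2 Ω (fun y =>
            (2 * r * rdot η₁ (A y - As₁ y) + q₁ A V ψ₁ y) * ansatz₁ r η₁ ψ₁ y)) x
          * (2 * r * rdot η₂ (A x - As₂ x) * b x + (V x : ℂ) * b x - q₂ A b ψ₂ x)
          * expFactor₂ r η₂ ψ₂ x) := by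
  have hΩb := hΩ.bounded
  have hco := boundedCoefficients hΩb hA hV
  set μ := volume.restrict (Ω : Set (Euc n))
  set Φ₁ := ansatz₁ r η₁ ψ₁ with hΦ₁
  set Φ₂ := ansatz₂ r η₂ b ψ₂ with hΦ₂
  have hb1 : ContDiff ℝ 1 (fun _ : Euc n => (1 : ℂ)) := contDiff_const
  have hb1' : LocallyLipschitz (fderiv ℝ (fun _ : Euc n => (1 : ℂ))) := by
    have : fderiv ℝ (fun _ : Euc n => (1 : ℂ)) = fun _ => 0 := by ext; simp
    rw [this]
    exact LocallyLipschitz.const 0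
  have hl₁ : LocallyLipschitz Φ₁ := by
    rw [hΦ₁, ansatz₁_eq]
    exact (hb1.mul (contDiff_wave (hψ₁.of_le one_le_two))).locallyLipschitz
  have hl₂ : LocallyLipschitz Φ₂ := by
    rw [hΦ₂, ansatz₂_eq]
    exact (hb.mul (contDiff_wave (hψ₂.of_le one_le_two))).locallyLipschitz
  have hg₁ : ∀ k, LocallyLipschitz fun y => grad Φ₁ y k := by
    rw [hΦ₁, ansatz₁_eq]
    exact locallyLipschitz_grad_mul_wave hψ₁ hb1 hb1'
  have hg₂ : ∀ k, LocallyLipschitz fun y => grad Φ₂ y k := by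
    rw [hΦ₂, ansatz₂_eq]
    exact locallyLipschitz_grad_mul_wave hψ₂ hb hb'
  have hAd : ∀ᵐ x ∂μ, DifferentiableAt ℝ A x :=
    ae_restrict_of_ae (locallyLipschitz_ae_differentiableAt volume hA)
  have hbd : ∀ᵐ x ∂μ, DifferentiableAt ℝ (fderiv ℝ b) x :=
    ae_restrict_of_ae (locallyLipschitz_ae_differentiableAt volume hb')
  have hm₁ : MemLp Φ₁ 2 μ := memLp_of_continuous hΩb hl₁.continuous
  set g : Euc n → ℂ := fun y => (2 * r * rdot η₁ (A y - As₁ y) + q₁ A V ψ₁ y) * Φ₁ y with hg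
  set G : Euc n → ℂ := fun x =>
    (2 * r * rdot η₂ (A x - As₂ x) * b x + (V x : ℂ) * b x - q₂ A b ψ₂ x) * expFactor₂ r η₂ ψ₂ x
    with hG
  have e₁ : ∀ᵐ x ∂μ, ∑ k, (-Complex.I * grad (fun y => momentumField (-Complex.I) A Φ₁ y k) x k
        + toC (A x) k * momentumField (-Complex.I) A Φ₁ x k) + V x * Φ₁ x
      = g x + lam * Φ₁ x := by
    filter_upwards [hAd] with x hx
    rw [← hr]
    exact momentum_ansatz₁ hη₁ hψ₁ (hψη₁ x) hx
  have e₂ : ∀ᵐ x ∂μ, ∑ k, (Complex.I * grad (fun y => momentumField Complex.I A Φ₂ y k) x k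
        + toC (A x) k * momentumField Complex.I A Φ₂ x k) + (V x - lam) * Φ₂ x = G x := by
    filter_upwards [hAd, hbd] with x hx hx'
    rw [← hr]
    exact momentum_ansatz₂ hη₂ hψ₂ (hψη₂ x) hx (hb.differentiable one_ne_zero) hx' (hηb x)
  have hgm : MemLp g 2 μ := by
    refine (memLp_congr_ae ?_).1 (memLp_momentum hΩb hA hV (-Complex.I) lam hl₁ hg₁)
    filter_upwards [e₁] with x hx
    linear_combination hx
  have hGm : MemLp G 2 μ :=
    (memLp_congr_ae e₂).1 (memLp_momentum hΩb hA hV Complex.I lam hl₂ hg₂)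
  have hs : SolvesMagnetic A V (toL2 Ω Φ₁) (toL2 Ω g + lam • toL2 Ω Φ₁) := by
    rw [← toL2_const_smul hm₁, ← toL2_add hgm (hm₁.const_smul lam)]
    exact solvesMagnetic_toL2 hΩb hA hV hl₁ hg₁ (hgm.add (hm₁.const_smul lam)) e₁
  have hiff := fun u => isDirichletSolution_iff (u := u) hco hlam hs
  have hv := (schrodingerResolvent_mem_graph (resolventExists hco hlam) (toL2 Ω g)).1
  set v := schrodingerResolvent Ω A V lam (toL2 Ω g) with hvdef
  have hex : ∃! u : L2 Ω, IsDirichletSolution A V lam (toL2 Ω Φ₁) u :=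
    ⟨toL2 Ω Φ₁ - v, (hiff _).2 rfl, fun u hu => (hiff u).1 hu⟩
  -- Uniqueness identifies the solution picked by choice with the explicit one.
  have hds : dirichletSolution A V lam (toL2 Ω Φ₁) = toL2 Ω Φ₁ - v := by
    rw [dirichletSolution, dif_pos hex.exists]
    exact (hiff _).1 hex.exists.choose_spec
  have hprod : ∀ x, Φ₁ x * G x
      = (2 * r * rdot η₂ (A x - As₂ x) * b x + (V x : ℂ) * b x - q₂ A b ψ₂ x)
        * expFactor₁₂ r η₁ η₂ ψ₁ ψ₂ x := fun x => by
    rw [← ansatz₁_mul_expFactor₂]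
    ring
  have hi : Integrable (fun x => Φ₁ x * G x) μ := hm₁.integrable_mul hGm
  refine ⟨hex, hi.congr (ae_of_all _ hprod), ?_⟩
  have hS := normalTracePairing_covariantGrad hΩ hA hV hv hl₁ hl₂ hg₂ ((hiff _).2 rfl).1 e₂
  rw [pairingS, dnPairing, hds, hS]
  have t1 : ∫ x in (Ω : Set (Euc n)), (toL2 Ω Φ₁ - v) x * G x
      = (∫ x in (Ω : Set (Euc n)),
          (2 * r * rdot η₂ (A x - As₂ x) * b x + (V x : ℂ) * b x - q₂ A b ψ₂ x)
            * expFactor₁₂ r η₁ η₂ ψ₁ ψ₂ x)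
        - ∫ x in (Ω : Set (Euc n)),
          v x * (2 * r * rdot η₂ (A x - As₂ x) * b x + (V x : ℂ) * b x - q₂ A b ψ₂ x)
            * expFactor₂ r η₂ ψ₂ x := by
    simp only [← hprod, mul_assoc (v _)]
    rw [← integral_sub hi (integrable_L2_mul v hGm)]
    refine integral_congr_ae ?_
    filter_upwards [Lp.coeFn_sub (toL2 Ω Φ₁) v, coeFn_toL2 hm₁] with x h1 h2
    rw [h1, Pi.sub_apply, h2, sub_mul]
  have t2 : ∀ x, Φ₁ x * (momentumField Complex.I A Φ₂ x
      ⬝ᵥ toC (outwardNormal (Ω : Set (Euc n)) x))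
      = expFactor₁₂ r η₁ η₂ ψ₁ ψ₂ x *
          (((b x * r) • toC η₂ + b x • grad ψ₂ x + Complex.I • grad b x + b x • toC (A x))
            ⬝ᵥ toC (outwardNormal (Ω : Set (Euc n)) x)) := fun x => by
    rw [momentumField_ansatz₂ (hψ₂.differentiable two_ne_zero x) (hb.differentiable one_ne_zero x),
      smul_dotProduct, smul_eq_mul, ← mul_assoc, ansatz₁_mul_expFactor₂]
  rw [t1]
  simp only [t2]
  ring

end Representation

/-! ### Dependence on the values of the magnetic potential in the closed domain -/

section Congruence

variable {n : ℕ} {Ω : Opens (Euc n)} {A A' : Euc n → Euc n}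

theorem solvesMagnetic_congr (h : EqOn A A' Ω) (V : Euc n → ℝ) :
    (SolvesMagnetic A V : L2 Ω → L2 Ω → Prop) = SolvesMagnetic A' V := by
  funext u f
  refine propext (and_congr_right fun _ => forall_congr' fun φ => ?_)
  have e : ∀ k, ∫ x in (Ω : Set (Euc n)),
      (-Complex.I * weakPartial k u x + toC (A x) k * u x) *
        (Complex.I * grad φ x k + toC (A x) k * φ x)
      = ∫ x in (Ω : Set (Euc n)), (-Complex.I * weakPartial k u x + toC (A' x) k * u x) *
        (Complex.I * grad φ x k + toC (A' x) k * φ x) := fun k =>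
    setIntegral_congr_fun Ω.isOpen.measurableSet fun x hx => by simp only [h hx]
  simp only [e]

theorem covariantGrad_congr (h : EqOn A A' Ω) :
    (covariantGrad A : L2 Ω → Fin n → L2 Ω) = covariantGrad A' := by
  funext u k
  refine toL2_congr_ae ((ae_restrict_iff' Ω.isOpen.measurableSet).2 (ae_of_all _ fun x hx => ?_))
  simp only [h hx]

/-- Ω is open, so equality on Ω is equality near each of its points and derivatives agree. -/
theorem divergence_congr (h : EqOn A A' Ω) {x : Euc n} (hx : x ∈ Ω) :
    divergence A x = divergence A' x := by
  have : A =ᶠ[𝓝 x] A' := h.eventuallyEq_of_mem (Ω.isOpen.mem_nhds hx)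
  simp only [divergence, this.fderiv_eq]

theorem q₁_congr (h : EqOn A A' Ω) (V : Euc n → ℝ) (ψ : Euc n → ℂ) {x : Euc n} (hx : x ∈ Ω) :
    q₁ A V ψ x = q₁ A' V ψ x := by
  simp only [q₁, divergence_congr h hx, h hx]

theorem q₂_congr (h : EqOn A A' Ω) (b ψ : Euc n → ℂ) {x : Euc n} (hx : x ∈ Ω) :
    q₂ A b ψ x = q₂ A' b ψ x := by
  simp only [q₂, divergence_congr h hx, h hx]

theorem schrodingerResolvent_congr (h : EqOn A A' Ω) (V : Euc n → ℝ) (lam : ℂ) :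
    schrodingerResolvent Ω A V lam = schrodingerResolvent Ω A' V lam := by
  unfold schrodingerResolvent schrodingerGraph
  rw [solvesMagnetic_congr h]

theorem resolventExists_congr (h : EqOn A A' Ω) (V : Euc n → ℝ) (lam : ℂ) :
    ResolventExists Ω A V lam ↔ ResolventExists Ω A' V lam := by
  unfold ResolventExists schrodingerGraph
  rw [solvesMagnetic_congr h]

theorem isDirichletSolution_congr (h : EqOn A A' Ω) (V : Euc n → ℝ) (lam : ℂ) :
    (IsDirichletSolution A V lam : L2 Ω → L2 Ω → Prop) = IsDirichletSolution A' V lam := by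
  unfold IsDirichletSolution
  rw [solvesMagnetic_congr h]

theorem pairingS_congr (h : EqOn A A' Ω) (V : Euc n → ℝ) (lam r : ℂ) (η₁ η₂ : Euc n)
    (b ψ₁ ψ₂ : Euc n → ℂ) :
    pairingS Ω A V lam r η₁ η₂ b ψ₁ ψ₂ = pairingS Ω A' V lam r η₁ η₂ b ψ₁ ψ₂ := by
  unfold pairingS dnPairing dirichletSolution
  rw [isDirichletSolution_congr h, covariantGrad_congr h]

/-- The representation of the pairing `S` for continuously differentiable magnetic potentials. -/
theorem pairingS_eq_of_contDiffOn (hΩ : IsAdmissibleDomain Ω)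
    (hA : ContDiffOn ℝ 1 A (closure (Ω : Set (Euc n)))) {V : Euc n → ℝ}
    (hV : MemLp V (⊤ : ℝ≥0∞) (volume.restrict (Ω : Set (Euc n))))
    {lam r : ℂ} (hlam : lam.im ≠ 0) (hr : r ^ 2 = lam) {η₁ η₂ : Euc n}
    (hη₁ : ‖η₁‖ = 1) (hη₂ : ‖η₂‖ = 1) {As₁ As₂ : Euc n → Euc n}
    (hAs₁ : ContDiff ℝ ∞ As₁) (hAs₁c : HasCompactSupport As₁)
    (hAs₂ : ContDiff ℝ ∞ As₂) (hAs₂c : HasCompactSupport As₂)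
    {b : Euc n → ℂ} (hb : IsW2Infty b) (hηb : ∀ x, toC η₂ ⬝ᵥ grad b x = 0) :
    ResolventExists Ω A V lam ∧
    (∃! u : L2 Ω, IsDirichletSolution A V lam (toL2 Ω (ansatz₁ r η₁ (phase η₁ As₁))) u) ∧
    IntegrableOn (fun x => (2 * r * rdot η₂ (A x - As₂ x) * b x + (V x : ℂ) * b x
        - q₂ A b (phase η₂ As₂) x) * expFactor₁₂ r η₁ η₂ (phase η₁ As₁) (phase η₂ As₂) x)
      (Ω : Set (Euc n)) ∧
    IntegrableOn (fun x => rdot η₂ (A x - As₂ x)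
        * expFactor₁₂ r η₁ η₂ (phase η₁ As₁) (phase η₂ As₂) x * b x) (Ω : Set (Euc n)) ∧
    pairingS Ω A V lam r η₁ η₂ b (phase η₁ As₁) (phase η₂ As₂) =
      (∫ x in (Ω : Set (Euc n)),
          (2 * r * rdot η₂ (A x - As₂ x) * b x + (V x : ℂ) * b x - q₂ A b (phase η₂ As₂) x)
            * expFactor₁₂ r η₁ η₂ (phase η₁ As₁) (phase η₂ As₂) x)
      - Complex.I * (∫ x, expFactor₁₂ r η₁ η₂ (phase η₁ As₁) (phase η₂ As₂) x *
          (((b x * r) • toC η₂ + b x • grad (phase η₂ As₂) x + Complex.I • grad b x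
            + b x • toC (A x)) ⬝ᵥ toC (outwardNormal (Ω : Set (Euc n)) x))
          ∂(surfaceMeasure (Ω : Set (Euc n))))
      - (∫ x in (Ω : Set (Euc n)),
          schrodingerResolvent Ω A V lam (toL2 Ω (fun y =>
            (2 * r * rdot η₁ (A y - As₁ y) + q₁ A V (phase η₁ As₁) y)
              * ansatz₁ r η₁ (phase η₁ As₁) y)) x
          * (2 * r * rdot η₂ (A x - As₂ x) * b x + (V x : ℂ) * b x - q₂ A b (phase η₂ As₂) x)
          * expFactor₂ r η₂ (phase η₂ As₂) x) := by
  -- The identity is proved for a Lipschitz extension A' and transported back to A.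
  obtain ⟨A', K, hA', hAA⟩ := exists_lipschitzWith_eqOn_closure hΩ hA
  have hl := hA'.locallyLipschitz
  have h : EqOn A A' Ω := hAA.mono subset_closure
  obtain ⟨K', hK'⟩ := hb.lipschitz_fderiv
  have hm : MeasurableSet (Ω : Set (Euc n)) := Ω.isOpen.measurableSet
  have hψ₁ := contDiff_phase hη₁ hAs₁ hAs₁c
  have hψ₂ := contDiff_phase hη₂ hAs₂ hAs₂c
  obtain ⟨h1, h2, h3⟩ := pairingS_eq hΩ hl hV hlam hr hη₁ hη₂ (As₁ := As₁) (As₂ := As₂) hψ₁ hψ₂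
    (fun x => by rw [toC_dotProduct_grad, fderiv_phase hη₁ hAs₁ hAs₁c])
    (fun x => by rw [toC_dotProduct_grad, fderiv_phase hη₂ hAs₂ hAs₂c])
    hb.contDiff hK'.locallyLipschitz hηb
  have hco := boundedCoefficients hΩ.bounded hl hV
  refine ⟨(resolventExists_congr h V lam).2 (resolventExists hco hlam), ?_, ?_, ?_, ?_⟩
  · rwa [isDirichletSolution_congr h]
  · exact h2.congr_fun (fun x hx => by simp only [h hx, q₂_congr h _ _ hx]) hm
  · have hc : Continuous fun x => rdot η₂ (A' x - As₂ x)
        * expFactor₁₂ r η₁ η₂ (phase η₁ As₁) (phase η₂ As₂) x * b x := by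
      have c1 := hA'.continuous
      have c2 := hAs₂.continuous
      have c3 := hψ₁.continuous
      have c4 := hψ₂.continuous
      have c5 := hb.contDiff.continuous
      unfold rdot expFactor₁₂ rdot
      fun_prop
    refine IntegrableOn.congr_fun
      (memLp_one_iff_integrable.1 (memLp_of_continuous hΩ.bounded hc)) (fun x hx => ?_) hm
    simp only [h hx]
  · rw [pairingS_congr h, h3, schrodingerResolvent_congr h]
    have t0 : toL2 Ω (fun y => (2 * r * rdot η₁ (A' y - As₁ y) + q₁ A' V (phase η₁ As₁) y)
          * ansatz₁ r η₁ (phase η₁ As₁) y)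
        = toL2 Ω (fun y => (2 * r * rdot η₁ (A y - As₁ y) + q₁ A V (phase η₁ As₁) y)
          * ansatz₁ r η₁ (phase η₁ As₁) y) := by
      refine toL2_congr_ae ((ae_restrict_iff' hm).2 (ae_of_all _ fun x hx => ?_))
      simp only [h hx, q₁_congr h _ _ hx]
    rw [t0]
    congr 1
    · congr 1
      · exact setIntegral_congr_fun hm fun x hx => by simp only [h hx, q₂_congr h _ _ hx]
      · congr 1
        -- The boundary integral is the one place where agreement on the closure, and not only on Ω,
        -- is used.
        exact setIntegral_congr_fun isClosed_frontier.measurableSet fun x hx => by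
          simp only [hAA (frontier_subset_closure hx)]
    · exact setIntegral_congr_fun hm fun x hx => by simp only [h hx, q₂_congr h _ _ hx]

end Congruence

end MagneticSchrodinger

theorem propositionl1 {n : ℕ} (hn : 2 ≤ n)
    (Ω : Opens (Euc n)) (hΩ : IsAdmissibleDomain Ω)
    (A₁ A₂ : Euc n → Euc n)
    (hA₁ : ContDiffOn ℝ 1 A₁ (closure (Ω : Set (Euc n))))
    (hA₂ : ContDiffOn ℝ 1 A₂ (closure (Ω : Set (Euc n))))
    (V₁ V₂ : Euc n → ℝ)
    (hV₁ : MemLp V₁ (⊤ : ℝ≥0∞) (volume.restrict (Ω : Set (Euc n))))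
    (hV₂ : MemLp V₂ (⊤ : ℝ≥0∞) (volume.restrict (Ω : Set (Euc n))))
    (As₁ As₂ : Euc n → Euc n)
    (hAs₁ : ContDiff ℝ ∞ As₁) (hAs₁c : HasCompactSupport As₁)
    (hAs₂ : ContDiff ℝ ∞ As₂) (hAs₂c : HasCompactSupport As₂)
    (lam r : ℂ) (hlam : lam.im ≠ 0) (hr : r ^ 2 = lam)
    (η₁ η₂ : Euc n) (hη₁ : ‖η₁‖ = 1) (hη₂ : ‖η₂‖ = 1)
    (ψ₁ ψ₂ : Euc n → ℂ) (hψ₁ : ψ₁ = phase η₁ As₁) (hψ₂ : ψ₂ = phase η₂ As₂)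
    (b₂ : Euc n → ℂ) (hb₂ : IsW2Infty b₂) (hηb₂ : ∀ x, toC η₂ ⬝ᵥ grad b₂ x = 0) :
    (ResolventExists Ω A₁ V₁ lam ∧ ResolventExists Ω A₂ V₂ lam) ∧
    ((∃! u : L2 Ω, IsDirichletSolution A₁ V₁ lam (toL2 Ω (ansatz₁ r η₁ ψ₁)) u) ∧
      (∃! u : L2 Ω, IsDirichletSolution A₂ V₂ lam (toL2 Ω (ansatz₁ r η₁ ψ₁)) u)) ∧
    pairingS Ω A₁ V₁ lam r η₁ η₂ b₂ ψ₁ ψ₂ =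
      2 * r * (∫ x in (Ω : Set (Euc n)),
          rdot η₂ (A₁ x - As₂ x) * expFactor₁₂ r η₁ η₂ ψ₁ ψ₂ x * b₂ x)
      + (∫ x in (Ω : Set (Euc n)),
          ((V₁ x : ℂ) * b₂ x - q₂ A₁ b₂ ψ₂ x) * expFactor₁₂ r η₁ η₂ ψ₁ ψ₂ x)
      - Complex.I * (∫ x, expFactor₁₂ r η₁ η₂ ψ₁ ψ₂ x *
          (((b₂ x * r) • toC η₂ + b₂ x • grad ψ₂ x + Complex.I • grad b₂ x + b₂ x • toC (A₁ x))
            ⬝ᵥ toC (outwardNormal (Ω : Set (Euc n)) x)) ∂(surfaceMeasure (Ω : Set (Euc n))))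
      - (∫ x in (Ω : Set (Euc n)),
          schrodingerResolvent Ω A₁ V₁ lam (toL2 Ω (fun y =>
            (2 * r * rdot η₁ (A₁ y - As₁ y) + q₁ A₁ V₁ ψ₁ y) * ansatz₁ r η₁ ψ₁ y)) x
          * (2 * r * rdot η₂ (A₁ x - As₂ x) * b₂ x + (V₁ x : ℂ) * b₂ x - q₂ A₁ b₂ ψ₂ x)
          * expFactor₂ r η₂ ψ₂ x) ∧
    pairingS Ω A₂ V₂ lam r η₁ η₂ b₂ ψ₁ ψ₂ =
      (∫ x in (Ω : Set (Euc n)),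
          (2 * r * rdot η₂ (A₂ x - As₂ x) * b₂ x + (V₂ x : ℂ) * b₂ x - q₂ A₂ b₂ ψ₂ x)
            * expFactor₁₂ r η₁ η₂ ψ₁ ψ₂ x)
      - Complex.I * (∫ x, expFactor₁₂ r η₁ η₂ ψ₁ ψ₂ x *
          (((b₂ x * r) • toC η₂ + b₂ x • grad ψ₂ x + Complex.I • grad b₂ x + b₂ x • toC (A₂ x))
            ⬝ᵥ toC (outwardNormal (Ω : Set (Euc n)) x)) ∂(surfaceMeasure (Ω : Set (Euc n))))
      - (∫ x in (Ω : Set (Euc n)),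
          schrodingerResolvent Ω A₂ V₂ lam (toL2 Ω (fun y =>
            (2 * r * rdot η₁ (A₂ y - As₁ y) + q₁ A₂ V₂ ψ₁ y) * ansatz₁ r η₁ ψ₁ y)) x
          * (2 * r * rdot η₂ (A₂ x - As₂ x) * b₂ x + (V₂ x : ℂ) * b₂ x - q₂ A₂ b₂ ψ₂ x)
          * expFactor₂ r η₂ ψ₂ x) := by
  subst hψ₁ hψ₂
  obtain ⟨hR₁, hD₁, hi, hi', hS₁⟩ := pairingS_eq_of_contDiffOn hΩ hA₁ hV₁ hlam hr hη₁ hη₂ hAs₁ hAs₁c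
    hAs₂ hAs₂c hb₂ hηb₂
  obtain ⟨hR₂, hD₂, -, -, hS₂⟩ := pairingS_eq_of_contDiffOn hΩ hA₂ hV₂ hlam hr hη₁ hη₂ hAs₁ hAs₁c
    hAs₂ hAs₂c hb₂ hηb₂
  refine ⟨⟨hR₁, hR₂⟩, ⟨hD₁, hD₂⟩, ?_, hS₂⟩
  rw [hS₁]
  congr 2
  -- Splitting the volume term of S₁ needs the integrability of the whole and of the part of order
  -- √λ; the remaining part is their difference.
  rw [← integral_const_mul, ← sub_eq_iff_eq_add', ← integral_sub hi (hi'.const_mul _)]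
  refine integral_congr_ae (ae_of_all _ fun x => ?_)
  ring
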